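/- Let $\mathfrak g$ be a finite-dimensional simple real Lie algebra and $h\in\mathfrak g$ a non-symmetric Euler element: $\operatorname{ad}h\neq0$ is diagonalizable with spectrum in $\{-1,0,1\}$, and $-h\notin \mathrm{Inn}(\mathfrak g)h$, where $\mathrm{Inn}(\mathfrak g)=\langle e^{\operatorname{ad}\mathfrak g}\rangle$. Let $\sigma_h=e^{\pi i\operatorname{ad}h}$ and let $G=\mathrm{Inn}(\mathfrak g)\rtimes\{1,\sigma_h\}$. Let $U$ be a strongly continuous (anti-)unitary representation of $G$ on a complex Hilbert space $\mathcal H$ (unitary on $G^\uparrow=\mathrm{Inn}(\mathfrak g)$, antiunitary on $G\setminus G^\uparrow$) that is non-trivial on $\mathrm{Inn}(\mathfrak g)$. Let $\mathfrak b\subseteq\mathfrak g$ be a Lie subalgebra containing $h$ and isomorphic to $\mathfrak{gl}_2(\mathbb R)$, and let $\psi:\mathfrak{sl}_2(\mathbb R)\to[\mathfrak b,\mathfrak b]$ be an isomorphism such that $h=h_c-h_1$ with $h_c$ central in $\mathfrak b$ and $h_1=\psi(\sigma_1)$, $\sigma_1=\frac12\begin{pmatrix}0&1\\1&0\end{pmatrix}$.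 For a real subspace $\mathsf H\subseteq\mathcal H$ write $\mathsf H'=\{\xi:\operatorname{Im}\langle\xi,\eta\rangle=0\ \forall\eta\in\mathsf H\}$. For a standard subspace $\mathsf H$ let $J_{\mathsf H}\Delta_{\mathsf H}^{1/2}$ be the polar decomposition of the operator $\xi+i\eta\mapsto\xi-i\eta$ on $\mathsf H+i\mathsf H$. Let $\mathrm{dS}^2=\{x\in\mathbb R^{1+2}: x_1^2+x_2^2-x_0^2=1\}$, on which $g\in\mathrm{SL}_2(\mathbb R)$ acts by $\Lambda(g)$, where $(\Lambda(g)x)^\sim=g\tilde xg^{-1}$ and $\tilde x=\frac12\begin{pmatrix}x_1&-x_0-x_2\\x_0-x_2&-x_1\end{pmatrix}$. Wedges are the sets $W=\Lambda(g)W_{x_1}$ with $W_{x_1}=\{x\in\mathrm{dS}^2:|x_0|<x_1\}$, and $W'$ denotes the causal complement of $W$ (the interior of the set of points spacelike to all of $W$), which is again a wedge. The boost group of $W=\Lambda(g)W_{x_1}$ is $\lambda_W(t)=\Lambda(g\exp(t\sigma_1)g^{-1})$. A net $W\mapsto\mathsf N(W)$ of standard subspaces is Lorentz covariant for a representation $V$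 of $\mathrm{SL}_2(\mathbb R)$ if $\mathsf N(\Lambda(g)W)=V(g)\mathsf N(W)$ for all $g,W$, and modular covariant if $\Delta_{\mathsf N(W_a)}^{-it}\mathsf N(W_b)=\mathsf N(\lambda_{W_a}(2\pi t)W_b)$ for all wedges $W_a,W_b$ and $t\in\mathbb R$. Then there are a homomorphism $\rho:\mathrm{SL}_2(\mathbb R)\to\mathrm{Inn}(\mathfrak g)$ with $\rho(\exp X)=e^{\operatorname{ad}\psi(X)}$ for all $X\in\mathfrak{sl}_2(\mathbb R)$, and a standard subspace $\mathsf N_U(W_h)$ with $J_{\mathsf N_U(W_h)}=U(\sigma_h)$ and $\Delta_{\mathsf N_U(W_h)}^{-it/2\pi}=U(e^{t\operatorname{ad}h})$ for $t\in\mathbb R$. The standard subspace $\mathsf N_U(W_h)'$ has the modular objects $J=U(\sigma_h)$ and $\Delta^{-it/2\pi}=U(e^{-t\operatorname{ad}h})$, that is, $\mathsf N_U(W_{-h})=\mathsf N_U(W_h)'$. With $V=U\circ\rho$, there are well-defined nets of standard subspaces $\mathsf N$, $\mathsf K$ on the wedges of $\mathrm{dS}^2$ with $$\mathsf N(\Lambda(g)W_{x_1})=V(g)\mathsf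 N_U(W_h),\qquad \mathsf K(\Lambda(g)W_{x_1}')=V(g)\mathsf N_U(W_h)'\qquad(g\in\mathrm{SL}_2(\mathbb R)).$$ Both are Lorentz covariant for $V$, neither is modular covariant, and $\mathsf N(W')=\mathsf K(W)'$ for every wedge $W$. The net $\tilde{\mathsf H}(W)=\mathsf N(W)\oplus\mathsf K(W)\subseteq\mathcal H\oplus\mathcal H$ of standard subspaces is Lorentz covariant for $\tilde V=V\oplus V$ and is not modular covariant. The operator $Z(\xi,\eta)=(\eta,\xi)$ commutes with $\tilde V(\mathrm{SL}_2(\mathbb R))$, and $\tilde{\mathsf H}$ is twisted Haag dual with respect to $Z$: $$\tilde{\mathsf H}(W')=Z\,\tilde{\mathsf H}(W)'\qquad\text{for every wedge }W.$$ -/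

import Mathlib

open scoped MatrixGroups Pointwise ComplexConjugate

noncomputable section

/-! ### Standard subspaces: images, direct sums, modular objects -/

namespace StandardSubspace

variable {H : Type*} [NormedAddCommGroup H] [InnerProductSpace ℂ H]

/-- The image `u S` of a standard subspace `S` under a unitary operator `u`. -/
def map (u : H ≃ₗᵢ[ℂ] H) (S : StandardSubspace H) : StandardSubspace H :=
  have hmul : (S.toClosedSubmodule.mapEquiv
      (u.toContinuousLinearEquiv.restrictScalars ℝ)).mulI =
      S.toClosedSubmodule.mulI.mapEquiv (u.toContinuousLinearEquiv.restrictScalars ℝ) := by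
    apply SetLike.ext
    intro x
    simp only [ClosedSubmodule.mem_mapEquiv_iff]
    have : u.symm ((scalarSMulCLE H Complex.UnitI).symm x) =
        (scalarSMulCLE H Complex.UnitI).symm (u.symm x) := by
      simp [Units.smul_def]
    exact Iff.of_eq (congrArg (· ∈ S.toClosedSubmodule) this)
  { toClosedSubmodule := S.toClosedSubmodule.mapEquiv
      (u.toContinuousLinearEquiv.restrictScalars ℝ)
    IsSeparating := by
      rw [hmul, ← ClosedSubmodule.mapEquiv_inf_eq, S.IsSeparating,
        ClosedSubmodule.mapEquiv_bot_eq_bot]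
    IsCyclic := by
      rw [hmul, ← ClosedSubmodule.mapEquiv_sup_eq, S.IsCyclic,
        ClosedSubmodule.mapEquiv_top_eq_top] }

theorem mem_map {u : H ≃ₗᵢ[ℂ] H} {S : StandardSubspace H} {x : H} :
    x ∈ (S.map u).toClosedSubmodule ↔ u.symm x ∈ S.toClosedSubmodule :=
  ClosedSubmodule.mem_mapEquiv_iff _ _ _

theorem mem_mulI_iff {C : ClosedSubmodule ℝ H} {x : H} :
    x ∈ C.mulI ↔ Complex.I • x ∈ C := by
  rw [ClosedSubmodule.mulI, ClosedSubmodule.mem_mapEquiv_iff]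
  have : (scalarSMulCLE H Complex.UnitI).symm x = -(Complex.I • x) := by
    simp [Units.smul_def, Complex.UnitI]
  rw [this]
  exact neg_mem_iff (S := Submodule ℝ H) (H := C.toSubmodule)

/-- The closed real subspace `S ⊕ T` of the Hilbert direct sum. -/
def prodClosed (S T : ClosedSubmodule ℝ H) : ClosedSubmodule ℝ (WithLp 2 (H × H)) where
  carrier := {x | x.fst ∈ S ∧ x.snd ∈ T}
  add_mem' := fun ha hb => ⟨add_mem ha.1 hb.1, add_mem ha.2 hb.2⟩
  zero_mem' := ⟨zero_mem _, zero_mem _⟩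
  smul_mem' := fun c _ hx =>
    ⟨S.toSubmodule.smul_mem c hx.1, T.toSubmodule.smul_mem c hx.2⟩
  isClosed' := by
    refine IsClosed.inter ?_ ?_
    · exact S.isClosed.preimage (by fun_prop)
    · exact T.isClosed.preimage (by fun_prop)

/-- The direct sum `S ⊕ T` as a standard subspace of the Hilbert direct sum. -/
def prod (S T : StandardSubspace H) : StandardSubspace (WithLp 2 (H × H)) where
  toClosedSubmodule := prodClosed S.toClosedSubmodule T.toClosedSubmodule
  IsSeparating := by
    apply SetLike.ext
    intro x
    rw [ClosedSubmodule.mem_inf, mem_mulI_iff, ClosedSubmodule.mem_bot]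
    constructor
    · rintro ⟨⟨h1, h2⟩, h3, h4⟩
      have e1 : x.fst ∈ S.toClosedSubmodule ⊓ S.toClosedSubmodule.mulI :=
        ClosedSubmodule.mem_inf.2 ⟨h1, mem_mulI_iff.2 h3⟩
      have e2 : x.snd ∈ T.toClosedSubmodule ⊓ T.toClosedSubmodule.mulI :=
        ClosedSubmodule.mem_inf.2 ⟨h2, mem_mulI_iff.2 h4⟩
      rw [S.IsSeparating, ClosedSubmodule.mem_bot] at e1
      rw [T.IsSeparating, ClosedSubmodule.mem_bot] at e2
      exact WithLp.ofLp_injective 2 (Prod.ext e1 e2)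
    · rintro rfl
      refine ⟨⟨zero_mem _, zero_mem _⟩, ?_, ?_⟩
      · simp
      · simp
  IsCyclic := by
    set P := prodClosed S.toClosedSubmodule T.toClosedSubmodule
    have hP : ∀ {x : WithLp 2 (H × H)}, x ∈ P ↔
      x.fst ∈ S.toClosedSubmodule ∧ x.snd ∈ T.toClosedSubmodule := Iff.rfl
    have hl : P ≤ P ⊔ P.mulI := le_sup_left (a := P) (b := P.mulI)
    have hr : P.mulI ≤ P ⊔ P.mulI := le_sup_right (a := P) (b := P.mulI)
    let i1 : H →L[ℝ] WithLp 2 (H × H) :=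
      { toFun := fun v => WithLp.toLp 2 (v, 0)
        map_add' := fun v w => by rw [← WithLp.toLp_add]; simp
        map_smul' := fun c v => by
          apply WithLp.ofLp_injective 2
          exact Prod.ext rfl (smul_zero c).symm
        cont := by fun_prop }
    let i2 : H →L[ℝ] WithLp 2 (H × H) :=
      { toFun := fun v => WithLp.toLp 2 (0, v)
        map_add' := fun v w => by rw [← WithLp.toLp_add]; simp
        map_smul' := fun c v => by
          apply WithLp.ofLp_injective 2
          exact Prod.ext (smul_zero c).symm rfl
        cont := by fun_prop }
    have k1 : S.toClosedSubmodule ⊔ S.toClosedSubmodule.mulI ≤ (P ⊔ P.mulI).comap i1 := by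
      refine sup_le (fun v hv => ?_) (fun v hv => ?_)
      · exact hl (hP.2 ⟨hv, zero_mem _⟩)
      · refine hr (mem_mulI_iff.2 (hP.2 ⟨?_, ?_⟩))
        · exact mem_mulI_iff.1 hv
        · change Complex.I • (0 : H) ∈ _
          rw [smul_zero]
          exact zero_mem _
    have k2 : T.toClosedSubmodule ⊔ T.toClosedSubmodule.mulI ≤ (P ⊔ P.mulI).comap i2 := by
      refine sup_le (fun v hv => ?_) (fun v hv => ?_)
      · exact hl (hP.2 ⟨zero_mem _, hv⟩)
      · refine hr (mem_mulI_iff.2 (hP.2 ⟨?_, ?_⟩))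
        · change Complex.I • (0 : H) ∈ _
          rw [smul_zero]
          exact zero_mem _
        · exact mem_mulI_iff.1 hv
    rw [S.IsCyclic] at k1
    rw [T.IsCyclic] at k2
    refine top_le_iff.1 (fun x _ => ?_)
    have hx : x = i1 x.fst + i2 x.snd := by
      apply WithLp.ofLp_injective 2
      exact Prod.ext (add_zero _).symm (zero_add _).symm
    rw [hx]
    exact add_mem (k1 (ClosedSubmodule.mem_top (x := x.fst)))
      (k2 (ClosedSubmodule.mem_top (x := x.snd)))

theorem mem_prod {S T : StandardSubspace H} {x : WithLp 2 (H × H)} :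
    x ∈ (S.prod T).toClosedSubmodule ↔
      x.fst ∈ S.toClosedSubmodule ∧ x.snd ∈ T.toClosedSubmodule :=
  Iff.rfl


/-- The graph of the Tomita operator `ξ + iη ↦ ξ - iη` on `S + iS`. -/
def IsTomita (S : StandardSubspace H) (v w : H) : Prop :=
  ∃ ξ ∈ S.toClosedSubmodule, ∃ η ∈ S.toClosedSubmodule,
    v = ξ + Complex.I • η ∧ w = ξ - Complex.I • η

end StandardSubspace

section Modular

variable {H : Type*} [NormedAddCommGroup H] [InnerProductSpace ℂ H]

/-- The graph of `Δ^{1/2}`, for the positive injective self-adjoint operator `Δ` whose imaginary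
powers are the unitary one-parameter group `V t = Δ^{it}`: the vector `v` lies in the domain of
`Δ^{1/2}` and `Δ^{1/2} v = w` iff the orbit map `t ↦ V t v` extends continuously to the closed strip
`-1/2 ≤ Im z ≤ 0`, holomorphically in the interior, with value `w` at `z = -i/2`
(so `Δ^{1/2}` is the analytic generator `V_{-i/2}`). -/
def IsSqrtGraph (V : ℝ → H ≃ₗᵢ[ℂ] H) (v w : H) : Prop :=
  ∃ F : ℂ → H,
    ContinuousOn F {z : ℂ | -(1 / 2) ≤ z.im ∧ z.im ≤ 0} ∧
    DifferentiableOn ℂ F {z : ℂ | -(1 / 2) < z.im ∧ z.im < 0} ∧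
    (∀ t : ℝ, F t = V t v) ∧
    F (-(Complex.I / 2)) = w

/-- `J` and `V` are the modular conjugation `J_S` and the modular group `V t = Δ_S^{it}` of the
standard subspace `S`: `J` is a conjugation, `V` a strongly continuous unitary one-parameter group,
and the Tomita operator of `S` has the polar decomposition `J Δ^{1/2}`, domains included. -/
structure IsModularPair (S : StandardSubspace H) (J : H ≃ₗᵢ⋆[ℂ] H) (V : ℝ → H ≃ₗᵢ[ℂ] H) :
    Prop where
  involutive : ∀ v, J (J v) = v
  map_add : ∀ s t, V (s + t) = V s * V t
  continuous : ∀ v, Continuous fun t => V t v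
  polar : ∀ v w, S.IsTomita v w ↔ ∃ u, IsSqrtGraph V v u ∧ w = J u

end Modular

/-! ### Two-dimensional de Sitter space, its wedges and the action of `SL(2,ℝ)` -/

/-- The matrix `σ₁ = ½ (0 1; 1 0)` in `sl(2,ℝ)`. -/
def sigmaOne : LieAlgebra.SpecialLinear.sl (Fin 2) ℝ :=
  ⟨!![0, 1 / 2; 1 / 2, 0], by
    change Matrix.trace (!![0, 1 / 2; 1 / 2, 0] : Matrix (Fin 2) (Fin 2) ℝ) = 0
    simp [Matrix.trace_fin_two]⟩

theorem det_exp_of_mem_sl (X : LieAlgebra.SpecialLinear.sl (Fin 2) ℝ) :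
    (NormedSpace.exp (X : Matrix (Fin 2) (Fin 2) ℝ)).det = 1 := by
  obtain ⟨X, hX⟩ := X
  change X.trace = 0 at hX
  rw [Matrix.trace_fin_two] at hX
  let w : Matrix (Fin 2) (Fin 2) ℝ := !![0, 1; -1, 0]
  let w' : Matrix (Fin 2) (Fin 2) ℝ := !![0, -1; 1, 0]
  have hww : w * w' = 1 := by
    ext i j
    fin_cases i <;> fin_cases j <;> simp [w, w']
  have hinv : w⁻¹ = w' := Matrix.inv_eq_right_inv hww
  have hu : IsUnit w := IsUnit.of_mul_eq_one w' hww
  have hc : w * X * w⁻¹ = -X.transpose := by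
    rw [hinv]
    ext i j
    fin_cases i <;> fin_cases j <;>
      simp [w, w', Matrix.mul_apply, Matrix.vecMul, dotProduct, Fin.sum_univ_two] <;> linarith
  have h1 := Matrix.exp_conj w X hu
  rw [hc, Matrix.exp_neg, Matrix.exp_transpose, hinv] at h1
  change (NormedSpace.exp X).det = 1
  set E := NormedSpace.exp X with hE
  have hEu : IsUnit E.det := (Matrix.isUnit_iff_isUnit_det _).1 (Matrix.isUnit_exp X)
  have h2 : E.transpose * (w * E * w') = 1 := by
    rw [← h1]
    exact Matrix.mul_nonsing_inv _ (by rwa [Matrix.det_transpose])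
  have h3 := congrFun (congrFun h2 0) 0
  simp [w, w', Matrix.mul_apply, Matrix.vecMul, dotProduct, Fin.sum_univ_two] at h3
  rw [Matrix.det_fin_two]
  linarith

/-- The exponential map `sl(2,ℝ) → SL(2,ℝ)`. -/
def slExp (X : LieAlgebra.SpecialLinear.sl (Fin 2) ℝ) : SL(2, ℝ) :=
  ⟨NormedSpace.exp (X : Matrix (Fin 2) (Fin 2) ℝ), det_exp_of_mem_sl X⟩

/-- `dS² = {x ∈ ℝ^{1+2} : x₁² + x₂² - x₀² = 1}`. -/
def DeSitter : Type :=
  {x : Fin 3 → ℝ // x 1 ^ 2 + x 2 ^ 2 - x 0 ^ 2 = 1}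

namespace DeSitter

instance : TopologicalSpace DeSitter := instTopologicalSpaceSubtype

/-- `x ↦ x̃ = ½ (x₁, -x₀ - x₂; x₀ - x₂, -x₁)`. -/
def toMat (x : Fin 3 → ℝ) : Matrix (Fin 2) (Fin 2) ℝ :=
  !![x 1 / 2, (-x 0 - x 2) / 2; (x 0 - x 2) / 2, -x 1 / 2]

/-- The inverse of `x ↦ x̃` on trace zero matrices. -/
def ofMat (X : Matrix (Fin 2) (Fin 2) ℝ) : Fin 3 → ℝ :=
  ![X 1 0 - X 0 1, X 0 0 - X 1 1, -(X 0 1 + X 1 0)]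

theorem ofMat_toMat (x : Fin 3 → ℝ) : ofMat (toMat x) = x := by
  ext i
  fin_cases i <;> simp [ofMat, toMat] <;> ring

theorem toMat_ofMat {X : Matrix (Fin 2) (Fin 2) ℝ} (hX : X.trace = 0) :
    toMat (ofMat X) = X := by
  rw [Matrix.trace_fin_two] at hX
  ext i j
  fin_cases i <;> fin_cases j <;> simp [ofMat, toMat] <;> linarith

theorem trace_toMat (x : Fin 3 → ℝ) : (toMat x).trace = 0 := by
  simp [toMat, Matrix.trace_fin_two]; ring

theorem det_toMat (x : Fin 3 → ℝ) :
    (toMat x).det = -(x 1 ^ 2 + x 2 ^ 2 - x 0 ^ 2) / 4 := by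
  simp [toMat, Matrix.det_fin_two]; ring

/-- The Lorentz transformation `Λ(g)`, given by `(Λ(g) x)˜ = g x̃ g⁻¹`. -/
def lorentz (g : SL(2, ℝ)) (x : Fin 3 → ℝ) : Fin 3 → ℝ :=
  ofMat ((g : Matrix (Fin 2) (Fin 2) ℝ) * toMat x *
    ((g⁻¹ : SL(2, ℝ)) : Matrix (Fin 2) (Fin 2) ℝ))

theorem coe_mul_inv (g : SL(2, ℝ)) : (g : Matrix (Fin 2) (Fin 2) ℝ) *
    ((g⁻¹ : SL(2, ℝ)) : Matrix (Fin 2) (Fin 2) ℝ) = 1 := by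
  rw [← Matrix.SpecialLinearGroup.coe_mul, mul_inv_cancel, Matrix.SpecialLinearGroup.coe_one]

theorem coe_inv_mul (g : SL(2, ℝ)) : ((g⁻¹ : SL(2, ℝ)) : Matrix (Fin 2) (Fin 2) ℝ) *
    (g : Matrix (Fin 2) (Fin 2) ℝ) = 1 := by
  rw [← Matrix.SpecialLinearGroup.coe_mul, inv_mul_cancel, Matrix.SpecialLinearGroup.coe_one]

theorem toMat_lorentz (g : SL(2, ℝ)) (x : Fin 3 → ℝ) :
    toMat (lorentz g x) = (g : Matrix (Fin 2) (Fin 2) ℝ) * toMat x *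
      ((g⁻¹ : SL(2, ℝ)) : Matrix (Fin 2) (Fin 2) ℝ) := by
  apply toMat_ofMat
  rw [Matrix.trace_mul_comm, ← Matrix.mul_assoc, coe_inv_mul, Matrix.one_mul, trace_toMat]

theorem lorentz_form (g : SL(2, ℝ)) (x : Fin 3 → ℝ) :
    lorentz g x 1 ^ 2 + lorentz g x 2 ^ 2 - lorentz g x 0 ^ 2 =
      x 1 ^ 2 + x 2 ^ 2 - x 0 ^ 2 := by
  have h1 := det_toMat (lorentz g x)
  rw [toMat_lorentz, Matrix.det_mul, Matrix.det_mul, g.det_coe, (g⁻¹).det_coe, one_mul, mul_one,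
    det_toMat] at h1
  linarith

/-- `SL(2,ℝ)` acts on `dS²` through the covering homomorphism `Λ`. -/
instance : MulAction SL(2, ℝ) DeSitter where
  smul g x := ⟨lorentz g x.1, by rw [lorentz_form]; exact x.2⟩
  one_smul x := by
    apply Subtype.ext
    change lorentz 1 x.1 = x.1
    simp [lorentz, ofMat_toMat]
  mul_smul g k x := by
    apply Subtype.ext
    change lorentz (g * k) x.1 = lorentz g (lorentz k x.1)
    rw [lorentz, lorentz, toMat_lorentz, mul_inv_rev, Matrix.SpecialLinearGroup.coe_mul,
      Matrix.SpecialLinearGroup.coe_mul]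
    simp only [Matrix.mul_assoc]

theorem smul_val (g : SL(2, ℝ)) (x : DeSitter) : (g • x).1 = lorentz g x.1 := rfl

/-- The square `(x - y)²` in the Minkowski metric with signature `(1, -1, -1)`. -/
def interval (x y : DeSitter) : ℝ :=
  (x.1 0 - y.1 0) ^ 2 - (x.1 1 - y.1 1) ^ 2 - (x.1 2 - y.1 2) ^ 2

/-- The causal complement `O'`: the interior of the set of points spacelike to all of `O`. -/
def causalCompl (O : Set DeSitter) : Set DeSitter :=
  interior {x | ∀ y ∈ O, interval x y < 0}

/-- The right wedge region `W_{x₁} = {|x₀| < x₁}` in `dS²`. -/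
def rightWedgeRegion : Set DeSitter := {x | |x.1 0| < x.1 1}

/-- The wedge regions in `dS²`: the Lorentz transforms of `W_{x₁}`. -/
abbrev Wedge : Type := MulAction.orbit SL(2, ℝ) rightWedgeRegion

/-- `W_{x₁}` as a wedge. -/
def rightWedge : Wedge := ⟨rightWedgeRegion, MulAction.mem_orbit_self _⟩

theorem lorentz_sub (g : SL(2, ℝ)) (x y : Fin 3 → ℝ) :
    lorentz g (x - y) = lorentz g x - lorentz g y := by
  have h : toMat (x - y) = toMat x - toMat y := by
    ext i j
    fin_cases i <;> fin_cases j <;> simp [toMat] <;> ring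
  rw [lorentz, h, Matrix.mul_sub, Matrix.sub_mul, lorentz, lorentz]
  ext i
  fin_cases i <;> simp [ofMat] <;> ring

theorem interval_smul (g : SL(2, ℝ)) (x y : DeSitter) :
    interval (g • x) (g • y) = interval x y := by
  have h := lorentz_form g (x.1 - y.1)
  rw [lorentz_sub] at h
  simp only [Pi.sub_apply] at h
  simp only [interval, smul_val]
  linarith

instance : ContinuousConstSMul SL(2, ℝ) DeSitter where
  continuous_const_smul g := by
    refine Continuous.subtype_mk (f := fun x : DeSitter => lorentz g x.1) ?_ _
    have h : ∀ i, Continuous fun x : DeSitter => x.1 i := fun i =>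
      (continuous_apply i).comp continuous_subtype_val
    refine continuous_pi fun i => ?_
    have hm : Continuous fun x : DeSitter => toMat x.1 := by
      refine continuous_matrix fun i j => ?_
      have h0 := h 0
      have h1 := h 1
      have h2 := h 2
      fin_cases i <;> fin_cases j <;> simp only [toMat, Matrix.of_apply] <;>
        simp <;> first | exact h1.div_const 2 | exact (h0.neg.sub h2).div_const 2 |
          exact (h0.sub h2).div_const 2 | exact h1.neg.div_const 2
    have hp := (continuous_const.matrix_mul hm).matrix_mul
      (continuous_const (y := ((g⁻¹ : SL(2, ℝ)) : Matrix (Fin 2) (Fin 2) ℝ)))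
      (A := fun x : DeSitter => (g : Matrix (Fin 2) (Fin 2) ℝ) * toMat x.1)
    have he := fun i j => hp.matrix_elem i j
    fin_cases i
    · exact (he 1 0).sub (he 0 1)
    · exact (he 0 0).sub (he 1 1)
    · exact ((he 0 1).add (he 1 0)).neg

theorem causalCompl_smul (g : SL(2, ℝ)) (O : Set DeSitter) :
    causalCompl (g • O) = g • causalCompl O := by
  rw [causalCompl, causalCompl, ← interior_smul]
  congr 1
  ext x
  rw [Set.mem_smul_set_iff_inv_smul_mem]
  constructor
  · intro hx y hy
    have := hx (g • y) (Set.smul_mem_smul_set hy)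
    rwa [← interval_smul g, smul_inv_smul]
  · rintro hx _ ⟨y, hy, rfl⟩
    have := hx y hy
    rwa [← interval_smul g, smul_inv_smul] at this

theorem le_of_spacelike {x : DeSitter} (hx : ∀ y ∈ rightWedgeRegion, interval x y < 0) :
    |x.1 0| ≤ -x.1 1 := by
  have key : ∀ a : ℝ, 0 < a → -2 < a * (x.1 0 - x.1 1) - a⁻¹ * (x.1 0 + x.1 1) := by
    intro a ha
    have hai : 0 < a⁻¹ := inv_pos.2 ha
    have hm : a * a⁻¹ = 1 := mul_inv_cancel₀ ha.ne'
    have := hx ⟨![(a - a⁻¹) / 2, (a + a⁻¹) / 2, 0], by simp; nlinarith⟩ (by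
      change |(a - a⁻¹) / 2| < (a + a⁻¹) / 2
      rw [abs_lt]
      constructor <;> linarith)
    simp [interval] at this
    have h2 := x.2
    nlinarith
  rw [abs_le]
  constructor
  · by_contra! hc
    have hp : x.1 0 - x.1 1 < 0 := by linarith
    set p := x.1 0 - x.1 1
    set q := x.1 0 + x.1 1
    have h := key ((2 + |q|) / (-p) + 1) (by
      have : 0 ≤ (2 + |q|) / (-p) := div_nonneg (by positivity) (by linarith)
      linarith)
    set a := (2 + |q|) / (-p) + 1 with ha
    have h1 : 1 ≤ a := by
      have : 0 ≤ (2 + |q|) / (-p) := div_nonneg (by positivity) (by linarith)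
      linarith
    have h2 : a * p ≤ -(2 + |q|) := by
      have : (2 + |q|) / (-p) * p = -(2 + |q|) := by
        rw [div_neg, neg_mul, div_mul_cancel₀ _ hp.ne]
      rw [ha, add_mul, this]
      linarith
    have h3 : a⁻¹ ≤ 1 := inv_le_one_of_one_le₀ h1
    have h4 : 0 < a⁻¹ := inv_pos.2 (by linarith)
    have h5 : -(a⁻¹ * q) ≤ |q| := by
      nlinarith [neg_abs_le q, abs_nonneg q]
    linarith
  · by_contra! hc
    have hq : 0 < x.1 0 + x.1 1 := by linarith
    set p := x.1 0 - x.1 1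
    set q := x.1 0 + x.1 1
    have hb : 0 ≤ (2 + |p|) / q := by positivity
    have h := key ((2 + |p|) / q + 1)⁻¹ (by positivity)
    rw [inv_inv] at h
    set a := (2 + |p|) / q + 1 with ha
    have h1 : 1 ≤ a := by linarith
    have h2 : 2 + |p| ≤ a * q := by
      have : (2 + |p|) / q * q = 2 + |p| := by field_simp
      rw [ha, add_mul, this]
      linarith
    have h3 : a⁻¹ ≤ 1 := inv_le_one_of_one_le₀ h1
    have h4 : 0 < a⁻¹ := inv_pos.2 (by linarith)
    have h5 : a⁻¹ * p ≤ |p| := by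
      nlinarith [le_abs_self p, abs_nonneg p]
    linarith

theorem causalCompl_rightWedgeRegion :
    causalCompl rightWedgeRegion = {x | |x.1 0| < -x.1 1} := by
  apply Set.Subset.antisymm
  · intro x hx
    have hle := le_of_spacelike (interior_subset hx)
    refine lt_of_le_of_ne hle fun heq => ?_
    have hx1 : x.1 1 ≤ 0 := by linarith [abs_nonneg (x.1 0)]
    have hx2 : x.1 2 ≠ 0 := by
      intro h0
      have h1 := x.2
      have h2 := sq_abs (x.1 0)
      rw [heq] at h2
      rw [h0] at h1
      nlinarith
    let c : ℝ → DeSitter := fun θ =>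
      ⟨![x.1 0, Real.cos θ * x.1 1 - Real.sin θ * x.1 2,
        Real.sin θ * x.1 1 + Real.cos θ * x.1 2], by
        have h1 := x.2
        have h2 := Real.sin_sq_add_cos_sq θ
        simp
        linear_combination h1 + (x.1 1 ^ 2 + x.1 2 ^ 2) * h2⟩
    have hc : Continuous c := by
      refine Continuous.subtype_mk ?_ _
      refine continuous_pi fun i => ?_
      fin_cases i <;> simp <;> fun_prop
    have hc0 : c 0 = x := by
      apply Subtype.ext
      ext i
      fin_cases i <;> simp [c]
    have hopen : IsOpen (c ⁻¹' causalCompl rightWedgeRegion) := isOpen_interior.preimage hc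
    obtain ⟨ε, hε, hball⟩ := Metric.isOpen_iff.1 hopen 0 (by simpa [hc0] using hx)
    have main : ∀ θ : ℝ, |θ| < ε → Real.sin θ * x.1 2 < 0 → False := by
      intro θ hθ hs
      have hm : c θ ∈ causalCompl rightWedgeRegion := hball (by simpa using hθ)
      have hl := le_of_spacelike (interior_subset hm)
      change |x.1 0| ≤ -(Real.cos θ * x.1 1 - Real.sin θ * x.1 2) at hl
      have := Real.cos_le_one θ
      nlinarith
    have hδ : 0 < min (ε / 2) 1 := by positivity
    have hδε : min (ε / 2) 1 < ε := (min_le_left _ _).trans_lt (by linarith)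
    have hsin : 0 < Real.sin (min (ε / 2) 1) :=
      Real.sin_pos_of_pos_of_lt_pi hδ ((min_le_right _ _).trans_lt (by linarith [Real.pi_gt_three]))
    rcases lt_or_gt_of_ne hx2 with h | h
    · exact main (min (ε / 2) 1) (by rwa [abs_of_pos hδ]) (mul_neg_of_pos_of_neg hsin h)
    · refine main (-min (ε / 2) 1) (by rwa [abs_neg, abs_of_pos hδ]) ?_
      rw [Real.sin_neg]
      nlinarith
  · have hcont : ∀ i, Continuous fun x : DeSitter => x.1 i := fun i =>
      (continuous_apply i).comp continuous_subtype_val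
    refine interior_maximal ?_ (isOpen_lt (hcont 0).abs (hcont 1).neg)
    intro x hx y hy
    change |x.1 0| < -x.1 1 at hx
    change |y.1 0| < y.1 1 at hy
    have h1 : |x.1 0 - y.1 0| < y.1 1 - x.1 1 := (abs_sub _ _).trans_lt (by linarith)
    have h2 := sq_lt_sq' (by linarith [abs_nonneg (x.1 0 - y.1 0)]) h1
    rw [sq_abs] at h2
    simp only [interval]
    nlinarith [sq_nonneg (x.1 2 - y.1 2)]

theorem causalCompl_mem_orbit (W : Wedge) :
    causalCompl W.1 ∈ MulAction.orbit SL(2, ℝ) rightWedgeRegion := by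
  obtain ⟨g, hg⟩ := W.2
  have hg' : g • rightWedgeRegion = W.1 := hg
  let r : SL(2, ℝ) := ⟨!![0, 1; -1, 0], by simp [Matrix.det_fin_two]⟩
  have hr : causalCompl rightWedgeRegion = r • rightWedgeRegion := by
    rw [causalCompl_rightWedgeRegion]
    ext x
    rw [Set.mem_smul_set_iff_inv_smul_mem]
    have e : (r⁻¹ • x).1 = ![x.1 0, -x.1 1, -x.1 2] := by
      rw [smul_val, lorentz, inv_inv, Matrix.SpecialLinearGroup.coe_inv]
      ext i
      fin_cases i <;>
        simp [r, ofMat, toMat, Matrix.adjugate_fin_two, Matrix.mul_apply, Fin.sum_univ_two] <;>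
        ring
    change _ ↔ |(r⁻¹ • x).1 0| < (r⁻¹ • x).1 1
    rw [e]
    rfl
  rw [← hg', causalCompl_smul, hr, smul_smul]
  exact MulAction.mem_orbit _ _

/-- The causal complement `W'` of a wedge is again a wedge. -/
def Wedge.compl (W : Wedge) : Wedge := ⟨causalCompl W.1, causalCompl_mem_orbit W⟩

end DeSitter

/-! ### Euler elements and the graded group `Inn(𝔤) ⋊ {1, σ_h}` -/

section LieGroup

variable {𝔤 : Type*} [LieRing 𝔤] [LieAlgebra ℝ 𝔤]

/-- `h` is an Euler element: `ad h` is non-zero and diagonalizable with spectrum in `{-1, 0, 1}`. -/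
def IsEuler (h : 𝔤) : Prop :=
  LieAlgebra.ad ℝ 𝔤 h ≠ 0 ∧
    ⨆ ν ∈ ({-1, 0, 1} : Set ℝ), (LieAlgebra.ad ℝ 𝔤 h).eigenspace ν = ⊤

theorem IsEuler.ad_cube {h : 𝔤} (hE : IsEuler h) (y : 𝔤) : ⁅h, ⁅h, ⁅h, y⁆⁆⁆ = ⁅h, y⁆ := by
  have hy : y ∈ ⨆ ν ∈ ({-1, 0, 1} : Set ℝ), (LieAlgebra.ad ℝ 𝔤 h).eigenspace ν := by
    rw [hE.2]; trivial
  have hle : (⨆ ν ∈ ({-1, 0, 1} : Set ℝ), (LieAlgebra.ad ℝ 𝔤 h).eigenspace ν) ≤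
      LinearMap.ker ((LieAlgebra.ad ℝ 𝔤 h) ^ 3 - LieAlgebra.ad ℝ 𝔤 h) := by
    refine iSup₂_le fun ν hν z hz => ?_
    rw [Module.End.mem_eigenspace_iff, LieAlgebra.ad_apply] at hz
    simp only [Set.mem_insert_iff, Set.mem_singleton_iff] at hν
    simp only [LinearMap.mem_ker, LinearMap.sub_apply, pow_succ, pow_zero, one_mul,
      Module.End.mul_apply, LieAlgebra.ad_apply, hz, lie_smul, smul_smul]
    rcases hν with rfl | rfl | rfl <;> simp
  have := hle hy
  simpa [LinearMap.mem_ker, pow_succ, Module.End.mul_apply, sub_eq_zero] using this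

/-- The Euler involution `σ_h = e^{πi ad h}`, equal to `(-1)^j` on `ker (ad h - j)` for
`j = -1, 0, 1`, that is, `σ_h = 1 - 2 (ad h)²`. -/
def eulerInvolution (h : 𝔤) (hE : IsEuler h) : 𝔤 ≃ₗ[ℝ] 𝔤 :=
  LinearEquiv.ofInvolutive
    (1 - (2 : ℝ) • (LieAlgebra.ad ℝ 𝔤 h * LieAlgebra.ad ℝ 𝔤 h) : Module.End ℝ 𝔤) (by
      intro y
      simp only [LinearMap.sub_apply, LinearMap.smul_apply, Module.End.mul_apply,
        Module.End.one_apply, LieAlgebra.ad_apply, lie_sub, lie_smul, hE.ad_cube]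
      module)

variable [FiniteDimensional ℝ 𝔤]

/-- The exponential `e^A` of an endomorphism of a finite-dimensional real vector space, computed in
coordinates (it does not depend on the basis). -/
def endExp (A : Module.End ℝ 𝔤) : Module.End ℝ 𝔤 :=
  (LinearMap.toMatrixAlgEquiv (Module.finBasis ℝ 𝔤)).symm
    (NormedSpace.exp (LinearMap.toMatrixAlgEquiv (Module.finBasis ℝ 𝔤) A))

theorem endExp_mul_neg (A : Module.End ℝ 𝔤) : endExp A * endExp (-A) = 1 := by
  have h : ∀ M : Matrix (Fin (Module.finrank ℝ 𝔤)) (Fin (Module.finrank ℝ 𝔤)) ℝ,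
      NormedSpace.exp M * NormedSpace.exp (-M) = 1 := fun M => by
    rw [Matrix.exp_neg]
    exact Matrix.mul_nonsing_inv _ ((Matrix.isUnit_iff_isUnit_det _).1 (Matrix.isUnit_exp M))
  unfold endExp
  rw [← map_mul, map_neg, h, map_one]

/-- `e^{ad x}` as an invertible linear map of `𝔤`. -/
def expAd (x : 𝔤) : 𝔤 ≃ₗ[ℝ] 𝔤 :=
  LinearEquiv.ofLinearMap (endExp (LieAlgebra.ad ℝ 𝔤 x)) (endExp (-LieAlgebra.ad ℝ 𝔤 x))
    (endExp_mul_neg _) (by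
      have := endExp_mul_neg (-LieAlgebra.ad ℝ 𝔤 x)
      rwa [neg_neg] at this)

variable (𝔤) in
/-- The group `Inn(𝔤) = ⟨e^{ad 𝔤}⟩` of inner automorphisms. -/
def Inn : Subgroup (𝔤 ≃ₗ[ℝ] 𝔤) := Subgroup.closure (Set.range expAd)

/-- The exponential map `x ↦ e^{ad x}` of `Inn(𝔤)`. -/
def innExp (x : 𝔤) : Inn 𝔤 := ⟨expAd x, Subgroup.subset_closure ⟨x, rfl⟩⟩

/-- The Euler element `h` is symmetric: `-h` lies in the orbit `Inn(𝔤) h`. -/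
def IsSymmetricEuler (h : 𝔤) : Prop := ∃ a : Inn 𝔤, (a : 𝔤 ≃ₗ[ℝ] 𝔤) h = -h

section

attribute [local instance 100] LieRing.ofAssociativeRing

/-- The subalgebra `b` is isomorphic to `gl₂(ℝ)`, the matrices with the commutator bracket. -/
def IsIsoGL2 (b : LieSubalgebra ℝ 𝔤) : Prop :=
  Nonempty (b ≃ₗ⁅ℝ⁆ Matrix (Fin 2) (Fin 2) ℝ)

end

/-- The usual topology of `GL(𝔤)`: the coarsest one for which all matrix coefficients
`a ↦ f (a x)` are continuous. -/
instance glTopology : TopologicalSpace (𝔤 ≃ₗ[ℝ] 𝔤) :=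
  TopologicalSpace.induced (fun a (p : 𝔤 × Module.Dual ℝ 𝔤) => p.2 (a p.1)) inferInstance

/-- The graded group `G = Inn(𝔤) ⋊ {1, σ_h}`, realized as the group of pairs `(a, 1)` and
`(a σ_h, -1)` with `a ∈ Inn(𝔤)`; the second component keeps `σ_h` apart from `Inn(𝔤)` when it
happens to be an inner automorphism. -/
def gradedGroup (h : 𝔤) (hE : IsEuler h) : Subgroup ((𝔤 ≃ₗ[ℝ] 𝔤) × ℤˣ) :=
  Subgroup.closure ({p | p.1 ∈ Inn 𝔤 ∧ p.2 = 1} ∪ {(eulerInvolution h hE, -1)})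

/-- The grading `ε : G → {±1}`. -/
def grading (h : 𝔤) (hE : IsEuler h) : gradedGroup h hE →* ℤˣ :=
  (MonoidHom.snd _ _).comp (gradedGroup h hE).subtype

/-- The inclusion of `G^↑ = Inn(𝔤)` into `G`, as the subgroup of even elements. -/
def evenIncl (h : 𝔤) (hE : IsEuler h) : Inn 𝔤 →* (grading h hE).ker where
  toFun a := ⟨⟨(a.1, 1), Subgroup.subset_closure (Or.inl ⟨a.2, rfl⟩)⟩, rfl⟩
  map_one' := rfl
  map_mul' _ _ := rfl

/-- The Euler involution `σ_h` as an odd element of `G`. -/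
def oddInvolution (h : 𝔤) (hE : IsEuler h) : gradedGroup h hE :=
  ⟨(eulerInvolution h hE, -1), Subgroup.subset_closure (Or.inr rfl)⟩

end LieGroup

/-! ### (Anti-)unitary representations of graded groups -/

/-- A strongly continuous (anti-)unitary representation of a graded topological group: even elements
act by unitary and odd ones by antiunitary operators. -/
structure AntiunitaryRep {G : Type*} [Group G] [TopologicalSpace G] (ε : G →* ℤˣ)
    (H : Type*) [NormedAddCommGroup H] [InnerProductSpace ℂ H] where
  /-- the action by real-linear isometries -/
  toHom : G →* (H ≃ₗᵢ[ℝ] H)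
  even_smul : ∀ g, ε g = 1 → ∀ (c : ℂ) (v : H), toHom g (c • v) = c • toHom g v
  odd_smul : ∀ g, ε g = -1 → ∀ (c : ℂ) (v : H), toHom g (c • v) = conj c • toHom g v
  continuous : ∀ v, Continuous fun g => toHom g v

namespace AntiunitaryRep

variable {G : Type*} [Group G] [TopologicalSpace G] {ε : G →* ℤˣ}
  {H : Type*} [NormedAddCommGroup H] [InnerProductSpace ℂ H]

/-- The unitary representation of the even subgroup. -/
def even (U : AntiunitaryRep ε H) : ε.ker →* (H ≃ₗᵢ[ℂ] H) where
  toFun g :=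
    { toFun := U.toHom g.1
      invFun := (U.toHom g.1).symm
      map_add' := _root_.map_add (U.toHom g.1)
      map_smul' := U.even_smul g.1 g.2
      left_inv := (U.toHom g.1).symm_apply_apply
      right_inv := (U.toHom g.1).apply_symm_apply
      norm_map' := (U.toHom g.1).norm_map }
  map_one' := by
    ext v
    change U.toHom 1 v = v
    rw [_root_.map_one]
    rfl
  map_mul' g k := by
    ext v
    change U.toHom (g.1 * k.1) v = U.toHom g.1 (U.toHom k.1 v)
    rw [_root_.map_mul]
    rfl

/-- The antiunitary operator of an odd element. -/
def odd (U : AntiunitaryRep ε H) (g : G) (hg : ε g = -1) : H ≃ₗᵢ⋆[ℂ] H where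
  toFun := U.toHom g
  invFun := (U.toHom g).symm
  map_add' := _root_.map_add (U.toHom g)
  map_smul' := U.odd_smul g hg
  left_inv := (U.toHom g).symm_apply_apply
  right_inv := (U.toHom g).apply_symm_apply
  norm_map' := (U.toHom g).norm_map

end AntiunitaryRep

/-! ### Nets of standard subspaces on `dS²` -/

section Nets

open DeSitter

variable {E : Type*} [NormedAddCommGroup E] [InnerProductSpace ℂ E]

/-- Lorentz covariance `N(Λ(g) W) = V(g) N(W)` with respect to a representation `V` of
`SL(2,ℝ)`. -/
def IsLorentzCovariant (N : Wedge → StandardSubspace E) (V : SL(2, ℝ) →* (E ≃ₗᵢ[ℂ] E)) : Prop :=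
  ∀ (g : SL(2, ℝ)) (W : Wedge), N (g • W) = (N W).map (V g)

/-- Modular covariance `Δ_{N(W_a)}^{-it} N(W_b) = N(λ_{W_a}(2πt) W_b)`. For `W_a = Λ(g) W_{x₁}` the
boost group is `λ_{W_a}(s) = Λ(g exp(s σ₁) g⁻¹)`. -/
def IsModularCovariant (N : Wedge → StandardSubspace E) : Prop :=
  ∀ (g : SL(2, ℝ)) (Wb : Wedge) (t : ℝ) (J : E ≃ₗᵢ⋆[ℂ] E) (Δi : ℝ → E ≃ₗᵢ[ℂ] E),
    IsModularPair (N (g • rightWedge)) J Δi →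
      (N Wb).map (Δi (-t)) =
        N ((g * slExp ((2 * Real.pi * t) • sigmaOne) * g⁻¹) • Wb)

/-- The direct sum `U ⊕ U` of a representation with itself. -/
def doubleRep {G : Type*} [Group G] (V : G →* (E ≃ₗᵢ[ℂ] E)) :
    G →* (WithLp 2 (E × E) ≃ₗᵢ[ℂ] WithLp 2 (E × E)) where
  toFun g := LinearIsometryEquiv.withLpProdCongr 2 (V g) (V g)
  map_one' := by
    ext x
    simp
    rfl
  map_mul' g k := by
    ext x
    simp

/-- The swap operator `Z = (0 1; 1 0)` on `E ⊕ E`. -/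
def swapOp (E : Type*) [NormedAddCommGroup E] [InnerProductSpace ℂ E] :
    WithLp 2 (E × E) ≃ₗᵢ[ℂ] WithLp 2 (E × E) :=
  LinearIsometryEquiv.withLpProdComm 2 ℂ E E

end Nets

end

/-!
The construction rests on three independent facts.

*Standard subspaces and their modular objects.* For the conjugation `J = U(σ_h)` and the commuting
unitary group `Δ^{it} = U(e^{-2πt ad h})`, the subspace `N_U(W_h)` consists of the fixed points of the
antilinear involution `J Δ^{1/2}`. The operator `Δ^{1/2}` is described by its graph (`IsSqrtGraph`):
`v` belongs to its domain if the orbit `t ↦ Δ^{it} v` extends to a strip, holomorphically inside and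
continuously up to the boundary, and `Δ^{1/2} v` is the value at `-i/2`. The spectral theorem is not
needed. Density of the domain and self-adjointness (`IsSqrtGraph.of_adjoint`) come from averaging the
group against Gaussians, whose orbits extend to entire functions. Self-adjointness means that the
symplectic complement has the modular objects `(J, Δ⁻¹)`
(`IsModularData.symplComp_standardSubspace`). A standard subspace determines its modular group
(`IsModularData.group_unique`): the function `⟨V'(t) η, V(t) ξ⟩` extends to a bounded holomorphic
function on the strip with real boundary values. So a unitary operator that preserves the standard
subspace commutes with its modular group.

*The stabilizer of the standard subspace.* The elements `x ∈ 𝔤` for which `e^{t ad x}` acts trivially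
for all `t` form an ideal, by the Trotter product formula and invariance under inner automorphisms.
As `𝔤` is simple and `U` is non-trivial, `U` distinguishes one-parameter groups
(`eq_of_map_innExp_eq`). An inner automorphism `a` for which `U(a)` preserves `N_U(W_h)` commutes with
`e^{t ad h}` under `U`, and therefore fixes `h`. Conversely, automorphisms fixing `h` commute with `J`
and with `Δ^{it}`, hence preserve `N_U(W_h)`.

*Integration of `sl₂(ℝ)`.* The group `SL(2,ℝ)` is not simply connected, so that `ad ∘ ψ` need not
integrate to it by general theory. Here `h = c - h₁` with `c` centralizing the image of `ψ`, and
`(ad h)³ = ad h`; commuting this relation with a raising operator `e` gives `e³ = 0` (`EulerTriple`).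
Only the simple `sl₂`-modules of dimensions one, two and three occur in `𝔤`. They all carry actions of
`SL(2,ℝ)`, and the coefficient maps of `𝔤` to them, given by explicit polynomials in the operators,
jointly separate points. A linear map that corresponds to `g ∈ SL(2,ℝ)` under all of them is thus
determined by `g`; since `SL(2,ℝ)` is generated by exponentials, this defines a homomorphism
(`exists_monoidHom_slExp`).

The stabilizer of the right wedge fixes `σ₁` under the adjoint action
(`DeSitter.slConj_sigmaOne_of_smul_rightWedge`), so `ρ` maps it to automorphisms fixing `h = c - ψ(σ₁)`
and the net `N` is well defined; `K(W) = N(W')'` is then the other net, and `W'' = W` gives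
`N(W') = K(W)'` and the twisted duality of `N ⊕ K`. Modular covariance fails because the modular group
is generated by `h = c - h₁` and the boosts by `h₁`: as `c` commutes with the image of `ρ`, the modular
group moves the wedge label like the inverse boost. Modular covariance would make the boosts in both
directions agree on all translates of `N_U(W_h)`, hence on all conjugates of `σ₁`, which is false
(`DeSitter.exists_slConj_ne`, `exists_map_ne`).
-/


noncomputable section

/-! ### Holomorphic functions on a strip -/

section Strip

open Complex Set Filter Topology

/-- The closed strip `-1/2 ≤ Im z ≤ 0`. -/
abbrev closedStrip : Set ℂ := {z : ℂ | -(1 / 2) ≤ z.im ∧ z.im ≤ 0}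

/-- The open strip `-1/2 < Im z < 0`. -/
abbrev openStrip : Set ℂ := {z : ℂ | -(1 / 2) < z.im ∧ z.im < 0}

theorem openStrip_subset : openStrip ⊆ closedStrip := fun _ hz => ⟨hz.1.le, hz.2.le⟩

theorem isOpen_openStrip : IsOpen openStrip :=
  (isOpen_lt continuous_const continuous_im).inter (isOpen_lt continuous_im continuous_const)

theorem closure_openStrip : closure openStrip = closedStrip := by
  have h : openStrip = im ⁻¹' Ioo (-(1 / 2)) 0 := rfl
  rw [h, closure_preimage_im, closure_Ioo (by norm_num)]
  rfl

theorem isPreconnected_openStrip : IsPreconnected openStrip := by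
  have h : openStrip = im ⁻¹' Ioo (-(1 / 2)) 0 := rfl
  rw [h]
  exact ((convex_Ioo _ _).linear_preimage Complex.imLm).isPreconnected

theorem ofReal_mem_closedStrip (t : ℝ) : (t : ℂ) ∈ closedStrip := by
  constructor <;> simp

theorem neg_I_div_two_mem_closedStrip : -(I / 2) ∈ closedStrip := by
  constructor <;> norm_num

theorem add_ofReal_mem_closedStrip {z : ℂ} (hz : z ∈ closedStrip) (t : ℝ) :
    z + t ∈ closedStrip := by
  simpa using hz

theorem neg_conj_mem_closedStrip {z : ℂ} (hz : z ∈ closedStrip) : -conj z ∈ closedStrip := by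
  simpa using hz

theorem neg_conj_mem_openStrip {z : ℂ} (hz : z ∈ openStrip) : -conj z ∈ openStrip := by
  simpa using hz

theorem conj_sub_mem_closedStrip {z : ℂ} (hz : z ∈ closedStrip) :
    conj z - I / 2 ∈ closedStrip := by
  have h1 := hz.1
  have h2 := hz.2
  constructor <;> simp <;> linarith

theorem conj_sub_mem_openStrip {z : ℂ} (hz : z ∈ openStrip) :
    conj z - I / 2 ∈ openStrip := by
  have h1 := hz.1
  have h2 := hz.2
  constructor <;> simp <;> linarith

/-- Near the real axis the product of the four functions obtained from `f` by rotations about the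
centre of a square with one side on the axis vanishes on the boundary of that square, so `f` is zero
at the centre. -/
theorem eq_zero_of_near_boundary {f : ℂ → ℂ} (hc : ContinuousOn f closedStrip)
    (hd : DifferentiableOn ℂ f openStrip) (h0 : ∀ t : ℝ, f t = 0) {z : ℂ}
    (h1 : -(1 / 4) ≤ z.im) (h2 : z.im < 0) : f z = 0 := by
  set τ : ℝ := -z.im with hτ
  have hτ0 : 0 < τ := by linarith
  set Q : Set ℂ := Ioo (-τ) τ ×ℂ Ioo (-τ) τ with hQ
  have hcl : closure Q = Icc (-τ) τ ×ℂ Icc (-τ) τ := by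
    rw [hQ, closure_reProdIm, closure_Ioo (by linarith)]
  have key : ∀ u : ℂ, (u = 1 ∨ u = -1 ∨ u = I ∨ u = -I) →
      DiffContOnCl ℂ (fun w => f (z + u * w)) Q := by
    intro u hu
    refine ⟨hd.comp (by fun_prop) ?_, ?_⟩
    · rintro w ⟨⟨a1, a2⟩, a3, a4⟩
      rcases hu with rfl | rfl | rfl | rfl <;> constructor <;> simp <;> linarith
    · rw [hcl]
      refine hc.comp (by fun_prop) ?_
      rintro w ⟨⟨a1, a2⟩, a3, a4⟩
      rcases hu with rfl | rfl | rfl | rfl <;> constructor <;> simp <;> linarith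
  have real0 : ∀ w : ℂ, w.im = 0 → f w = 0 := fun w hw => by
    have : w = (w.re : ℂ) := Complex.ext rfl (by simpa using hw)
    rw [this]
    exact h0 _
  have hP : DiffContOnCl ℂ (fun w => (f (z + 1 * w) • f (z + (-1) * w)) •
      (f (z + I * w) • f (z + (-I) * w))) Q :=
    ((key 1 (by simp)).smul (key (-1) (by simp))).smul ((key I (by simp)).smul (key (-I) (by simp)))
  have hbd : Bornology.IsBounded Q := (Metric.isBounded_Ioo _ _).reProdIm (Metric.isBounded_Ioo _ _)
  have hfr : ∀ w ∈ frontier Q, ‖(fun w => (f (z + 1 * w) • f (z + (-1) * w)) •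
      (f (z + I * w) • f (z + (-I) * w))) w‖ ≤ 0 := by
    intro w hw
    rw [hQ, frontier_reProdIm, closure_Ioo (by linarith), frontier_Ioo (by linarith)] at hw
    rcases hw with ⟨-, hw⟩ | ⟨hw, -⟩
    · rcases hw with hw | hw
      · have : f (z + (-1) * w) = 0 := real0 _ (by
          have : w.im = -τ := hw
          simp; linarith)
        simp only [this]; simp
      · have : f (z + 1 * w) = 0 := real0 _ (by
          have : w.im = τ := hw
          simp; linarith)
        simp only [this]; simp
    · rcases hw with hw | hw
      · have : f (z + (-I) * w) = 0 := real0 _ (by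
          have : w.re = -τ := hw
          simp; linarith)
        simp only [this]; simp
      · have : f (z + I * w) = 0 := real0 _ (by
          have : w.re = τ := hw
          simp; linarith)
        simp only [this]; simp
  have := Complex.norm_le_of_forall_mem_frontier_norm_le hbd hP hfr (z := 0)
    (subset_closure (by simp [hQ, mem_reProdIm, hτ0]))
  by_contra hne
  have hpos : 0 < ‖f z‖ * ‖f z‖ * (‖f z‖ * ‖f z‖) := by
    have := norm_pos_iff.2 hne
    positivity
  simp only [mul_zero, add_zero, smul_eq_mul, norm_mul] at this
  linarith

/-- A function that is continuous on the closed strip, holomorphic inside and zero on the real line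
vanishes. No growth condition is needed. -/
theorem eqOn_zero_of_strip {f : ℂ → ℂ} (hc : ContinuousOn f closedStrip)
    (hd : DifferentiableOn ℂ f openStrip) (h0 : ∀ t : ℝ, f t = 0) :
    EqOn f 0 closedStrip := by
  have han : AnalyticOnNhd ℂ f openStrip := hd.analyticOnNhd isOpen_openStrip
  have hm : (-(I / 8)) ∈ openStrip := by constructor <;> norm_num
  have hU : {z : ℂ | -(1 / 4) < z.im ∧ z.im < 0} ∈ 𝓝 (-(I / 8)) := by
    refine ((isOpen_lt continuous_const continuous_im).inter
      (isOpen_lt continuous_im continuous_const)).mem_nhds ?_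
    constructor <;> norm_num
  have hev : f =ᶠ[𝓝 (-(I / 8))] 0 := by
    filter_upwards [hU] with z hz
    exact eq_zero_of_near_boundary hc hd h0 hz.1.le hz.2
  have := han.eqOn_zero_of_preconnected_of_eventuallyEq_zero isPreconnected_openStrip hm hev
  exact this.of_subset_closure hc continuousOn_const openStrip_subset closure_openStrip.ge

theorem eqOn_of_strip {f g : ℂ → ℂ} (hf : ContinuousOn f closedStrip)
    (hf' : DifferentiableOn ℂ f openStrip) (hg : ContinuousOn g closedStrip)
    (hg' : DifferentiableOn ℂ g openStrip) (h0 : ∀ t : ℝ, f t = g t) :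
    EqOn f g closedStrip := by
  intro z hz
  have := eqOn_zero_of_strip (hf.sub hg) (hf'.sub hg') (fun t => sub_eq_zero.2 (h0 t)) hz
  exact sub_eq_zero.1 this

variable {H : Type*} [NormedAddCommGroup H] [InnerProductSpace ℂ H]

theorem eqOn_of_strip_vector {F G : ℂ → H} (hF : ContinuousOn F closedStrip)
    (hF' : DifferentiableOn ℂ F openStrip) (hG : ContinuousOn G closedStrip)
    (hG' : DifferentiableOn ℂ G openStrip) (h0 : ∀ t : ℝ, F t = G t) :
    EqOn F G closedStrip := by
  intro z hz
  refine ext_inner_left ℂ fun v => ?_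
  exact eqOn_of_strip (f := fun z => inner ℂ v (F z)) (g := fun z => inner ℂ v (G z))
    ((innerSL ℂ v).continuous.comp_continuousOn hF)
    ((innerSL ℂ v).differentiable.comp_differentiableOn hF')
    ((innerSL ℂ v).continuous.comp_continuousOn hG)
    ((innerSL ℂ v).differentiable.comp_differentiableOn hG') (fun t => by rw [h0]) hz

/-- Three lines: a bounded function on the strip is bounded by its values on the boundary. -/
theorem norm_le_of_strip {E : Type*} [NormedAddCommGroup E] [NormedSpace ℂ E] {F : ℂ → E}
    (hF : ContinuousOn F closedStrip) (hF' : DifferentiableOn ℂ F openStrip)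
    {B : ℝ} (hB : ∀ z ∈ closedStrip, ‖F z‖ ≤ B) {C : ℝ}
    (h0 : ∀ z : ℂ, z.im = 0 → ‖F z‖ ≤ C) (h1 : ∀ z : ℂ, z.im = -(1 / 2) → ‖F z‖ ≤ C)
    {z : ℂ} (hz : z ∈ closedStrip) : ‖F z‖ ≤ C := by
  refine PhragmenLindelof.horizontal_strip (a := -(1 / 2)) (b := 0) (f := F) ?_ ?_ h1 h0 hz.1 hz.2
  · refine ⟨hF', ?_⟩
    have : closure (im ⁻¹' Ioo (-(1 / 2)) 0) = closedStrip := closure_openStrip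
    rw [this]
    exact hF
  · refine ⟨0, by positivity, 0, ?_⟩
    refine Asymptotics.IsBigO.of_bound B ?_
    refine (eventually_principal.2 fun z hz => ?_).filter_mono inf_le_right
    have := hB z (openStrip_subset hz)
    simpa using this

/-- A bounded holomorphic function on the strip with real boundary values is constant. -/
theorem constant_of_real_boundary {g : ℂ → ℂ} (hc : ContinuousOn g closedStrip)
    (hd : DifferentiableOn ℂ g openStrip) {B : ℝ} (hB : ∀ z ∈ closedStrip, ‖g z‖ ≤ B)
    (h0 : ∀ z : ℂ, z.im = 0 → (g z).im = 0) (h1 : ∀ z : ℂ, z.im = -(1 / 2) → (g z).im = 0) :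
    ∀ z ∈ closedStrip, g z = g 0 := by
  have him : ∀ c : ℂ, (c = I ∨ c = -I) → ∀ z ∈ closedStrip, Real.exp ((c * g z).re) ≤ 1 := by
    intro c hc' z hz
    have hre : ∀ w, (g w).im = 0 → (c * g w).re = 0 := by
      intro w hw
      rcases hc' with rfl | rfl <;> simp [hw]
    have := norm_le_of_strip (F := fun z => Complex.exp (c * g z)) (B := Real.exp (‖c‖ * B)) (C := 1)
      (Complex.continuous_exp.comp_continuousOn (continuousOn_const.mul hc))
      (Complex.differentiable_exp.comp_differentiableOn ((differentiableOn_const c).mul hd))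
      (fun w hw => by
        rw [Complex.norm_exp]
        refine Real.exp_le_exp.2 ((Complex.re_le_norm _).trans ?_)
        rw [norm_mul]
        exact mul_le_mul_of_nonneg_left (hB w hw) (norm_nonneg _))
      (fun w hw => by rw [Complex.norm_exp, hre w (h0 w hw), Real.exp_zero])
      (fun w hw => by rw [Complex.norm_exp, hre w (h1 w hw), Real.exp_zero]) hz
    rwa [Complex.norm_exp] at this
  have hi : ∀ z ∈ closedStrip, (g z).im = 0 := by
    intro z hz
    have a1 := Real.exp_le_one_iff.1 (him I (Or.inl rfl) z hz)
    have a2 := Real.exp_le_one_iff.1 (him (-I) (Or.inr rfl) z hz)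
    simp at a1 a2
    linarith
  have han : AnalyticOnNhd ℂ g openStrip := hd.analyticOnNhd isOpen_openStrip
  have hcst : ∃ w, ∀ z ∈ openStrip, g z = w := by
    rcases han.is_constant_or_isOpen isPreconnected_openStrip with h | h
    · exact h
    · exfalso
      have hm : (-(I / 8)) ∈ openStrip := by constructor <;> norm_num
      have ho := h openStrip subset_rfl isOpen_openStrip
      obtain ⟨ε, hε, hball⟩ := Metric.isOpen_iff.1 ho _ (mem_image_of_mem g hm)
      obtain ⟨z, hz, hzw⟩ := hball (show g (-(I / 8)) + (ε / 2 : ℝ) * I ∈ _ by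
        simp [abs_of_pos hε, hε])
      have e1 := hi z (openStrip_subset hz)
      have e2 := hi _ (openStrip_subset hm)
      rw [hzw] at e1
      simp [e2] at e1
      linarith
  obtain ⟨w, hw⟩ := hcst
  have hall : EqOn g (fun _ => w) closedStrip :=
    EqOn.of_subset_closure (fun z hz => hw z hz) hc continuousOn_const openStrip_subset
      closure_openStrip.ge
  intro z hz
  rw [hall hz, hall (show (0 : ℂ) ∈ closedStrip by simp)]

end Strip

/-! ### Antiunitary operators -/

section Antiunitary

open Complex Set Filter Topology

variable {H : Type*} [NormedAddCommGroup H] [InnerProductSpace ℂ H]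

theorem inner_conjugation (J : H ≃ₗᵢ⋆[ℂ] H) (v w : H) : inner ℂ (J v) (J w) = inner ℂ w v := by
  rw [inner_eq_sum_norm_sq_div_four (J v) (J w), inner_eq_sum_norm_sq_div_four w v]
  have hI : ∀ x : H, I • J x = J (-(I • x)) := fun x => by
    rw [map_neg, map_smulₛₗ]
    simp
  have hr : (RCLike.I : ℂ) = I := rfl
  rw [hr, hI, ← map_add, ← map_sub, ← map_add, ← map_sub]
  simp only [LinearIsometryEquiv.norm_map]
  have e1 : ‖w - I • v‖ = ‖v + I • w‖ := by
    have : v + I • w = I • (w - I • v) := by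
      rw [smul_sub, smul_smul, I_mul_I]; module
    rw [this, norm_smul]; simp
  have e2 : ‖w + I • v‖ = ‖v - I • w‖ := by
    have : v - I • w = -(I • (w + I • v)) := by
      rw [smul_add, smul_smul, I_mul_I]; module
    rw [this, norm_neg, norm_smul]; simp
  rw [e1, e2, add_comm w v, norm_sub_rev w v, sub_neg_eq_add, ← sub_eq_add_neg]

/-- If `f` is holomorphic, so is `z ↦ J (f (conj z))` for antilinear `J`. -/
theorem hasDerivAt_conjugation_comp_conj (J : H ≃ₗᵢ⋆[ℂ] H) {f : ℂ → H} {f' : H} {z : ℂ}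
    (hf : HasDerivAt f f' (conj z)) : HasDerivAt (fun w => J (f (conj w))) (J f') z := by
  rw [hasDerivAt_iff_tendsto_slope] at hf ⊢
  have hconj : Tendsto (fun w : ℂ => conj w) (𝓝[≠] z) (𝓝[≠] (conj z)) := by
    refine tendsto_nhdsWithin_iff.2
      ⟨(continuous_conj.tendsto z).mono_left nhdsWithin_le_nhds, ?_⟩
    filter_upwards [self_mem_nhdsWithin] with w hw h
    exact hw (star_injective h)
  refine ((J.continuous.tendsto f').comp (hf.comp hconj)).congr fun w => ?_
  simp only [Function.comp, slope, vsub_eq_sub]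
  rw [map_smulₛₗ, map_sub]
  simp

end Antiunitary

/-! ### Smoothing a unitary one-parameter group by Gaussians -/

/-- `V` is a strongly continuous unitary one-parameter group. -/
structure IsOneParamGroup {H : Type*} [NormedAddCommGroup H] [InnerProductSpace ℂ H]
    (V : ℝ → H ≃ₗᵢ[ℂ] H) : Prop where
  map_add : ∀ s t, V (s + t) = V s * V t
  continuous : ∀ v, Continuous fun t => V t v

namespace IsOneParamGroup

variable {H : Type*} [NormedAddCommGroup H] [InnerProductSpace ℂ H] {V : ℝ → H ≃ₗᵢ[ℂ] H}

theorem add_apply (hV : IsOneParamGroup V) (s t : ℝ) (v : H) : V (s + t) v = V s (V t v) := by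
  rw [hV.map_add]; rfl

theorem zero_apply (hV : IsOneParamGroup V) (v : H) : V 0 v = v := by
  have h := hV.add_apply 0 0 v
  rw [add_zero] at h
  exact ((V 0).injective h).symm

theorem neg_apply_apply (hV : IsOneParamGroup V) (t : ℝ) (v : H) : V (-t) (V t v) = v := by
  rw [← hV.add_apply, neg_add_cancel, hV.zero_apply]

theorem apply_neg_apply (hV : IsOneParamGroup V) (t : ℝ) (v : H) : V t (V (-t) v) = v := by
  rw [← hV.add_apply, add_neg_cancel, hV.zero_apply]

theorem inner_apply_left (hV : IsOneParamGroup V) (t : ℝ) (v w : H) :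
    inner ℂ (V t v) w = inner ℂ v (V (-t) w) := by
  rw [← (V (-t)).inner_map_map, hV.neg_apply_apply]

theorem neg (hV : IsOneParamGroup V) : IsOneParamGroup fun t => V (-t) where
  map_add s t := by
    rw [neg_add, hV.map_add]
  continuous v := (hV.continuous v).comp continuous_neg

theorem conjugate (hV : IsOneParamGroup V) (u : H ≃ₗᵢ[ℂ] H) :
    IsOneParamGroup fun t => u * V t * u⁻¹ where
  map_add s t := by
    rw [hV.map_add]
    group
  continuous v := u.continuous.comp (hV.continuous (u⁻¹ v))

end IsOneParamGroup

section Gauss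

open Complex Set Filter Topology MeasureTheory

theorem norm_cexp_neg_sq (s : ℝ) (ζ : ℂ) :
    ‖cexp (-((s : ℂ) - ζ) ^ 2)‖ = Real.exp (-(s - ζ.re) ^ 2 + ζ.im ^ 2) := by
  rw [Complex.norm_exp]
  congr 1
  simp [pow_two]
  ring

theorem norm_cexp_neg_sq_le {s : ℝ} {ζ : ℂ} {M : ℝ} (h : ‖ζ‖ ≤ M) :
    ‖cexp (-((s : ℂ) - ζ) ^ 2)‖ ≤ Real.exp (M ^ 2) * Real.exp (-(1 / 2) * s ^ 2) := by
  rw [norm_cexp_neg_sq, ← Real.exp_add]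
  refine Real.exp_le_exp.2 ?_
  have h1 : ζ.re ^ 2 + ζ.im ^ 2 ≤ M ^ 2 := by
    have := Complex.sq_norm ζ
    rw [Complex.normSq_apply] at this
    nlinarith [norm_nonneg ζ]
  nlinarith [sq_nonneg (s - 2 * ζ.re)]

theorem integrable_gauss : Integrable fun s : ℝ => Real.exp (-(1 / 2) * s ^ 2) :=
  integrable_exp_neg_mul_sq (by norm_num)

variable {H : Type*} [NormedAddCommGroup H] [InnerProductSpace ℂ H]

theorem integrable_gauss_smul (ζ : ℂ) {u : ℝ → H} (hu : Continuous u) {C : ℝ}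
    (hC : ∀ s, ‖u s‖ ≤ C) : Integrable fun s : ℝ => cexp (-((s : ℂ) - ζ) ^ 2) • u s := by
  have hC0 : 0 ≤ C := (norm_nonneg _).trans (hC 0)
  refine (integrable_gauss.const_mul (Real.exp (‖ζ‖ ^ 2) * C)).mono'
    (Continuous.aestronglyMeasurable (by fun_prop)) (ae_of_all _ fun s => ?_)
  rw [norm_smul]
  calc _ ≤ Real.exp (‖ζ‖ ^ 2) * Real.exp (-(1 / 2) * s ^ 2) * C :=
        mul_le_mul (norm_cexp_neg_sq_le le_rfl) (hC s) (norm_nonneg _) (by positivity)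
    _ = _ := by ring

theorem abs_le_exp_half_sq (s : ℝ) : |s| ≤ 2 * Real.exp (1 / 4 * s ^ 2) := by
  have := Real.add_one_le_exp (1 / 4 * s ^ 2)
  nlinarith [sq_nonneg (|s| / 2 - 1), sq_abs s]

/-- Convolving a bounded continuous curve with a Gaussian gives an entire function. -/
theorem differentiable_gauss_integral {u : ℝ → H} (hu : Continuous u) {C : ℝ}
    (hC : ∀ s, ‖u s‖ ≤ C) :
    Differentiable ℂ fun ζ : ℂ => ∫ s : ℝ, cexp (-((s : ℂ) - ζ) ^ 2) • u s := by
  intro ζ₀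
  have hC0 : 0 ≤ C := (norm_nonneg _).trans (hC 0)
  set M : ℝ := ‖ζ₀‖ + 1 with hM
  have hM0 : 0 ≤ M := by positivity
  have hb : Integrable fun s : ℝ => (Real.exp (M ^ 2) * C) *
      (2 * (2 * Real.exp (-(1 / 4) * s ^ 2) + M * Real.exp (-(1 / 2) * s ^ 2))) :=
    ((((integrable_exp_neg_mul_sq (by norm_num : (0 : ℝ) < 1 / 4)).const_mul 2).add
      (integrable_gauss.const_mul M)).const_mul 2).const_mul _
  refine (hasDerivAt_integral_of_dominated_loc_of_deriv_le
    (F' := fun ζ s => (cexp (-((s : ℂ) - ζ) ^ 2) * (2 * ((s : ℂ) - ζ))) • u s)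
    (Metric.ball_mem_nhds ζ₀ one_pos)
    (.of_forall fun ζ => (integrable_gauss_smul ζ hu hC).aestronglyMeasurable)
    (integrable_gauss_smul ζ₀ hu hC)
    (Continuous.aestronglyMeasurable (by fun_prop)) ?_ hb ?_).2.differentiableAt
  · refine ae_of_all _ fun s ζ hζ => ?_
    have hζM : ‖ζ‖ ≤ M := by
      have h1 : ‖ζ - ζ₀‖ < 1 := by simpa [dist_eq_norm] using hζ
      have h2 := norm_add_le (ζ - ζ₀) ζ₀
      rw [sub_add_cancel] at h2
      linarith
    rw [norm_smul, norm_mul, norm_mul]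
    have h3 : ‖(s : ℂ) - ζ‖ ≤ |s| + M := (norm_sub_le _ _).trans (by
      rw [Complex.norm_real, Real.norm_eq_abs]; linarith)
    have h4 : ‖(2 : ℂ)‖ * ‖(s : ℂ) - ζ‖ ≤ 2 * (2 * Real.exp (1 / 4 * s ^ 2) + M) := by
      have := abs_le_exp_half_sq s
      rw [Complex.norm_ofNat]
      linarith
    calc _ ≤ Real.exp (M ^ 2) * Real.exp (-(1 / 2) * s ^ 2) *
          (2 * (2 * Real.exp (1 / 4 * s ^ 2) + M)) * C :=
        mul_le_mul (mul_le_mul (norm_cexp_neg_sq_le hζM) h4 (by positivity) (by positivity))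
          (hC s) (norm_nonneg _) (by positivity)
      _ = _ := by
        have : Real.exp (-(1 / 4) * s ^ 2) =
            Real.exp (-(1 / 2) * s ^ 2) * Real.exp (1 / 4 * s ^ 2) := by
          rw [← Real.exp_add]; congr 1; ring
        rw [this]; ring
  · refine ae_of_all _ fun s ζ _ => ?_
    have h1 : HasDerivAt (fun ζ : ℂ => -((s : ℂ) - ζ) ^ 2) (2 * ((s : ℂ) - ζ)) ζ := by
      have h2 : HasDerivAt (fun ζ : ℂ => (s : ℂ) - ζ) (-1) ζ := by
        simpa using (hasDerivAt_id ζ).const_sub (s : ℂ)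
      have := (h2.pow 2).neg
      simp only [Nat.cast_ofNat, Nat.add_one_sub_one, pow_one] at this
      convert! this using 1
      ring
    exact h1.cexp.smul_const (u s)

variable {V : ℝ → H ≃ₗᵢ[ℂ] H}

theorem integrable_gaussSmooth (hV : IsOneParamGroup V) (ε : ℝ) (v : H) :
    Integrable fun s : ℝ => cexp (-((s : ℂ) - 0) ^ 2) • V (ε * s) v :=
  integrable_gauss_smul 0 ((hV.continuous v).comp (continuous_const_mul ε))
    fun s => (V (ε * s)).norm_map v |>.le

/-- The Gaussian average `∫ e^{-s²} V(εs) v ds` of a unitary one-parameter group, as a bounded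
operator. It maps into the entire vectors, and tends to `√π v` for `ε → 0`. -/
def gaussSmooth (hV : IsOneParamGroup V) (ε : ℝ) : H →L[ℂ] H :=
  LinearMap.mkContinuous
    { toFun := fun v => ∫ s : ℝ, cexp (-((s : ℂ) - 0) ^ 2) • V (ε * s) v
      map_add' := fun v w => by
        rw [← integral_add (integrable_gaussSmooth hV ε v) (integrable_gaussSmooth hV ε w)]
        simp only [_root_.map_add, smul_add]
      map_smul' := fun c v => by
        rw [RingHom.id_apply, ← integral_smul]
        simp only [_root_.map_smul, smul_comm c] }
    (Real.exp (0 ^ 2) * ∫ s : ℝ, Real.exp (-(1 / 2) * s ^ 2)) (fun v => by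
      rw [← integral_const_mul, ← integral_mul_const]
      refine norm_integral_le_of_norm_le
        ((integrable_gauss.const_mul _).mul_const ‖v‖) (ae_of_all _ fun s => ?_)
      rw [norm_smul, LinearIsometryEquiv.norm_map]
      exact mul_le_mul_of_nonneg_right (norm_cexp_neg_sq_le (by simp)) (norm_nonneg _))

theorem gaussSmooth_apply (hV : IsOneParamGroup V) (ε : ℝ) (v : H) :
    gaussSmooth hV ε v = ∫ s : ℝ, cexp (-((s : ℂ) - 0) ^ 2) • V (ε * s) v := rfl

variable [CompleteSpace H]

theorem gaussSmooth_comm (hV : IsOneParamGroup V) (ε t : ℝ) (v : H) :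
    gaussSmooth hV ε (V t v) = V t (gaussSmooth hV ε v) := by
  rw [gaussSmooth_apply, gaussSmooth_apply]
  have := (V t).toContinuousLinearEquiv.toContinuousLinearMap.integral_comp_comm
    (integrable_gaussSmooth hV ε v)
  refine Eq.trans ?_ this
  refine integral_congr_ae (ae_of_all _ fun s => ?_)
  change _ • V _ (V t v) = V t (_ • _)
  rw [_root_.map_smul, ← hV.add_apply, ← hV.add_apply, add_comm]

theorem gaussSmooth_symm (hV : IsOneParamGroup V) (ε : ℝ) (v w : H) :
    inner ℂ (gaussSmooth hV ε v) w = inner ℂ v (gaussSmooth hV ε w) := by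
  rw [gaussSmooth_apply, gaussSmooth_apply, ← inner_conj_symm,
    ← integral_inner (integrable_gaussSmooth hV ε v),
    ← integral_inner (integrable_gaussSmooth hV ε w), ← integral_conj,
    ← integral_neg_eq_self]
  refine integral_congr_ae (ae_of_all _ fun s => ?_)
  simp only [inner_smul_right, map_mul, inner_conj_symm]
  rw [hV.inner_apply_left, ← Complex.exp_conj]
  simp

theorem gaussSmooth_tendsto (hV : IsOneParamGroup V) (v : H) :
    Tendsto (fun n : ℕ => gaussSmooth hV (1 / ((n : ℝ) + 1)) v) atTop
      (𝓝 ((Real.sqrt Real.pi : ℂ) • v)) := by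
  have h1 : (Real.sqrt Real.pi : ℂ) • v = ∫ s : ℝ, cexp (-((s : ℂ) - 0) ^ 2) • v := by
    rw [integral_smul_const]
    congr 1
    have := integral_gaussian 1
    rw [div_one] at this
    rw [← this, ← integral_complex_ofReal]
    refine integral_congr_ae (ae_of_all _ fun s => ?_)
    simp
  rw [h1]
  refine tendsto_integral_filter_of_dominated_convergence
    (fun s => Real.exp (0 ^ 2) * Real.exp (-(1 / 2) * s ^ 2) * ‖v‖)
    (.of_forall fun n => (integrable_gaussSmooth hV _ v).aestronglyMeasurable)
    (.of_forall fun n => ae_of_all _ fun s => ?_)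
    ((integrable_gauss.const_mul _).mul_const _) (ae_of_all _ fun s => ?_)
  · rw [norm_smul, LinearIsometryEquiv.norm_map]
    exact mul_le_mul_of_nonneg_right (norm_cexp_neg_sq_le (by simp)) (norm_nonneg _)
  · refine Tendsto.const_smul ?_ _
    have h2 : Tendsto (fun n : ℕ => 1 / ((n : ℝ) + 1) * s) atTop (𝓝 (0 * s)) :=
      tendsto_one_div_add_atTop_nhds_zero_nat.mul_const s
    rw [zero_mul] at h2
    have h3 := ((hV.continuous v).tendsto 0).comp h2
    rwa [hV.zero_apply] at h3

theorem apply_gaussSmooth (hV : IsOneParamGroup V) {ε : ℝ} (hε : 0 < ε) (v : H) (t : ℝ) :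
    ∫ s : ℝ, cexp (-((s : ℂ) - (t : ℂ) / ε) ^ 2) • V (ε * s) v = V t (gaussSmooth hV ε v) := by
  rw [← gaussSmooth_comm, gaussSmooth_apply,
    ← integral_add_right_eq_self (fun s : ℝ => cexp (-((s : ℂ) - (t : ℂ) / ε) ^ 2) • V (ε * s) v)
      (t / ε)]
  refine integral_congr_ae (ae_of_all _ fun s => ?_)
  simp only
  rw [← hV.add_apply]
  congr 3
  · push_cast
    ring
  · field_simp

/-- The orbit of a Gaussian average extends to an entire function. -/
theorem isSqrtGraph_gaussSmooth (hV : IsOneParamGroup V) {ε : ℝ} (hε : 0 < ε) (v : H) :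
    ∃ w, IsSqrtGraph V (gaussSmooth hV ε v) w := by
  have hd : Differentiable ℂ fun z : ℂ =>
      ∫ s : ℝ, cexp (-((s : ℂ) - z / ε) ^ 2) • V (ε * s) v :=
    (differentiable_gauss_integral ((hV.continuous v).comp (continuous_const_mul ε))
      (fun s => (V (ε * s)).norm_map v |>.le)).comp (differentiable_id.div_const (ε : ℂ))
  exact ⟨_, _, hd.continuous.continuousOn, hd.differentiableOn, apply_gaussSmooth hV hε v, rfl⟩

end Gauss

/-! ### The graph of `Δ^{1/2}` -/

namespace IsSqrtGraph

open Complex Set Filter Topology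

variable {H : Type*} [NormedAddCommGroup H] [InnerProductSpace ℂ H] {V V' : ℝ → H ≃ₗᵢ[ℂ] H}
  {v w v' w' : H}

theorem add (h : IsSqrtGraph V v w) (h' : IsSqrtGraph V v' w') :
    IsSqrtGraph V (v + v') (w + w') := by
  obtain ⟨F, h1, h2, h3, h4⟩ := h
  obtain ⟨G, k1, k2, k3, k4⟩ := h'
  exact ⟨fun z => F z + G z, h1.add k1, h2.add k2, fun t => by simp only [h3, k3, map_add],
    by simp only [h4, k4]⟩

theorem clm (h : IsSqrtGraph V v w) {K : Type*} [NormedAddCommGroup K] [InnerProductSpace ℂ K]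
    {W : ℝ → K ≃ₗᵢ[ℂ] K} (L : H →L[ℂ] K) (hL : ∀ t v, L (V t v) = W t (L v)) :
    IsSqrtGraph W (L v) (L w) := by
  obtain ⟨F, h1, h2, h3, h4⟩ := h
  exact ⟨fun z => L (F z), L.continuous.comp_continuousOn h1,
    L.differentiable.comp_differentiableOn h2, fun t => by simp only [h3, hL], by simp only [h4]⟩

theorem smul (h : IsSqrtGraph V v w) (c : ℂ) : IsSqrtGraph V (c • v) (c • w) :=
  h.clm (c • ContinuousLinearMap.id ℂ H) (fun t v => by simp)

theorem sub (h : IsSqrtGraph V v w) (h' : IsSqrtGraph V v' w') :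
    IsSqrtGraph V (v - v') (w - w') := by
  simpa [sub_eq_add_neg] using h.add (h'.smul (-1))

theorem zero : IsSqrtGraph V 0 0 :=
  ⟨fun _ => 0, continuousOn_const, differentiableOn_const _, fun t => by simp, rfl⟩

theorem unique (h : IsSqrtGraph V v w) (h' : IsSqrtGraph V v w') : w = w' := by
  obtain ⟨F, h1, h2, h3, rfl⟩ := h
  obtain ⟨G, k1, k2, k3, rfl⟩ := h'
  exact eqOn_of_strip_vector h1 h2 k1 k2 (fun t => by rw [h3, k3]) neg_I_div_two_mem_closedStrip

/-- An extended orbit map is equivariant under real translations. -/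
theorem extension_add (hV : IsOneParamGroup V) {F : ℂ → H} (h1 : ContinuousOn F closedStrip)
    (h2 : DifferentiableOn ℂ F openStrip) (h3 : ∀ t : ℝ, F t = V t v) (t : ℝ) {z : ℂ}
    (hz : z ∈ closedStrip) : F (z + t) = V t (F z) := by
  refine eqOn_of_strip_vector (F := fun z => F (z + t)) (G := fun z => V t (F z))
    (h1.comp (by fun_prop) fun z hz => add_ofReal_mem_closedStrip hz t)
    (h2.comp (by fun_prop) fun z hz => by simpa using hz)
    ((V t).continuous.comp_continuousOn h1)
    ((V t).toContinuousLinearEquiv.differentiable.comp_differentiableOn h2) (fun s => ?_) hz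
  rw [← ofReal_add, h3, h3, ← hV.add_apply, add_comm]

theorem extension_bounded (hV : IsOneParamGroup V) {F : ℂ → H} (h1 : ContinuousOn F closedStrip)
    (h2 : DifferentiableOn ℂ F openStrip) (h3 : ∀ t : ℝ, F t = V t v) :
    ∃ B, ∀ z ∈ closedStrip, ‖F z‖ ≤ B := by
  have hc : ContinuousOn (fun y : ℝ => F (y * I)) (Icc (-(1 / 2)) 0) :=
    h1.comp (by fun_prop) fun y hy => by simpa using hy
  obtain ⟨B, hB⟩ := isCompact_Icc.exists_bound_of_continuousOn hc
  refine ⟨B, fun z hz => ?_⟩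
  have h := extension_add hV h1 h2 h3 z.re (z := z.im * I) (by simpa using hz)
  rw [add_comm, re_add_im] at h
  rw [h, LinearIsometryEquiv.norm_map]
  exact hB z.im hz

theorem extension_norm_le (hV : IsOneParamGroup V) {F : ℂ → H} (h1 : ContinuousOn F closedStrip)
    (h2 : DifferentiableOn ℂ F openStrip) (h3 : ∀ t : ℝ, F t = V t v) {z : ℂ}
    (hz : z ∈ closedStrip) : ‖F z‖ ≤ max ‖v‖ ‖F (-(I / 2))‖ := by
  obtain ⟨B, hB⟩ := extension_bounded hV h1 h2 h3
  refine norm_le_of_strip h1 h2 hB (fun z hz => ?_) (fun z hz => ?_) hz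
  · have : z = (z.re : ℂ) := Complex.ext rfl (by simpa using hz)
    rw [this, h3, LinearIsometryEquiv.norm_map]
    exact le_max_left _ _
  · have : z = -(I / 2) + (z.re : ℂ) := Complex.ext (by simp) (by simp [hz])
    rw [this, extension_add hV h1 h2 h3 _ neg_I_div_two_mem_closedStrip,
      LinearIsometryEquiv.norm_map]
    exact le_max_right _ _

/-- `Δ^{1/2}` is a closed operator. -/
theorem of_tendsto [CompleteSpace H] (hV : IsOneParamGroup V) {x y : ℕ → H}
    (h : ∀ n, IsSqrtGraph V (x n) (y n)) (hx : Tendsto x atTop (𝓝 v))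
    (hy : Tendsto y atTop (𝓝 w)) : IsSqrtGraph V v w := by
  choose F h1 h2 h3 h4 using h
  have hcauchy : UniformCauchySeqOn F atTop closedStrip := by
    rw [Metric.uniformCauchySeqOn_iff]
    intro ε hε
    obtain ⟨N₁, hN₁⟩ := Metric.cauchySeq_iff.1 hx.cauchySeq ε hε
    obtain ⟨N₂, hN₂⟩ := Metric.cauchySeq_iff.1 hy.cauchySeq ε hε
    refine ⟨max N₁ N₂, fun m hm n hn z hz => ?_⟩
    have h5 := extension_norm_le (v := x m - x n) (F := fun z => F m z - F n z) hV
      ((h1 m).sub (h1 n)) ((h2 m).sub (h2 n)) (fun t => by rw [h3, h3, map_sub]) hz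
    rw [dist_eq_norm]
    refine h5.trans_lt (max_lt ?_ ?_)
    · rw [← dist_eq_norm]
      exact hN₁ m ((le_max_left _ _).trans hm) n ((le_max_left _ _).trans hn)
    · simp only [h4]
      rw [← dist_eq_norm]
      exact hN₂ m ((le_max_right _ _).trans hm) n ((le_max_right _ _).trans hn)
  have hlim : ∀ z ∈ closedStrip, ∃ l, Tendsto (fun n => F n z) atTop (𝓝 l) := fun z hz =>
    cauchySeq_tendsto_of_complete (hcauchy.cauchySeq hz)
  choose! G hG using hlim
  have hunif : TendstoUniformlyOn F G atTop closedStrip :=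
    hcauchy.tendstoUniformlyOn_of_tendsto hG
  refine ⟨G, hunif.continuousOn (Frequently.of_forall h1), ?_, fun t => ?_, ?_⟩
  · exact ((hunif.mono openStrip_subset).tendstoLocallyUniformlyOn).differentiableOn
      (.of_forall h2) isOpen_openStrip
  · refine tendsto_nhds_unique (hG t (ofReal_mem_closedStrip t)) ?_
    simp only [h3]
    exact ((V t).continuous.tendsto v).comp hx
  · refine tendsto_nhds_unique (hG _ neg_I_div_two_mem_closedStrip) ?_
    simpa only [h4] using hy

/-- If the conjugation `J` commutes with `Δ^{it}`, then `J Δ^{1/2} J = Δ^{-1/2}`, so that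
`J Δ^{1/2}` is an involution of the domain of `Δ^{1/2}`. -/
theorem conjugation {J : H ≃ₗᵢ⋆[ℂ] H} (hV : IsOneParamGroup V) (hJ : ∀ t v, J (V t v) = V t (J v))
    (h : IsSqrtGraph V v w) : IsSqrtGraph V (J w) (J v) := by
  obtain ⟨F, h1, h2, h3, h4⟩ := h
  refine ⟨fun z => J (F (conj z - I / 2)), ?_, ?_, fun t => ?_, ?_⟩
  · refine J.continuous.comp_continuousOn (h1.comp (by fun_prop) fun z hz => ?_)
    exact conj_sub_mem_closedStrip hz
  · intro z hz
    have hd := (h2.differentiableAt (isOpen_openStrip.mem_nhds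
      (conj_sub_mem_openStrip hz))).hasDerivAt
    exact (hasDerivAt_conjugation_comp_conj (f := fun z => F (z - I / 2)) J
      (hd.comp_sub_const (conj z) (I / 2))).differentiableAt.differentiableWithinAt
  · beta_reduce
    rw [conj_ofReal, sub_eq_add_neg, add_comm,
      extension_add hV h1 h2 h3 t neg_I_div_two_mem_closedStrip, h4, hJ]
  · have : conj (-(I / 2)) - I / 2 = ((0 : ℝ) : ℂ) := by
      rw [map_neg, map_div₀, conj_I, Complex.conj_ofNat, ofReal_zero]
      ring
    beta_reduce
    rw [this, h3, hV.zero_apply]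

/-- The inverse of `Δ^{1/2}` is the analytic generator of the reversed group. -/
theorem inverse (hV : IsOneParamGroup V) (h : IsSqrtGraph V v w) :
    IsSqrtGraph (fun t => V (-t)) w v := by
  obtain ⟨F, h1, h2, h3, h4⟩ := h
  refine ⟨fun z => F (-z - I / 2), h1.comp (by fun_prop) fun z hz => ?_,
    h2.comp (by fun_prop) fun z hz => ?_, fun t => ?_, ?_⟩
  · have a := hz.1
    have b := hz.2
    constructor <;> simp <;> linarith
  · have a := hz.1
    have b := hz.2
    constructor <;> simp <;> linarith
  · have : -(t : ℂ) - I / 2 = -(I / 2) + ((-t : ℝ) : ℂ) := by push_cast; ring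
    beta_reduce
    rw [this, extension_add hV h1 h2 h3 _ neg_I_div_two_mem_closedStrip, h4]
  · have : - -(I / 2) - I / 2 = ((0 : ℝ) : ℂ) := by simp
    beta_reduce
    rw [this, h3, hV.zero_apply]

/-- `⟨F(-z̄), G(z)⟩` is holomorphic, for holomorphic `F` and `G`. -/
theorem differentiableOn_inner {F G : ℂ → H} (hF : DifferentiableOn ℂ F openStrip)
    (hG : DifferentiableOn ℂ G openStrip) :
    DifferentiableOn ℂ (fun z => inner ℂ (F (-conj z)) (G z)) openStrip := by
  intro z hz
  have hd := (hF.differentiableAt (isOpen_openStrip.mem_nhds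
    (neg_conj_mem_openStrip hz))).hasDerivAt
  have hg := (hG.differentiableAt (isOpen_openStrip.mem_nhds hz)).hasDerivAt
  refine DifferentiableAt.differentiableWithinAt ?_
  set a := F (-conj z) with ha
  have hd' : HasDerivAt (fun z => F (-z)) (-(deriv F (-conj z))) (conj z) := by
    have := hd.scomp (conj z) (hasDerivAt_neg (conj z))
    simpa [Function.comp_def] using this
  rw [hasDerivAt_iff_tendsto_slope] at hd' hg
  have hconj : Tendsto (fun w : ℂ => conj w) (𝓝[≠] z) (𝓝[≠] (conj z)) := by
    refine tendsto_nhdsWithin_iff.2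
      ⟨(continuous_conj.tendsto z).mono_left nhdsWithin_le_nhds, ?_⟩
    filter_upwards [self_mem_nhdsWithin] with w hw h
    exact hw (star_injective h)
  have hGc : Tendsto G (𝓝[≠] z) (𝓝 (G z)) :=
    ((hG.differentiableAt (isOpen_openStrip.mem_nhds hz)).continuousAt.tendsto).mono_left
      nhdsWithin_le_nhds
  have key : HasDerivAt (fun z => inner ℂ (F (-conj z)) (G z))
      (inner ℂ (-(deriv F (-conj z))) (G z) + inner ℂ a (deriv G z)) z := by
    rw [hasDerivAt_iff_tendsto_slope]
    refine (((hd'.comp hconj).inner hGc).add (tendsto_const_nhds.inner hg)).congr fun w => ?_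
    simp only [Function.comp, slope, vsub_eq_sub, inner_smul_left, inner_smul_right,
      inner_sub_left, inner_sub_right, ha, smul_eq_mul]
    simp
    ring
  exact key.differentiableAt

theorem continuousOn_inner {F G : ℂ → H} (hF : ContinuousOn F closedStrip)
    (hG : ContinuousOn G closedStrip) :
    ContinuousOn (fun z => inner ℂ (F (-conj z)) (G z)) closedStrip :=
  (hF.comp (by fun_prop) fun _ hz => neg_conj_mem_closedStrip hz).inner hG

/-- `Δ^{1/2}` is symmetric. -/
theorem symm (hV : IsOneParamGroup V) (h : IsSqrtGraph V v w) (h' : IsSqrtGraph V v' w') :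
    inner ℂ w v' = inner ℂ v w' := by
  obtain ⟨F, h1, h2, h3, rfl⟩ := h
  obtain ⟨G, k1, k2, k3, rfl⟩ := h'
  have := eqOn_of_strip (f := fun z => inner ℂ (F (-conj z)) v') (g := fun z => inner ℂ v (G z))
    (continuousOn_inner h1 continuousOn_const) (differentiableOn_inner h2 (differentiableOn_const _))
    (continuousOn_const.inner k1)
    ((innerSL ℂ v).differentiable.comp_differentiableOn k2) (fun t => ?_)
    neg_I_div_two_mem_closedStrip
  · have h5 : -conj (-(I / 2)) = -(I / 2) := by
      rw [map_neg, map_div₀, conj_I, Complex.conj_ofNat]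
      ring
    simpa only [h5] using this
  · simp only [conj_ofReal]
    rw [← ofReal_neg, h3, k3, hV.inner_apply_left, neg_neg]

theorem inner_eq_zero_of_domain [CompleteSpace H] (hV : IsOneParamGroup V) {y : H}
    (h : ∀ v w, IsSqrtGraph V v w → inner ℂ v y = 0) : y = 0 := by
  have h1 := (gaussSmooth_tendsto hV y).inner (𝕜 := ℂ) (tendsto_const_nhds (x := y))
  have h2 : ∀ n : ℕ, inner ℂ (gaussSmooth hV (1 / ((n : ℝ) + 1)) y) y = (0 : ℂ) := fun n => by
    obtain ⟨w, hw⟩ := isSqrtGraph_gaussSmooth hV (ε := 1 / ((n : ℝ) + 1)) (by positivity) y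
    exact h _ _ hw
  simp only [h2] at h1
  have h3 := tendsto_nhds_unique h1 tendsto_const_nhds
  rw [inner_smul_left] at h3
  simpa [(Real.sqrt_pos.2 Real.pi_pos).ne'] using h3

/-- `Δ^{1/2}` is self-adjoint: its adjoint has no larger domain, because Gaussian averages map the
domain of the adjoint into the domain of `Δ^{1/2}`. -/
theorem of_adjoint [CompleteSpace H] (hV : IsOneParamGroup V) {ζ η : H}
    (hadj : ∀ v w, IsSqrtGraph V v w → inner ℂ w ζ = inner ℂ v η) : IsSqrtGraph V ζ η := by
  have key : ∀ n : ℕ, IsSqrtGraph V (gaussSmooth hV (1 / ((n : ℝ) + 1)) ζ)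
      (gaussSmooth hV (1 / ((n : ℝ) + 1)) η) := fun n => by
    obtain ⟨u, hu⟩ := isSqrtGraph_gaussSmooth hV (ε := 1 / ((n : ℝ) + 1)) (by positivity) ζ
    have hz : u - gaussSmooth hV (1 / ((n : ℝ) + 1)) η = 0 := by
      refine inner_eq_zero_of_domain hV fun v w hvw => ?_
      rw [inner_sub_right, ← hvw.symm hV hu, ← gaussSmooth_symm, ← gaussSmooth_symm,
        hadj _ _ (hvw.clm (gaussSmooth hV _) fun t v => gaussSmooth_comm hV _ t v), sub_self]
    rwa [← sub_eq_zero.1 hz]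
  have h1 := of_tendsto hV key (gaussSmooth_tendsto hV ζ) (gaussSmooth_tendsto hV η)
  have h2 := h1.smul ((Real.sqrt Real.pi : ℂ)⁻¹)
  have h4 : ((Real.sqrt Real.pi : ℝ) : ℂ) ≠ 0 := by
    exact_mod_cast (Real.sqrt_pos.2 Real.pi_pos).ne'
  rwa [inv_smul_smul₀ h4, inv_smul_smul₀ h4] at h2

end IsSqrtGraph

/-! ### The standard subspace with given modular objects -/

namespace StandardSubspace

open Complex Set Filter Topology

variable {H : Type*} [NormedAddCommGroup H] [InnerProductSpace ℂ H]

theorem eqOn_clm (S : StandardSubspace H) {K : Type*} [NormedAddCommGroup K]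
    [InnerProductSpace ℂ K] {A B : H →L[ℂ] K} (h : ∀ x ∈ S.toClosedSubmodule, A x = B x) (x : H) :
    A x = B x := by
  let T : H →L[ℝ] K := (A - B).restrictScalars ℝ
  have hT : ∀ y, T y = A y - B y := fun y => rfl
  let C : ClosedSubmodule ℝ H := (⊥ : ClosedSubmodule ℝ K).comap T
  have hle : S.toClosedSubmodule ⊔ S.toClosedSubmodule.mulI ≤ C := by
    refine sup_le (fun y hy => ?_) (fun y hy => ?_)
    · change T y = 0
      rw [hT, h y hy, sub_self]
    · change T y = 0
      have h1 := h _ (mem_mulI_iff.1 hy)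
      rw [map_smul, map_smul, ← sub_eq_zero, ← smul_sub] at h1
      rw [hT]
      exact (smul_eq_zero_iff_right I_ne_zero).1 h1
  rw [S.IsCyclic] at hle
  have hx : T x = 0 := hle (ClosedSubmodule.mem_top (x := x))
  exact sub_eq_zero.1 hx

theorem mem_symplComp [CompleteSpace H] {S : StandardSubspace H} {x : H} :
    x ∈ S.symplComp.toClosedSubmodule ↔ ∀ y ∈ S.toClosedSubmodule, (inner ℂ y x).im = 0 :=
  ClosedSubmodule.mem_symplComp_iff

theorem ext_mem {S T : StandardSubspace H}
    (h : ∀ x, x ∈ S.toClosedSubmodule ↔ x ∈ T.toClosedSubmodule) : S = T :=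
  toClosedSubmodule_injective (SetLike.ext h)

theorem map_mul (u v : H ≃ₗᵢ[ℂ] H) (S : StandardSubspace H) :
    S.map (u * v) = (S.map v).map u :=
  ext_mem fun _ => by
    rw [mem_map, mem_map, mem_map]
    rfl

theorem map_one (S : StandardSubspace H) : S.map 1 = S :=
  ext_mem fun _ => by
    rw [mem_map]
    rfl

theorem map_symplComp [CompleteSpace H] (u : H ≃ₗᵢ[ℂ] H) (S : StandardSubspace H) :
    (S.map u).symplComp = S.symplComp.map u := by
  refine ext_mem fun x => ?_
  rw [mem_map, mem_symplComp, mem_symplComp]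
  constructor
  · intro h y hy
    have := h (u y) (mem_map.2 (by rwa [u.symm_apply_apply]))
    rwa [← u.inner_map_map, u.apply_symm_apply]
  · intro h y hy
    have := h (u.symm y) (mem_map.1 hy)
    rwa [u.symm.inner_map_map] at this

theorem prod_symplComp [CompleteSpace H] (S T : StandardSubspace H) :
    (S.prod T).symplComp = S.symplComp.prod T.symplComp := by
  refine ext_mem fun x => ?_
  rw [mem_prod, mem_symplComp, mem_symplComp, mem_symplComp]
  constructor
  · intro h
    constructor
    · intro y hy
      have := h (WithLp.toLp 2 (y, 0)) (mem_prod.2 ⟨hy, zero_mem _⟩)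
      simpa [WithLp.prod_inner_apply] using this
    · intro y hy
      have := h (WithLp.toLp 2 (0, y)) (mem_prod.2 ⟨zero_mem _, hy⟩)
      simpa [WithLp.prod_inner_apply] using this
  · rintro ⟨h1, h2⟩ y hy
    have a := h1 _ (mem_prod.1 hy).1
    have b := h2 _ (mem_prod.1 hy).2
    rw [WithLp.prod_inner_apply, add_im]
    change (inner ℂ y.fst x.fst).im + (inner ℂ y.snd x.snd).im = 0
    rw [a, b, add_zero]

theorem prod_map_swapOp (S T : StandardSubspace H) :
    (S.prod T).map (swapOp H) = T.prod S :=
  ext_mem fun x => by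
    rw [mem_map, mem_prod, mem_prod, and_comm]
    rfl

theorem map_prod (S T : StandardSubspace H) (u v : H ≃ₗᵢ[ℂ] H) :
    (S.prod T).map (LinearIsometryEquiv.withLpProdCongr 2 u v) = (S.map u).prod (T.map v) :=
  ext_mem fun x => by
    rw [mem_map, mem_prod, mem_prod, mem_map, mem_map]
    rfl

/-- A direct sum determines its first summand. -/
theorem prod_left_injective {S S' T T' : StandardSubspace H} (h : S.prod T = S'.prod T') :
    S = S' := by
  refine ext_mem fun x => ?_
  have h1 : WithLp.toLp 2 (x, (0 : H)) ∈ (S.prod T).toClosedSubmodule ↔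
      WithLp.toLp 2 (x, (0 : H)) ∈ (S'.prod T').toClosedSubmodule := by rw [h]
  simpa [mem_prod] using h1

end StandardSubspace

/-- `J` is a conjugation commuting with the unitary one-parameter group `V`. -/
structure IsModularData {H : Type*} [NormedAddCommGroup H] [InnerProductSpace ℂ H]
    (J : H ≃ₗᵢ⋆[ℂ] H) (V : ℝ → H ≃ₗᵢ[ℂ] H) : Prop extends IsOneParamGroup V where
  involutive : ∀ v, J (J v) = v
  comm : ∀ t v, J (V t v) = V t (J v)

namespace IsModularData

open Complex Set Filter Topology StandardSubspace

variable {H : Type*} [NormedAddCommGroup H] [InnerProductSpace ℂ H]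
  {J J' : H ≃ₗᵢ⋆[ℂ] H} {V V' : ℝ → H ≃ₗᵢ[ℂ] H}

theorem inverse (D : IsModularData J V) : IsModularData J fun t => V (-t) where
  toIsOneParamGroup := D.toIsOneParamGroup.neg
  involutive := D.involutive
  comm t v := D.comm (-t) v

/-- Every vector of the domain of `Δ^{1/2}` splits into vectors fixed by `J Δ^{1/2}`. -/
theorem exists_decomposition (D : IsModularData J V) {v u : H} (h : IsSqrtGraph V v u) :
    ∃ ξ η, IsSqrtGraph V ξ (J ξ) ∧ IsSqrtGraph V η (J η) ∧ v = ξ + I • η ∧ J u = ξ - I • η := by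
  have h' := h.conjugation D.toIsOneParamGroup D.comm
  refine ⟨(1 / 2 : ℂ) • (v + J u), (-I / 2) • (v - J u), ?_, ?_, ?_, ?_⟩
  · convert! (h.add h').smul (1 / 2) using 1
    rw [map_smulₛₗ, map_add, D.involutive, map_div₀, _root_.map_one, Complex.conj_ofNat, add_comm]
  · convert! (h.sub h').smul (-I / 2) using 1
    rw [map_smulₛₗ, map_sub, D.involutive, map_div₀, map_neg, conj_I, Complex.conj_ofNat]
    module
  all_goals
    rw [smul_smul]
    have : I * (-I / 2) = 1 / 2 := by
      rw [mul_div_assoc', mul_neg, I_mul_I, neg_neg]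
    rw [this]
    module

variable [CompleteSpace H]

/-- The closed real subspace of fixed points of the antilinear involution `J Δ^{1/2}`. -/
def fixedPoints (D : IsModularData J V) : ClosedSubmodule ℝ H where
  carrier := {v | IsSqrtGraph V v (J v)}
  add_mem' := fun {a b} ha hb => by
    change IsSqrtGraph V (a + b) (J (a + b))
    rw [map_add]
    exact IsSqrtGraph.add ha hb
  zero_mem' := by
    change IsSqrtGraph V 0 (J 0)
    rw [map_zero]
    exact IsSqrtGraph.zero
  smul_mem' := fun c v hv => by
    change IsSqrtGraph V (c • v) (J (c • v))
    rw [← Complex.coe_smul, map_smulₛₗ, conj_ofReal]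
    exact IsSqrtGraph.smul hv c
  isClosed' := by
    refine isClosed_of_closure_subset fun v hv => ?_
    obtain ⟨x, hx, hlim⟩ := mem_closure_iff_seq_limit.1 hv
    exact IsSqrtGraph.of_tendsto D.toIsOneParamGroup hx hlim
      ((J.continuous.tendsto v).comp hlim)

/-- The fixed points of `J Δ^{1/2}` form a standard subspace. -/
def standardSubspace (D : IsModularData J V) : StandardSubspace H where
  toClosedSubmodule := D.fixedPoints
  IsSeparating := by
    apply SetLike.ext
    intro v
    rw [ClosedSubmodule.mem_inf, mem_mulI_iff, ClosedSubmodule.mem_bot]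
    constructor
    · rintro ⟨h1, h2⟩
      have h1' : IsSqrtGraph V v (J v) := h1
      have h2' : IsSqrtGraph V (I • v) (J (I • v)) := h2
      have h3 := (h1'.smul I).unique h2'
      rw [map_smulₛₗ, conj_I, neg_smul] at h3
      have h5 : (2 * I) • J v = 0 := by
        rw [two_mul, add_smul]
        nth_rw 1 [h3]
        exact neg_add_cancel _
      have h4 := (smul_eq_zero_iff_right (by simp)).1 h5
      exact (map_eq_zero_iff J J.injective).1 h4
    · rintro rfl
      exact ⟨zero_mem _, by rw [smul_zero]; exact zero_mem _⟩
  IsCyclic := by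
    refine top_le_iff.1 (fun v _ => ?_)
    set S : ClosedSubmodule ℝ H := D.fixedPoints
    have hS : ∀ x, IsSqrtGraph V x (J x) → x ∈ S := fun x hx => hx
    have hdom : ∀ x w, IsSqrtGraph V x w → x ∈ S ⊔ S.mulI := fun x w hx => by
      obtain ⟨ξ, η, h1, h2, rfl, -⟩ := D.exists_decomposition hx
      refine add_mem ((le_sup_left : S ≤ S ⊔ S.mulI) (hS _ h1)) ?_
      refine (le_sup_right : S.mulI ≤ S ⊔ S.mulI) (mem_mulI_iff.2 ?_)
      rw [smul_smul, I_mul_I, neg_one_smul]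
      exact S.toSubmodule.neg_mem (hS _ h2)
    have h3 := (gaussSmooth_tendsto D.toIsOneParamGroup v).const_smul ((Real.sqrt Real.pi : ℂ)⁻¹)
    have h4 : ((Real.sqrt Real.pi : ℝ) : ℂ) ≠ 0 := by
      exact_mod_cast (Real.sqrt_pos.2 Real.pi_pos).ne'
    rw [inv_smul_smul₀ h4] at h3
    refine (S ⊔ S.mulI).isClosed.mem_of_tendsto h3 (.of_forall fun n => ?_)
    obtain ⟨w, hw⟩ := isSqrtGraph_gaussSmooth D.toIsOneParamGroup
      (ε := 1 / ((n : ℝ) + 1)) (by positivity) v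
    exact hdom _ _ (hw.smul _)

theorem mem_standardSubspace (D : IsModularData J V) {v : H} :
    v ∈ D.standardSubspace.toClosedSubmodule ↔ IsSqrtGraph V v (J v) := Iff.rfl

theorem isModularPair (D : IsModularData J V) : IsModularPair D.standardSubspace J V where
  involutive := D.involutive
  map_add := D.map_add
  continuous := D.continuous
  polar v w := by
    constructor
    · rintro ⟨ξ, hξ, η, hη, rfl, rfl⟩
      have h1 : IsSqrtGraph V ξ (J ξ) := hξ
      have h2 : IsSqrtGraph V η (J η) := hη
      refine ⟨_, h1.add (h2.smul I), ?_⟩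
      rw [_root_.map_add, map_smulₛₗ, D.involutive, D.involutive, conj_I, neg_smul, sub_eq_add_neg]
    · rintro ⟨u, hu, rfl⟩
      obtain ⟨ξ, η, h1, h2, h3, h4⟩ := D.exists_decomposition hu
      exact ⟨ξ, h1, η, h2, h3, h4⟩

theorem apply_mem (D : IsModularData J V) (t : ℝ) {v : H}
    (hv : v ∈ D.standardSubspace.toClosedSubmodule) :
    V t v ∈ D.standardSubspace.toClosedSubmodule := by
  rw [mem_standardSubspace, D.comm]
  refine IsSqrtGraph.clm (W := V) hv (V t).toContinuousLinearEquiv.toContinuousLinearMap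
    fun s w => ?_
  change V t (V s w) = V s (V t w)
  rw [← D.add_apply, ← D.add_apply, add_comm]

/-- The symplectic complement is the standard subspace with the modular objects `J` and `Δ⁻¹`: this
expresses the self-adjointness of `Δ^{1/2}`. -/
theorem symplComp_standardSubspace (D : IsModularData J V) :
    D.standardSubspace.symplComp = D.inverse.standardSubspace := by
  refine ext_mem fun η => ?_
  rw [mem_symplComp, mem_standardSubspace]
  constructor
  · intro h
    have hadj : IsSqrtGraph V (J η) η := by
      refine IsSqrtGraph.of_adjoint D.toIsOneParamGroup fun v u hu => ?_
      obtain ⟨ξ, ξ', h1, h2, hv, hJ⟩ := D.exists_decomposition hu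
      have hreal : ∀ x, IsSqrtGraph V x (J x) → inner ℂ η x = inner ℂ x η := fun x hx => by
        rw [← inner_conj_symm]
        exact conj_eq_iff_im.2 (h x hx)
      have hu' : u = J (ξ - I • ξ') := by rw [← hJ, D.involutive]
      rw [hu', inner_conjugation, hv, inner_sub_right, inner_add_left, inner_smul_right,
        inner_smul_left, hreal _ h1, hreal _ h2, conj_I]
      ring
    exact hadj.inverse D.toIsOneParamGroup
  · intro h ξ hξ
    obtain ⟨F, h1, h2, h3, h4⟩ := D.mem_standardSubspace.1 hξ
    obtain ⟨G, k1, k2, k3, k4⟩ := h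
    -- The orbit maps pair to a constant, whose values at `0` and `-i/2` are complex conjugate.
    have := eqOn_of_strip (f := fun z => inner ℂ (F (-conj z)) (G z))
      (g := fun _ => inner ℂ ξ η)
      (IsSqrtGraph.continuousOn_inner h1 k1) (IsSqrtGraph.differentiableOn_inner h2 k2)
      continuousOn_const (differentiableOn_const _) (fun t => ?_) neg_I_div_two_mem_closedStrip
    · have h5 : -conj (-(I / 2)) = -(I / 2) := by
        rw [map_neg, map_div₀, conj_I, Complex.conj_ofNat]
        ring
      simp only [h5, h4, k4] at this
      rw [inner_conjugation, ← inner_conj_symm] at this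
      exact conj_eq_iff_im.1 this
    · simp only [conj_ofReal]
      rw [← ofReal_neg, h3, k3, (V (-t)).inner_map_map]

theorem conjugation_mem (D : IsModularData J V) {v : H}
    (hv : v ∈ D.standardSubspace.toClosedSubmodule) :
    J v ∈ D.standardSubspace.symplComp.toClosedSubmodule := by
  rw [symplComp_standardSubspace, mem_standardSubspace, D.involutive]
  exact IsSqrtGraph.inverse D.toIsOneParamGroup hv

theorem conjugation_mem' (D : IsModularData J V) {v : H}
    (hv : v ∈ D.standardSubspace.symplComp.toClosedSubmodule) :
    J v ∈ D.standardSubspace.toClosedSubmodule := by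
  rw [symplComp_standardSubspace, mem_standardSubspace] at hv
  rw [mem_standardSubspace, D.involutive]
  have := hv.inverse D.inverse.toIsOneParamGroup
  simpa only [neg_neg] using this

/-- The standard subspace determines the modular group: for `ξ ∈ N` and `η ∈ N'` the function
`⟨V'(t) η, V(t) ξ⟩` extends to a bounded holomorphic function on the strip that is real on both
boundary lines, hence constant. -/
theorem group_unique (D : IsModularData J V) (D' : IsModularData J' V')
    (h : D.standardSubspace = D'.standardSubspace) (t : ℝ) : V t = V' t := by
  have key : ∀ ξ ∈ D.standardSubspace.toClosedSubmodule,
      ∀ η ∈ D.standardSubspace.symplComp.toClosedSubmodule,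
      inner ℂ (V' t η) (V t ξ) = inner ℂ η ξ := by
    intro ξ hξ η hη
    have hη' := hη
    rw [h, symplComp_standardSubspace, mem_standardSubspace] at hη'
    obtain ⟨F, h1, h2, h3, h4⟩ := D.mem_standardSubspace.1 hξ
    obtain ⟨G, k1, k2, k3, k4⟩ := hη'
    beta_reduce at k3
    obtain ⟨A, hA⟩ := IsSqrtGraph.extension_bounded D.toIsOneParamGroup h1 h2 h3
    obtain ⟨B, hB⟩ := IsSqrtGraph.extension_bounded D'.inverse.toIsOneParamGroup k1 k2 k3
    have hreal : ∀ x ∈ D.standardSubspace.toClosedSubmodule,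
        ∀ y ∈ D.standardSubspace.symplComp.toClosedSubmodule,
        (inner ℂ x y).im = 0 ∧ (inner ℂ y x).im = 0 := fun x hx y hy => by
      have h5 := mem_symplComp.1 hy x hx
      refine ⟨h5, ?_⟩
      rw [← inner_conj_symm, conj_im, h5, neg_zero]
    have hV' : ∀ s, ∀ x ∈ D.standardSubspace.symplComp.toClosedSubmodule,
        V' s x ∈ D.standardSubspace.symplComp.toClosedSubmodule := fun s x hx => by
      rw [h, symplComp_standardSubspace] at hx ⊢
      have := D'.inverse.apply_mem (-s) hx
      simpa only [neg_neg] using this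
    have hcst := constant_of_real_boundary (g := fun z => inner ℂ (G (-conj z)) (F z)) (B := B * A)
      (IsSqrtGraph.continuousOn_inner k1 h1) (IsSqrtGraph.differentiableOn_inner k2 h2)
      (fun z hz => (norm_inner_le_norm _ _).trans
        (mul_le_mul (hB _ (neg_conj_mem_closedStrip hz)) (hA z hz) (norm_nonneg _)
          ((norm_nonneg _).trans (hB z hz))))
      (fun z hz => ?_) (fun z hz => ?_) t (ofReal_mem_closedStrip t)
    · have e0 : -conj (0 : ℂ) = ((0 : ℝ) : ℂ) := by simp
      simp only [conj_ofReal] at hcst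
      rw [e0, ← ofReal_neg, k3, k3, h3, neg_neg, neg_zero] at hcst
      have h0 := h3 0
      rw [ofReal_zero, D.zero_apply] at h0
      rw [hcst, h0, D'.zero_apply]
    · have hz' : z = (z.re : ℂ) := Complex.ext rfl (by simpa using hz)
      rw [hz', conj_ofReal, ← ofReal_neg, k3, h3, neg_neg]
      exact (hreal _ (D.apply_mem _ hξ) _ (hV' _ _ hη)).2
    · have hz' : z = -(I / 2) + (z.re : ℂ) := Complex.ext (by simp) (by simp [hz])
      have hz'' : -conj z = -(I / 2) + ((-z.re : ℝ) : ℂ) :=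
        Complex.ext (by simp) (by simp [hz])
      rw [hz'', IsSqrtGraph.extension_add D'.inverse.toIsOneParamGroup k1 k2 k3 _
        neg_I_div_two_mem_closedStrip, k4, neg_neg]
      nth_rw 2 [hz']
      rw [IsSqrtGraph.extension_add D.toIsOneParamGroup h1 h2 h3 _
        neg_I_div_two_mem_closedStrip, h4]
      rw [h] at hη
      have a1 := D'.apply_mem z.re (D'.conjugation_mem' hη)
      rw [← h] at a1
      rw [← D.comm]
      exact (hreal _ a1 _ (D.conjugation_mem (D.apply_mem _ hξ))).1
  have h2 : ∀ ξ ∈ D.standardSubspace.toClosedSubmodule, V t ξ = V' t ξ := fun ξ hξ => by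
    have h3 : V' (-t) (V t ξ) - ξ = 0 := by
      refine ext_inner_right ℂ fun x => ?_
      rw [inner_zero_left]
      have := D.standardSubspace.symplComp.eqOn_clm (A := innerSL ℂ (V' (-t) (V t ξ) - ξ)) (B := 0)
        (fun η hη => ?_) x
      · exact this
      · have h4 := key ξ hξ η hη
        rw [D'.inner_apply_left] at h4
        rw [innerSL_apply_apply, zero_apply, ← inner_conj_symm, inner_sub_right,
          h4, sub_self, map_zero]
    rw [← D'.apply_neg_apply t (V t ξ), sub_eq_zero.1 h3]
  ext x
  exact D.standardSubspace.eqOn_clm (A := (V t).toContinuousLinearEquiv.toContinuousLinearMap)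
    (B := (V' t).toContinuousLinearEquiv.toContinuousLinearMap) h2 x

/-- The conjugation `u J u⁻¹`. -/
abbrev conjConjugation (u : H ≃ₗᵢ[ℂ] H) (J : H ≃ₗᵢ⋆[ℂ] H) : H ≃ₗᵢ⋆[ℂ] H :=
  (u.symm.trans J).trans u

omit [CompleteSpace H] in
theorem conjugate (D : IsModularData J V) (u : H ≃ₗᵢ[ℂ] H) :
    IsModularData (conjConjugation u J) fun t => u * V t * u⁻¹ where
  toIsOneParamGroup := D.toIsOneParamGroup.conjugate u
  involutive v := by
    change u (J (u.symm (u (J (u.symm v))))) = v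
    rw [u.symm_apply_apply, D.involutive, u.apply_symm_apply]
  comm t v := by
    change u (J (u.symm (u (V t (u.symm v))))) = u (V t (u.symm (u (J (u.symm v)))))
    rw [u.symm_apply_apply, u.symm_apply_apply, D.comm]

theorem standardSubspace_conjugate (D : IsModularData J V) (u : H ≃ₗᵢ[ℂ] H) :
    (D.conjugate u).standardSubspace = D.standardSubspace.map u := by
  refine ext_mem fun x => ?_
  rw [StandardSubspace.mem_map, mem_standardSubspace, mem_standardSubspace]
  constructor
  · intro h
    have := h.clm (W := V) u.symm.toContinuousLinearEquiv.toContinuousLinearMap fun t v => by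
      change u.symm (u (V t (u.symm v))) = V t (u.symm v)
      rw [u.symm_apply_apply]
    change IsSqrtGraph V (u.symm x) (u.symm (u (J (u.symm x)))) at this
    rwa [u.symm_apply_apply] at this
  · intro h
    have := h.clm (W := fun t => u * V t * u⁻¹)
      u.toContinuousLinearEquiv.toContinuousLinearMap fun t v => by
        change u (V t v) = u (V t (u.symm (u v)))
        rw [u.symm_apply_apply]
    change IsSqrtGraph _ (u (u.symm x)) (u (J (u.symm x))) at this
    rwa [u.apply_symm_apply] at this

/-- A unitary operator preserves the standard subspace if it commutes with the modular objects. -/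
theorem map_eq_of_comm (D : IsModularData J V) {u : H ≃ₗᵢ[ℂ] H} (hJ : ∀ v, u (J v) = J (u v))
    (hV : ∀ t, Commute u (V t)) : D.standardSubspace.map u = D.standardSubspace := by
  rw [← D.standardSubspace_conjugate]
  refine ext_mem fun x => ?_
  rw [mem_standardSubspace, mem_standardSubspace]
  have h1 : conjConjugation u J x = J x := by
    change u (J (u.symm x)) = J x
    rw [hJ, u.apply_symm_apply]
  have h2 : (fun t => u * V t * u⁻¹) = V := by
    funext t
    rw [(hV t).eq, mul_inv_cancel_right]
  rw [h1, h2]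

/-- A unitary operator that preserves the standard subspace commutes with the modular group. -/
theorem comm_of_map_eq (D : IsModularData J V) {u : H ≃ₗᵢ[ℂ] H}
    (h : D.standardSubspace.map u = D.standardSubspace) (t : ℝ) : Commute u (V t) := by
  rw [← D.standardSubspace_conjugate] at h
  have := (D.conjugate u).group_unique D h t
  exact mul_inv_eq_iff_eq_mul.1 this

end IsModularData

namespace IsModularPair

variable {H : Type*} [NormedAddCommGroup H] [InnerProductSpace ℂ H]
  {J J' : H ≃ₗᵢ⋆[ℂ] H} {V V' : ℝ → H ≃ₗᵢ[ℂ] H} {S T : StandardSubspace H}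

/-- The conjugation `J ⊕ J'`. -/
def prodConjugation (J J' : H ≃ₗᵢ⋆[ℂ] H) :
    WithLp 2 (H × H) ≃ₗᵢ⋆[ℂ] WithLp 2 (H × H) where
  toFun x := WithLp.toLp 2 (J x.fst, J' x.snd)
  invFun x := WithLp.toLp 2 (J.symm x.fst, J'.symm x.snd)
  map_add' x y := by
    apply WithLp.ofLp_injective 2
    exact Prod.ext (_root_.map_add J _ _) (_root_.map_add J' _ _)
  map_smul' c x := by
    apply WithLp.ofLp_injective 2
    exact Prod.ext (map_smulₛₗ J c _) (map_smulₛₗ J' c _)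
  left_inv x := by
    apply WithLp.ofLp_injective 2
    exact Prod.ext (J.symm_apply_apply _) (J'.symm_apply_apply _)
  right_inv x := by
    apply WithLp.ofLp_injective 2
    exact Prod.ext (J.apply_symm_apply _) (J'.apply_symm_apply _)
  norm_map' x := by
    change ‖WithLp.toLp 2 (J x.fst, J' x.snd)‖ = ‖x‖
    rw [WithLp.prod_norm_eq_of_L2, WithLp.prod_norm_eq_of_L2]
    simp

theorem isSqrtGraph_prod {v w : WithLp 2 (H × H)} :
    IsSqrtGraph (fun t => LinearIsometryEquiv.withLpProdCongr 2 (V t) (V' t)) v w ↔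
      IsSqrtGraph V v.fst w.fst ∧ IsSqrtGraph V' v.snd w.snd := by
  constructor
  · intro h
    exact ⟨h.clm (WithLp.fstL 2 ℂ H H) fun t v => rfl, h.clm (WithLp.sndL 2 ℂ H H) fun t v => rfl⟩
  · rintro ⟨⟨F, h1, h2, h3, h4⟩, G, k1, k2, k3, k4⟩
    let e := (WithLp.prodContinuousLinearEquiv 2 ℂ H H).symm
    refine ⟨fun z => e (F z, G z), e.continuous.comp_continuousOn (h1.prodMk k1),
      e.differentiable.comp_differentiableOn (h2.prodMk k2), fun t => ?_, ?_⟩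
    · beta_reduce
      rw [h3, k3]
      rfl
    · beta_reduce
      rw [h4, k4]
      rfl

theorem prod (h : IsModularPair S J V) (h' : IsModularPair T J' V') :
    IsModularPair (S.prod T) (prodConjugation J J')
      fun t => LinearIsometryEquiv.withLpProdCongr 2 (V t) (V' t) where
  involutive x := by
    apply WithLp.ofLp_injective 2
    exact Prod.ext (h.involutive _) (h'.involutive _)
  map_add s t := by
    ext x
    apply WithLp.ofLp_injective 2
    refine Prod.ext ?_ ?_
    · change V (s + t) x.fst = V s (V t x.fst)
      rw [h.map_add]
      rfl
    · change V' (s + t) x.snd = V' s (V' t x.snd)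
      rw [h'.map_add]
      rfl
  continuous x := (WithLp.prodContinuousLinearEquiv 2 ℂ H H).symm.continuous.comp
    ((h.continuous x.fst).prodMk (h'.continuous x.snd))
  polar v w := by
    have hT : (S.prod T).IsTomita v w ↔ S.IsTomita v.fst w.fst ∧ T.IsTomita v.snd w.snd := by
      constructor
      · rintro ⟨ξ, hξ, η, hη, rfl, rfl⟩
        exact ⟨⟨ξ.fst, hξ.1, η.fst, hη.1, rfl, rfl⟩, ⟨ξ.snd, hξ.2, η.snd, hη.2, rfl, rfl⟩⟩
      · rintro ⟨⟨ξ, hξ, η, hη, h1, h2⟩, ξ', hξ', η', hη', h3, h4⟩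
        exact ⟨WithLp.toLp 2 (ξ, ξ'), ⟨hξ, hξ'⟩, WithLp.toLp 2 (η, η'), ⟨hη, hη'⟩,
          WithLp.ofLp_injective 2 (Prod.ext h1 h3), WithLp.ofLp_injective 2 (Prod.ext h2 h4)⟩
    rw [hT, h.polar, h'.polar]
    constructor
    · rintro ⟨⟨u, hu, e⟩, u', hu', e'⟩
      exact ⟨WithLp.toLp 2 (u, u'), isSqrtGraph_prod.2 ⟨hu, hu'⟩,
        WithLp.ofLp_injective 2 (Prod.ext e e')⟩
    · rintro ⟨u, hu, rfl⟩
      exact ⟨⟨u.fst, (isSqrtGraph_prod.1 hu).1, rfl⟩, u.snd, (isSqrtGraph_prod.1 hu).2, rfl⟩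

end IsModularPair

/-! ### Exponentials in Banach algebras and of endomorphisms -/

section Trotter

open Filter Topology NormedSpace

variable {A : Type*} [NormedRing A] [NormOneClass A]

theorem norm_pow_sub_pow_le {x y : A} {c : ℝ} (hc : 1 ≤ c) (hx : ‖x‖ ≤ c) (hy : ‖y‖ ≤ c) (n : ℕ) :
    ‖x ^ n - y ^ n‖ ≤ n * c ^ n * ‖x - y‖ := by
  induction n with
  | zero => simp
  | succ n ih =>
    have e : x ^ (n + 1) - y ^ (n + 1) = x ^ n * (x - y) + (x ^ n - y ^ n) * y := by
      rw [pow_succ, pow_succ, mul_sub, sub_mul]; abel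
    have h1 : ‖x ^ n‖ ≤ c ^ n :=
      (norm_pow_le x n).trans (pow_le_pow_left₀ (norm_nonneg _) hx n)
    have h2 : c ^ n ≤ c ^ (n + 1) := pow_le_pow_right₀ hc n.le_succ
    calc ‖x ^ (n + 1) - y ^ (n + 1)‖ ≤ ‖x ^ n‖ * ‖x - y‖ + ‖x ^ n - y ^ n‖ * ‖y‖ := by
          rw [e]
          exact (norm_add_le _ _).trans (add_le_add (norm_mul_le _ _) (norm_mul_le _ _))
      _ ≤ c ^ (n + 1) * ‖x - y‖ + n * c ^ n * ‖x - y‖ * c :=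
          add_le_add (mul_le_mul_of_nonneg_right (h1.trans h2) (norm_nonneg _))
            (mul_le_mul ih hy (norm_nonneg _) (by positivity))
      _ = _ := by push_cast; ring

variable [NormedAlgebra ℝ A]

theorem norm_exp_le_exp_norm (x : A) : ‖exp x‖ ≤ Real.exp ‖x‖ := by
  have h : HasSum (fun n : ℕ => ‖x‖ ^ n / n.factorial) (Real.exp ‖x‖) := by
    rw [Real.exp_eq_exp_ℝ]
    exact expSeries_div_hasSum_exp ‖x‖
  rw [exp_eq_tsum (𝕂 := ℝ)]
  refine tsum_of_norm_bounded h fun n => ?_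
  rw [norm_smul, norm_inv, Real.norm_natCast, div_eq_inv_mul]
  exact mul_le_mul_of_nonneg_left (norm_pow_le x n) (by positivity)

variable [CompleteSpace A]

/-- The Lie–Trotter product formula. -/
theorem tendsto_trotter (a b : A) :
    Tendsto (fun n : ℕ => (exp ((1 / ((n : ℝ) + 1)) • a) * exp ((1 / ((n : ℝ) + 1)) • b)) ^ (n + 1))
      atTop (𝓝 (exp (a + b))) := by
  let : NormedAlgebra ℚ A := NormedAlgebra.restrictScalars ℚ ℝ A
  have hnorm : ∀ x : A, ‖exp x‖ ≤ Real.exp ‖x‖ := norm_exp_le_exp_norm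
  have hder : HasDerivAt (fun t : ℝ => exp (t • a) * exp (t • b) - exp (t • (a + b))) 0 0 := by
    have h1 := hasDerivAt_exp_smul_const (𝕂 := ℝ) a (0 : ℝ)
    have h2 := hasDerivAt_exp_smul_const (𝕂 := ℝ) b (0 : ℝ)
    have h3 := hasDerivAt_exp_smul_const (𝕂 := ℝ) (a + b) (0 : ℝ)
    have := (h1.mul h2).sub h3
    convert! this using 1
    simp
  have hseq : Tendsto (fun n : ℕ => 1 / ((n : ℝ) + 1)) atTop (𝓝[≠] 0) :=
    tendsto_nhdsWithin_iff.2 ⟨tendsto_one_div_add_atTop_nhds_zero_nat,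
      .of_forall fun n => by simp; positivity⟩
  have hlim := (hasDerivAt_iff_tendsto_slope.1 hder).comp hseq
  have hlim' := (hlim.norm).const_mul (Real.exp (‖a‖ + ‖b‖))
  rw [norm_zero, mul_zero] at hlim'
  rw [tendsto_iff_norm_sub_tendsto_zero]
  refine squeeze_zero (fun _ => norm_nonneg _) (fun n => ?_) hlim'
  set t : ℝ := 1 / ((n : ℝ) + 1) with ht
  have ht0 : 0 < t := by positivity
  have htn : t * (n + 1) = 1 := by rw [ht]; field_simp
  set c : ℝ := Real.exp (t * (‖a‖ + ‖b‖))
  have hX : ‖exp (t • a) * exp (t • b)‖ ≤ c := by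
    refine (norm_mul_le _ _).trans ((mul_le_mul (hnorm _) (hnorm _) (norm_nonneg _)
      (Real.exp_nonneg _)).trans ?_)
    rw [← Real.exp_add, norm_smul, norm_smul, Real.norm_of_nonneg ht0.le, ← mul_add]
  have hY : ‖exp (t • (a + b))‖ ≤ c := by
    refine (hnorm _).trans (Real.exp_le_exp.2 ?_)
    rw [norm_smul, Real.norm_of_nonneg ht0.le]
    exact mul_le_mul_of_nonneg_left (norm_add_le _ _) ht0.le
  have hc : 1 ≤ c := Real.one_le_exp (by positivity)
  have hcn : c ^ (n + 1) = Real.exp (‖a‖ + ‖b‖) := by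
    rw [← Real.exp_nat_mul]
    congr 1
    push_cast
    rw [← mul_assoc, mul_comm ((n : ℝ) + 1), htn, one_mul]
  have hYn : exp (a + b) = exp (t • (a + b)) ^ (n + 1) := by
    rw [← exp_nsmul]
    congr 1
    rw [← Nat.cast_smul_eq_nsmul ℝ, smul_smul]
    push_cast
    rw [mul_comm, htn, one_smul]
  have hmain := norm_pow_sub_pow_le hc hX hY (n + 1)
  rw [← hYn, hcn] at hmain
  refine hmain.trans (le_of_eq ?_)
  simp only [Function.comp, slope, vsub_eq_sub, zero_smul, exp_zero, one_mul, sub_self, sub_zero,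
    norm_smul, norm_inv, ← ht]
  rw [Real.norm_of_nonneg ht0.le]
  have : t⁻¹ = n + 1 := by rw [ht]; field_simp
  rw [this]
  push_cast
  ring

end Trotter

section EndExp

open Filter Topology
open scoped Matrix.Norms.Operator

variable {V : Type*} [LieRing V] [LieAlgebra ℝ V] [FiniteDimensional ℝ V]

/-- The coordinate matrix of an endomorphism. -/
abbrev coordMat : Module.End ℝ V ≃ₐ[ℝ]
    Matrix (Fin (Module.finrank ℝ V)) (Fin (Module.finrank ℝ V)) ℝ :=
  LinearMap.toMatrixAlgEquiv (Module.finBasis ℝ V)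

theorem coordMat_endExp (A : Module.End ℝ V) :
    coordMat (endExp A) = NormedSpace.exp (coordMat A) := by
  rw [endExp, AlgEquiv.apply_symm_apply]

/-- The matrix coefficient `M ↦ φ (M x)`, as a continuous function of the coordinate matrix. -/
def matCoeff (φ : Module.Dual ℝ V) (x : V) :
    Matrix (Fin (Module.finrank ℝ V)) (Fin (Module.finrank ℝ V)) ℝ →L[ℝ] ℝ :=
  LinearMap.toContinuousLinearMap
    { toFun := fun M => φ (coordMat.symm M x)
      map_add' := fun M N => by rw [map_add, LinearMap.add_apply, map_add]
      map_smul' := fun c M => by rw [map_smul, LinearMap.smul_apply, map_smul, RingHom.id_apply] }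

theorem matCoeff_coordMat (φ : Module.Dual ℝ V) (x : V) (A : Module.End ℝ V) :
    matCoeff φ x (coordMat A) = φ (A x) := by
  change φ (coordMat.symm (coordMat A) x) = _
  rw [AlgEquiv.symm_apply_apply]

/-- The exponential series in matrix coefficients. Linear functionals separate points, so that no
topology on `V` is needed. -/
theorem hasSum_endExp (A : Module.End ℝ V) (φ : Module.Dual ℝ V) (x : V) :
    HasSum (fun n : ℕ => (n.factorial : ℝ)⁻¹ * φ ((A ^ n) x)) (φ (endExp A x)) := by
  have h : HasSum (fun n : ℕ => (n.factorial : ℝ)⁻¹ • coordMat A ^ n)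
      (NormedSpace.exp (coordMat A)) := NormedSpace.exp_series_hasSum_exp' (𝕂 := ℝ) (coordMat A)
  rw [← coordMat_endExp] at h
  have h' := h.mapL (matCoeff φ x)
  simpa only [← map_pow, map_smul, matCoeff_coordMat, smul_eq_mul] using h'

theorem eq_of_dual_eq {x y : V} (h : ∀ φ : Module.Dual ℝ V, φ x = φ y) : x = y := by
  rw [← sub_eq_zero, ← Module.forall_dual_apply_eq_zero_iff ℝ]
  exact fun φ => by rw [map_sub, h, sub_self]

theorem endExp_add_of_commute {A B : Module.End ℝ V} (h : Commute A B) :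
    endExp (A + B) = endExp A * endExp B := by
  apply coordMat.injective
  rw [map_mul, coordMat_endExp, coordMat_endExp, coordMat_endExp, map_add]
  exact Matrix.exp_add_of_commute _ _ (h.map coordMat)

theorem endExp_zero : endExp (0 : Module.End ℝ V) = 1 := by
  apply coordMat.injective
  rw [coordMat_endExp, map_zero, map_one, NormedSpace.exp_zero]

/-- Linear maps intertwining two endomorphisms intertwine their exponentials. -/
theorem endExp_intertwine {W : Type*} [LieRing W] [LieAlgebra ℝ W] [FiniteDimensional ℝ W]
    {A : Module.End ℝ V} {B : Module.End ℝ W} (L : V →ₗ[ℝ] W) (h : ∀ x, L (A x) = B (L x)) (x : V) :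
    L (endExp A x) = endExp B (L x) := by
  refine eq_of_dual_eq fun φ => ?_
  have h1 := hasSum_endExp A (φ ∘ₗ L) x
  have hn : ∀ n : ℕ, L ((A ^ n) x) = (B ^ n) (L x) := fun n => by
    induction n with
    | zero => rfl
    | succ n ih => rw [pow_succ', pow_succ', Module.End.mul_apply, h, ih, Module.End.mul_apply]
  simp only [LinearMap.comp_apply, hn] at h1
  exact h1.unique (hasSum_endExp B φ (L x))

/-- Linear maps to a coordinate space intertwining an endomorphism with a matrix intertwine the
exponentials. -/
theorem endExp_mulVec {m : Type*} [Fintype m] [DecidableEq m] {A : Module.End ℝ V}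
    {B : Matrix m m ℝ} (L : V →ₗ[ℝ] m → ℝ) (h : ∀ x, L (A x) = B.mulVec (L x)) (x : V) :
    L (endExp A x) = (NormedSpace.exp B).mulVec (L x) := by
  funext i
  have h1 := hasSum_endExp A (LinearMap.proj i ∘ₗ L) x
  have hn : ∀ n : ℕ, L ((A ^ n) x) = (B ^ n).mulVec (L x) := fun n => by
    induction n with
    | zero => simp
    | succ n ih =>
      rw [pow_succ', pow_succ', Module.End.mul_apply, h, ih, Matrix.mulVec_mulVec]
  simp only [LinearMap.comp_apply, hn] at h1
  have h2 : HasSum (fun n : ℕ => (n.factorial : ℝ)⁻¹ • B ^ n) (NormedSpace.exp B) :=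
    NormedSpace.exp_series_hasSum_exp' (𝕂 := ℝ) B
  have h3 := h2.mapL (LinearMap.toContinuousLinearMap
    ((LinearMap.proj i : (m → ℝ) →ₗ[ℝ] ℝ) ∘ₗ
      (LinearMap.applyₗ (L x)) ∘ₗ (Matrix.toLin' (R := ℝ) (m := m) (n := m)).toLinearMap))
  refine h1.unique (h3.congr_fun fun n => ?_)
  rw [map_smul]
  rfl

theorem endExp_conj (a : V ≃ₗ[ℝ] V) {A B : Module.End ℝ V} (h : ∀ x, a (A x) = B (a x)) (x : V) :
    a (endExp A x) = endExp B (a x) :=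
  endExp_intertwine a.toLinearMap h x

theorem continuous_endExp_smul (A : Module.End ℝ V) (φ : Module.Dual ℝ V) (x : V) :
    Continuous fun t : ℝ => φ (endExp (t • A) x) := by
  have h : ∀ t : ℝ, φ (endExp (t • A) x) = matCoeff φ x (NormedSpace.exp (t • coordMat A)) :=
    fun t => by rw [← map_smul, ← coordMat_endExp, matCoeff_coordMat]
  simp only [h]
  refine (matCoeff φ x).continuous.comp ?_
  let := NormedAlgebra.restrictScalars ℚ ℝ
    (Matrix (Fin (Module.finrank ℝ V)) (Fin (Module.finrank ℝ V)) ℝ)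
  exact NormedSpace.exp_continuous.comp (continuous_id.smul continuous_const)

theorem hasDerivAt_endExp_smul (A : Module.End ℝ V) (φ : Module.Dual ℝ V) (x : V) :
    HasDerivAt (fun t : ℝ => φ (endExp (t • A) x)) (φ (A x)) 0 := by
  have h : ∀ t : ℝ, φ (endExp (t • A) x) = matCoeff φ x (NormedSpace.exp (t • coordMat A)) :=
    fun t => by rw [← map_smul, ← coordMat_endExp, matCoeff_coordMat]
  simp only [h]
  have h1 := hasDerivAt_exp_smul_const (𝕂 := ℝ) (coordMat A) (0 : ℝ)
  rw [zero_smul, NormedSpace.exp_zero, one_mul] at h1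
  have h2 := (matCoeff φ x).hasFDerivAt.comp_hasDerivAt (0 : ℝ) h1
  rw [← matCoeff_coordMat]
  exact h2

theorem tendsto_endExp_trotter [Nontrivial V] (A B : Module.End ℝ V) (φ : Module.Dual ℝ V) (x : V) :
    Tendsto (fun n : ℕ => φ (((endExp ((1 / ((n : ℝ) + 1)) • A) *
      endExp ((1 / ((n : ℝ) + 1)) • B)) ^ (n + 1)) x)) atTop (𝓝 (φ (endExp (A + B) x))) := by
  have : Nonempty (Fin (Module.finrank ℝ V)) := ⟨⟨0, Module.finrank_pos⟩⟩
  have h := ((matCoeff φ x).continuous.tendsto _).comp (tendsto_trotter (coordMat A) (coordMat B))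
  rw [← map_add] at h
  have e : NormedSpace.exp (coordMat (A + B)) = coordMat (endExp (A + B)) :=
    (coordMat_endExp _).symm
  refine (h.congr fun n => ?_).trans (le_of_eq ?_)
  · rw [← matCoeff_coordMat, map_pow, map_mul, coordMat_endExp, coordMat_endExp, map_smul, map_smul]
    rfl
  · rw [← matCoeff_coordMat, coordMat_endExp]
    rfl

end EndExp

/-! ### Inner automorphisms -/

section InnerAutomorphisms

open Filter Topology

section

attribute [local instance 100] LieRing.ofAssociativeRing LieAlgebra.ofAssociativeAlgebra

variable {V : Type*} [LieRing V] [LieAlgebra ℝ V] [FiniteDimensional ℝ V]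

theorem endExp_mulLeft (A B : Module.End ℝ V) :
    endExp (LinearMap.mulLeft ℝ A) B = endExp A * B := by
  ext x
  exact endExp_intertwine (A := LinearMap.mulLeft ℝ A) (B := A) (LinearMap.applyₗ x)
    (fun _ => rfl) B

theorem endExp_neg_mulRight (A B : Module.End ℝ V) :
    endExp (-LinearMap.mulRight ℝ A) B = B * endExp (-A) := by
  ext x
  refine eq_of_dual_eq fun φ => ?_
  have h1 := hasSum_endExp (-LinearMap.mulRight ℝ A) (φ ∘ₗ LinearMap.applyₗ x) B
  have h2 := hasSum_endExp (-A) (φ ∘ₗ B) x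
  have hn : ∀ n : ℕ, ((-LinearMap.mulRight ℝ A) ^ n) B = B * (-A) ^ n := fun n => by
    induction n with
    | zero => simp
    | succ n ih =>
      rw [pow_succ', Module.End.mul_apply, ih, LinearMap.neg_apply, LinearMap.mulRight_apply,
        pow_succ, mul_assoc, mul_neg, mul_neg]
  simp only [hn] at h1
  exact h1.unique h2

/-- `e^{[A, ·]} B = e^A B e^{-A}`. -/
theorem endExp_commutator (A B : Module.End ℝ V) :
    endExp (LinearMap.mulLeft ℝ A - LinearMap.mulRight ℝ A) B = endExp A * B * endExp (-A) := by
  have hc : Commute (LinearMap.mulLeft ℝ A) (-LinearMap.mulRight ℝ A) := by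
    ext C x
    simp [mul_assoc]
  rw [sub_eq_add_neg, endExp_add_of_commute hc, Module.End.mul_apply, endExp_neg_mulRight,
    endExp_mulLeft, mul_assoc]

/-- `e^{ad x}` is an automorphism: apply `endExp_intertwine` to `ad : V → End V`, which intertwines
`ad x` with the commutator with `ad x`. -/
theorem endExp_ad_lie (x y z : V) :
    endExp (LieAlgebra.ad ℝ V x) ⁅y, z⁆ =
      ⁅endExp (LieAlgebra.ad ℝ V x) y, endExp (LieAlgebra.ad ℝ V x) z⁆ := by
  have h := endExp_intertwine (A := LieAlgebra.ad ℝ V x)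
    (B := LinearMap.mulLeft ℝ (LieAlgebra.ad ℝ V x) - LinearMap.mulRight ℝ (LieAlgebra.ad ℝ V x))
    (LieAlgebra.ad ℝ V).toLinearMap (fun w => (LieAlgebra.ad ℝ V).map_lie x w) y
  rw [endExp_commutator] at h
  have h2 := LinearMap.congr_fun h (endExp (LieAlgebra.ad ℝ V x) z)
  have h3 : endExp (-LieAlgebra.ad ℝ V x) (endExp (LieAlgebra.ad ℝ V x) z) = z :=
    (expAd x).symm_apply_apply z
  rw [Module.End.mul_apply, Module.End.mul_apply, h3] at h2
  exact h2.symm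

end

variable {𝔤 : Type*} [LieRing 𝔤] [LieAlgebra ℝ 𝔤] [FiniteDimensional ℝ 𝔤]

theorem expAd_apply (x y : 𝔤) : expAd x y = endExp (LieAlgebra.ad ℝ 𝔤 x) y := rfl

theorem coe_innExp (x : 𝔤) : (innExp x : 𝔤 ≃ₗ[ℝ] 𝔤) = expAd x := rfl

theorem inn_lie (a : Inn 𝔤) (y z : 𝔤) :
    (a : 𝔤 ≃ₗ[ℝ] 𝔤) ⁅y, z⁆ = ⁅(a : 𝔤 ≃ₗ[ℝ] 𝔤) y, (a : 𝔤 ≃ₗ[ℝ] 𝔤) z⁆ := by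
  obtain ⟨a, ha⟩ := a
  change a ⁅y, z⁆ = ⁅a y, a z⁆
  induction ha using Subgroup.closure_induction generalizing y z with
  | mem a h =>
    obtain ⟨x, rfl⟩ := h
    exact endExp_ad_lie x y z
  | one => rfl
  | mul a b _ _ iha ihb => rw [LinearEquiv.mul_apply, ihb, iha]; rfl
  | inv a _ ih =>
    apply a.injective
    rw [ih]
    change a (a.symm _) = ⁅a (a.symm y), a (a.symm z)⁆
    simp only [LinearEquiv.apply_symm_apply]

theorem expAd_eq_self {x y : 𝔤} (h : ⁅x, y⁆ = 0) : expAd x y = y := by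
  refine eq_of_dual_eq fun φ => (hasSum_endExp (LieAlgebra.ad ℝ 𝔤 x) φ y).unique ?_
  have h1 := hasSum_single (f := fun n : ℕ =>
    (n.factorial : ℝ)⁻¹ * φ (((LieAlgebra.ad ℝ 𝔤 x) ^ n) y)) 0 (fun n hn => by
      obtain ⟨m, rfl⟩ := Nat.exists_eq_succ_of_ne_zero hn
      rw [pow_succ, Module.End.mul_apply, LieAlgebra.ad_apply, h, map_zero, map_zero, mul_zero])
  simpa using h1

omit [FiniteDimensional ℝ 𝔤] in
theorem commute_ad {x y : 𝔤} (h : ⁅x, y⁆ = 0) :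
    Commute (LieAlgebra.ad ℝ 𝔤 x) (LieAlgebra.ad ℝ 𝔤 y) := by
  ext z
  simp only [Module.End.mul_apply, LieAlgebra.ad_apply]
  rw [leibniz_lie, h, zero_lie, zero_add]

theorem innExp_add {x y : 𝔤} (h : ⁅x, y⁆ = 0) : innExp (x + y) = innExp x * innExp y := by
  apply Subtype.ext
  ext z
  change endExp (LieAlgebra.ad ℝ 𝔤 (x + y)) z = _
  rw [map_add, endExp_add_of_commute (commute_ad h)]
  rfl

theorem innExp_zero : innExp (0 : 𝔤) = 1 := by
  apply Subtype.ext
  ext z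
  change endExp (LieAlgebra.ad ℝ 𝔤 0) z = z
  rw [map_zero, endExp_zero]
  rfl

theorem innExp_add_smul (s t : ℝ) (x : 𝔤) :
    innExp ((s + t) • x) = innExp (s • x) * innExp (t • x) := by
  rw [add_smul, innExp_add (by rw [smul_lie, lie_smul, lie_self, smul_zero, smul_zero])]

theorem innExp_neg (x : 𝔤) : innExp (-x) = (innExp x)⁻¹ := by
  rw [eq_inv_iff_mul_eq_one, ← innExp_add (by rw [neg_lie, lie_self, neg_zero]), neg_add_cancel,
    innExp_zero]

theorem inn_conj_innExp (a : Inn 𝔤) (x : 𝔤) :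
    a * innExp x * a⁻¹ = innExp ((a : 𝔤 ≃ₗ[ℝ] 𝔤) x) := by
  rw [mul_inv_eq_iff_eq_mul]
  apply Subtype.ext
  ext z
  exact endExp_conj (a : 𝔤 ≃ₗ[ℝ] 𝔤) (A := LieAlgebra.ad ℝ 𝔤 x)
    (B := LieAlgebra.ad ℝ 𝔤 ((a : 𝔤 ≃ₗ[ℝ] 𝔤) x)) (inn_lie a x) z

theorem tendsto_inn {α : Type*} {l : Filter α} {u : α → Inn 𝔤} {a : Inn 𝔤} :
    Tendsto u l (𝓝 a) ↔ ∀ (x : 𝔤) (φ : Module.Dual ℝ 𝔤),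
      Tendsto (fun n => φ ((u n : 𝔤 ≃ₗ[ℝ] 𝔤) x)) l (𝓝 (φ ((a : 𝔤 ≃ₗ[ℝ] 𝔤) x))) := by
  rw [tendsto_subtype_rng, nhds_induced, tendsto_comap_iff, tendsto_pi_nhds]
  exact ⟨fun h x φ => h (x, φ), fun h p => h p.1 p.2⟩

theorem continuous_innExp_smul (x : 𝔤) : Continuous fun t : ℝ => innExp (t • x) := by
  rw [continuous_iff_continuousAt]
  intro t
  refine tendsto_inn.2 fun y φ => ?_
  have := (continuous_endExp_smul (LieAlgebra.ad ℝ 𝔤 x) φ y).tendsto t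
  simp only [← map_smul] at this
  exact this

theorem tendsto_innExp_trotter [Nontrivial 𝔤] (x y : 𝔤) :
    Tendsto (fun n : ℕ => (innExp ((1 / ((n : ℝ) + 1)) • x) *
      innExp ((1 / ((n : ℝ) + 1)) • y)) ^ (n + 1)) atTop (𝓝 (innExp (x + y))) := by
  refine tendsto_inn.2 fun z φ => ?_
  have h := tendsto_endExp_trotter (LieAlgebra.ad ℝ 𝔤 x) (LieAlgebra.ad ℝ 𝔤 y) φ z
  rw [← map_add] at h
  refine h.congr fun n => ?_
  rw [← map_smul, ← map_smul]
  have key : ∀ (a : Inn 𝔤) (m : ℕ) (w : 𝔤), ((a ^ m : Inn 𝔤) : 𝔤 ≃ₗ[ℝ] 𝔤) w =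
      (((a : 𝔤 ≃ₗ[ℝ] 𝔤) : Module.End ℝ 𝔤) ^ m) w := fun a m w => by
    induction m with
    | zero => rfl
    | succ m ih =>
      rw [pow_succ', pow_succ', Module.End.mul_apply, ← ih]
      rfl
  rw [key]
  rfl

/-! ### Continuous unitary representations of `Inn(𝔤)` for simple `𝔤` -/

variable {H : Type*} [NormedAddCommGroup H] [InnerProductSpace ℂ H] {π : Inn 𝔤 →* (H ≃ₗᵢ[ℂ] H)}

/-- If two one-parameter subgroups have the same image, then the one generated by the difference of
their generators lies in the kernel. -/
theorem innExp_sub_mem_ker [Nontrivial 𝔤] (hπ : ∀ v, Continuous fun a => π a v) {x y : 𝔤}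
    (h : ∀ t : ℝ, π (innExp (t • x)) = π (innExp (t • y))) (t : ℝ) :
    π (innExp (t • (x - y))) = 1 := by
  have h1 := tendsto_innExp_trotter (t • x) (-(t • y))
  ext v
  have h2 := ((hπ v).tendsto _).comp h1
  have h3 : ∀ n : ℕ, π ((innExp ((1 / ((n : ℝ) + 1)) • t • x) *
      innExp ((1 / ((n : ℝ) + 1)) • -(t • y))) ^ (n + 1)) = 1 := fun n => by
    rw [map_pow, map_mul, smul_neg, innExp_neg, map_inv, smul_smul, smul_smul, h, mul_inv_cancel,
      one_pow]
  simp only [Function.comp_def, h3] at h2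
  rw [smul_sub, sub_eq_add_neg]
  exact tendsto_nhds_unique h2 tendsto_const_nhds

/-- The Lie algebra of the kernel of `π`, as an ideal. It is closed under sums by Trotter's formula,
and an ideal because it is invariant under inner automorphisms. -/
def kernelIdeal [Nontrivial 𝔤] (hπ : ∀ v, Continuous fun a => π a v) : LieIdeal ℝ 𝔤 :=
  let K : Submodule ℝ 𝔤 :=
    { carrier := {x | ∀ t : ℝ, π (innExp (t • x)) = 1}
      add_mem' := fun {x y} hx hy t => by
        have := innExp_sub_mem_ker hπ (x := x) (y := -y) (fun t => by
          rw [hx t, smul_neg, innExp_neg, map_inv, hy t, inv_one]) t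
        rwa [sub_neg_eq_add] at this
      zero_mem' := fun t => by rw [smul_zero, innExp_zero, map_one]
      smul_mem' := fun c x hx t => by rw [smul_smul]; exact hx _ }
  { K with
    lie_mem := fun {z x} hx => by
      change ⁅z, x⁆ ∈ K
      have hx' : x ∈ K := hx
      have hinv : ∀ s : ℝ, endExp (s • LieAlgebra.ad ℝ 𝔤 z) x ∈ K := fun s t => by
        have e : t • endExp (s • LieAlgebra.ad ℝ 𝔤 z) x =
            (innExp (s • z) : 𝔤 ≃ₗ[ℝ] 𝔤) (t • x) := by
          rw [map_smul, coe_innExp, expAd_apply, map_smul]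
        rw [e, ← inn_conj_innExp, map_mul, map_mul, hx' t, mul_one, ← map_mul, mul_inv_cancel,
          map_one]
      -- differentiate `e^{s ad z} x ∈ K` at `s = 0`, tested against functionals vanishing on `K`
      rw [← Subspace.dualAnnihilator_dualCoannihilator_eq (W := K),
        Submodule.mem_dualCoannihilator]
      intro φ hφ
      rw [Submodule.mem_dualAnnihilator] at hφ
      have h1 := hasDerivAt_endExp_smul (LieAlgebra.ad ℝ 𝔤 z) φ x
      simp only [hφ _ (hinv _)] at h1
      exact h1.unique (hasDerivAt_const _ _) }

theorem mem_kernelIdeal [Nontrivial 𝔤] (hπ : ∀ v, Continuous fun a => π a v) {x : 𝔤} :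
    x ∈ kernelIdeal hπ ↔ ∀ t : ℝ, π (innExp (t • x)) = 1 := Iff.rfl

/-- A non-trivial continuous unitary representation of `Inn(𝔤)`, for simple `𝔤`, distinguishes
one-parameter subgroups. -/
theorem eq_of_map_innExp_eq [LieAlgebra.IsSimple ℝ 𝔤] (hπ : ∀ v, Continuous fun a => π a v)
    (hne : ∃ a, π a ≠ 1) {x y : 𝔤} (h : ∀ t : ℝ, π (innExp (t • x)) = π (innExp (t • y))) :
    x = y := by
  have : Nontrivial 𝔤 := by
    by_contra hn
    have := not_nontrivial_iff_subsingleton.1 hn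
    exact LieAlgebra.IsSimple.non_abelian (R := ℝ) (L := 𝔤) ⟨fun _ _ => Subsingleton.elim _ _⟩
  have hm : x - y ∈ kernelIdeal hπ := (mem_kernelIdeal hπ).2 (innExp_sub_mem_ker hπ h)
  rcases LieAlgebra.IsSimple.eq_bot_or_eq_top (kernelIdeal hπ) with hI | hI
  · rw [hI, LieSubmodule.mem_bot] at hm
    exact sub_eq_zero.1 hm
  · exfalso
    obtain ⟨⟨a, ha⟩, hne⟩ := hne
    refine hne ?_
    clear hne
    induction ha using Subgroup.closure_induction with
    | mem a h =>
      obtain ⟨z, rfl⟩ := h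
      have hz : z ∈ kernelIdeal hπ := by rw [hI]; exact LieSubmodule.mem_top z
      have := (mem_kernelIdeal hπ).1 hz 1
      rwa [one_smul] at this
    | one => exact map_one π
    | mul a b ha hb iha ihb =>
      have : (⟨a * b, mul_mem ha hb⟩ : Inn 𝔤) = ⟨a, ha⟩ * ⟨b, hb⟩ := rfl
      rw [this, map_mul, iha, ihb, one_mul]
    | inv a ha ih =>
      have : (⟨a⁻¹, inv_mem ha⟩ : Inn 𝔤) = ⟨a, ha⟩⁻¹ := rfl
      rw [this, map_inv, ih, inv_one]

end InnerAutomorphisms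

/-! ### Operator identities for `sl₂`-modules with an Euler grading -/

/-- Operators `e, f, k` satisfying the relations of `sl₂(ℝ)` and an operator `z` commuting with them
such that `d = z - k/2` satisfies `d³ = d`. This forces the `sl₂`-module to be a sum of copies of the
simple modules of dimension at most three. -/
structure EulerTriple {R : Type*} [Ring R] (e f k z : R) : Prop where
  ek : e * k = k * e - 2 * e
  fk : f * k = k * f + 2 * f
  ef : e * f = f * e + k
  ez : e * z = z * e
  fz : f * z = z * f
  kz : k * z = z * k
  cube : (2 * z - k) * (2 * z - k) * (2 * z - k) = 4 * (2 * z - k)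

namespace EulerTriple

variable {R : Type*} [Ring R] [Algebra ℝ R] {e f k z : R}

theorem eq_zero_of_nat_mul {x : R} (n : ℕ) [NeZero n] (h : (n : R) * x = 0) : x = 0 := by
  have h1 : (n : ℝ) • x = 0 := by
    rw [Algebra.smul_def, map_natCast]
    exact h
  exact (smul_eq_zero_iff_right (Nat.cast_ne_zero.2 (NeZero.ne n))).1 h1

omit [Algebra ℝ R] in
/-- The symmetry `e ↔ f`, `k ↦ -k`, `z ↦ -z`. -/
theorem symm (t : EulerTriple e f k z) : EulerTriple f e (-k) (-z) where
  ek := by linear_combination (norm := noncomm_ring) -t.fk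
  fk := by linear_combination (norm := noncomm_ring) -t.ek
  ef := by linear_combination (norm := noncomm_ring) -t.ef
  ez := by linear_combination (norm := noncomm_ring) -t.fz
  fz := by linear_combination (norm := noncomm_ring) -t.ez
  kz := by linear_combination (norm := noncomm_ring) t.kz
  cube := by linear_combination (norm := noncomm_ring) -t.cube

/-- The image of `e²` is contained in the eigenspace of `d = z - k/2` for `-1`, since `e` lowers the
eigenvalues of `d` by `1` and these are `-1`, `0` and `1`. -/
theorem grade_sq (t : EulerTriple e f k z) : (2 * z - k + 2) * (e * e) = 0 := by
  have eD : e * (2 * z - k) = (2 * z - k) * e + 2 * e := by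
    linear_combination (norm := noncomm_ring) 2 * t.ez - t.ek
  have D3 := t.cube
  generalize 2 * z - k = D at eD D3 ⊢
  have s1 : (D * D + 2 * D) * e = 0 := by
    refine eq_zero_of_nat_mul 6 ?_
    rw [Nat.cast_ofNat]
    linear_combination (norm := noncomm_ring) e * D3 - D3 * e + 4 * eD
      - (eD * D * D + (D + 2) * eD * D + (D + 2) * (D + 2) * eD)
  refine eq_zero_of_nat_mul 4 ?_
  rw [Nat.cast_ofNat]
  linear_combination (norm := noncomm_ring) e * s1 - (eD * D * e + (D + 2) * eD * e)
    - 2 * eD * e - s1 * e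

theorem e_cube (t : EulerTriple e f k z) : e * e * e = 0 := by
  have eD : e * (2 * z - k) = (2 * z - k) * e + 2 * e := by
    linear_combination (norm := noncomm_ring) 2 * t.ez - t.ek
  have s2 := t.grade_sq
  generalize 2 * z - k = D at eD s2
  refine eq_zero_of_nat_mul 2 ?_
  rw [Nat.cast_ofNat]
  linear_combination (norm := noncomm_ring) e * s2 - eD * e * e - s2 * e

/-- The image of `e²` has weight `2`. -/
theorem weight_sq (t : EulerTriple e f k z) : (k - 2) * (e * e) = 0 := by
  have s3 := t.e_cube
  refine eq_zero_of_nat_mul 3 ?_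
  rw [Nat.cast_ofNat]
  linear_combination (norm := noncomm_ring) s3 * f - f * s3
    - (e * e * t.ef + e * t.ef * e + t.ef * e * e) - 2 * t.ek * e - e * t.ek

theorem z_sq (t : EulerTriple e f k z) : z * (e * e) = 0 := by
  refine eq_zero_of_nat_mul 2 ?_
  rw [Nat.cast_ofNat]
  linear_combination (norm := noncomm_ring) t.grade_sq + t.weight_sq

theorem sq_mul_f (t : EulerTriple e f k z) : e * e * f = (k * k - k) * e := by
  rw [← sub_eq_zero]
  refine eq_zero_of_nat_mul 2 ?_
  rw [Nat.cast_ofNat]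
  linear_combination (norm := noncomm_ring) f * t.weight_sq - t.fk * e * e
    + k * (e * t.ef + t.ef * e + t.ek) - t.weight_sq * f

theorem f_mul_sq (t : EulerTriple e f k z) : f * (e * e) = (k * k - 3 * k + 2) * e := by
  linear_combination (norm := noncomm_ring) t.sq_mul_f - (e * t.ef + t.ef * e + t.ek)

/-- The image of `e` has weights `0`, `1` and `2`. -/
theorem weights (t : EulerTriple e f k z) : (k * k * k - 3 * k * k + 2 * k) * e = 0 := by
  linear_combination (norm := noncomm_ring) f * t.weight_sq - t.fk * e * e - k * t.f_mul_sq

theorem z_weight (t : EulerTriple e f k z) : z * (k - 1) * e = 0 := by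
  refine eq_zero_of_nat_mul 2 ?_
  rw [Nat.cast_ofNat]
  linear_combination (norm := noncomm_ring) t.z_sq * f - z * t.sq_mul_f
    - (f * t.z_sq - t.fz * e * e - z * t.f_mul_sq)

theorem e_f_e (t : EulerTriple e f k z) : e * f * e = (k * k - 2 * k + 2) * e := by
  linear_combination (norm := noncomm_ring) t.sq_mul_f - e * t.ef - t.ek

theorem sq_sq_sq (t : EulerTriple e f k z) : e * e * (f * f) * (e * e) = 4 * (e * e) := by
  have h1 : e * ((k * k - 3 * k + 2) * e) = (k * k - 7 * k + 12) * (e * e) := by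
    linear_combination (norm := noncomm_ring) t.ek * k * e + (k - 2) * t.ek * e - 3 * t.ek * e
  linear_combination (norm := noncomm_ring) t.sq_mul_f * f * e * e + (k * k - k) * e * t.f_mul_sq
    + (k * k - k) * h1 + (k * k * k - 6 * k * k + 7 * k + 2) * t.weight_sq

theorem sq_sq_e (t : EulerTriple e f k z) : e * e * (f * f) * e = 2 * (e * e * f) := by
  linear_combination (norm := noncomm_ring) t.sq_mul_f * f * e + (k * k - k) * t.e_f_e
    - 2 * t.sq_mul_f + k * t.weights

theorem z_e_f_e (t : EulerTriple e f k z) : z * (e * f * e) = z * e := by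
  linear_combination (norm := noncomm_ring) z * t.e_f_e + (k - 1) * t.z_weight
    - t.kz * (k - 1) * e

/-- The multiple of the Casimir operator that acts on the simple module of dimension `n` by
`n² - 1`. -/
def casimir (e f k : R) : R := 4 * (f * e) + 2 * k + k * k

omit [Algebra ℝ R] in
theorem casimir_symm (t : EulerTriple e f k z) : casimir f e (-k) = casimir e f k := by
  unfold casimir
  linear_combination (norm := noncomm_ring) 4 * t.ef

/-- The polynomial in the Casimir operator that vanishes on the non-trivial simple submodules. -/
theorem casimir_mul_e (t : EulerTriple e f k z) :
    (casimir e f k - 3) * (casimir e f k - 8) * e = 0 := by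
  have h1 : casimir e f k * e = (5 * k * k - 10 * k + 8) * e := by
    unfold casimir
    linear_combination (norm := noncomm_ring) 4 * t.f_mul_sq
  have h2 : casimir e f k * k = k * casimir e f k := by
    unfold casimir
    linear_combination (norm := noncomm_ring) 4 * f * t.ek + 4 * t.fk * e
  generalize casimir e f k = c at h1 h2
  linear_combination (norm := noncomm_ring) (c - 3) * h1
    + 5 * h2 * k * e + 5 * k * h2 * e - 10 * h2 * e + (5 * k * k - 10 * k) * h1
    + 25 * (k - 1) * t.weights

/-! The operators `e²f²` and `z e f` followed by the possible powers of `e` span, under right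
multiplication by `e`, `f` and `k`, modules with the structure constants of the adjoint and of the
two-dimensional representation. -/

theorem adjoint_mul_f (t : EulerTriple e f k z) : e * e * (f * f) * f = 0 := by
  linear_combination (norm := noncomm_ring) e * e * t.symm.e_cube

theorem vector_mul_f (t : EulerTriple e f k z) : z * (e * f) * f = 0 := by
  linear_combination (norm := noncomm_ring) -e * t.symm.z_sq - t.ez * f * f

theorem vector_mul_e_e (t : EulerTriple e f k z) : z * (e * f) * e * e = 0 := by
  linear_combination (norm := noncomm_ring) e * f * t.z_sq - t.ez * f * e * e - e * t.fz * e * e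

theorem vector_mul_k (t : EulerTriple e f k z) : z * (e * f) * k = z * (e * f) := by
  linear_combination (norm := noncomm_ring) t.z_weight * f + z * e * t.fk + z * t.ek * f

theorem vector_mul_e_f (t : EulerTriple e f k z) : z * (e * f) * e * f = z * (e * f) := by
  linear_combination (norm := noncomm_ring) t.z_e_f_e * f

theorem vector_mul_e_k (t : EulerTriple e f k z) : z * (e * f) * e * k = -(z * (e * f) * e) := by
  linear_combination (norm := noncomm_ring) t.z_e_f_e * k + z * t.ek + t.z_weight + t.z_e_f_e

theorem adjoint_mul_k (t : EulerTriple e f k z) : e * e * (f * f) * k = 2 * (e * e * (f * f)) := by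
  linear_combination (norm := noncomm_ring) e * e * f * t.fk + e * e * t.fk * f
    + e * t.ek * f * f + t.ek * e * f * f + t.weight_sq * f * f

theorem adjoint_mul_e_f (t : EulerTriple e f k z) :
    e * e * (f * f) * e * f = 2 * (e * e * (f * f)) := by
  linear_combination (norm := noncomm_ring) t.sq_sq_e * f

theorem adjoint_mul_e_k (t : EulerTriple e f k z) : e * e * (f * f) * e * k = 0 := by
  linear_combination (norm := noncomm_ring) t.sq_sq_e * k + 2 * e * e * t.fk
    + 2 * e * t.ek * f + 2 * t.ek * e * f + 2 * t.weight_sq * f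

theorem adjoint_mul_e_e_e (t : EulerTriple e f k z) : e * e * (f * f) * e * e * e = 0 := by
  linear_combination (norm := noncomm_ring) e * e * (f * f) * t.e_cube

theorem adjoint_mul_e_e_f (t : EulerTriple e f k z) :
    e * e * (f * f) * e * e * f = 2 * (e * e * (f * f) * e) := by
  linear_combination (norm := noncomm_ring) t.sq_sq_sq * f - 2 * t.sq_sq_e

theorem adjoint_mul_e_e_k (t : EulerTriple e f k z) :
    e * e * (f * f) * e * e * k = -2 * (e * e * (f * f) * e * e) := by
  linear_combination (norm := noncomm_ring) t.sq_sq_sq * k + 4 * e * t.ek + 4 * t.ek * e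
    + 4 * t.weight_sq + 2 * t.sq_sq_sq

theorem casimir_mul_f (t : EulerTriple e f k z) :
    (casimir e f k - 3) * (casimir e f k - 8) * f = 0 := by
  rw [← t.casimir_symm]
  exact t.symm.casimir_mul_e

theorem casimir_mul_k (t : EulerTriple e f k z) :
    (casimir e f k - 3) * (casimir e f k - 8) * k = 0 := by
  have h1 := t.casimir_mul_e
  have h2 := t.casimir_mul_f
  generalize (casimir e f k - 3) * (casimir e f k - 8) = q at h1 h2
  linear_combination (norm := noncomm_ring) h1 * f - h2 * e - q * t.ef

variable {V : Type*} [AddCommGroup V] [Module ℝ V] {e f k z : Module.End ℝ V}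

theorem end_ofNat_apply {V : Type*} [AddCommGroup V] [Module ℝ V] (n : ℕ) [n.AtLeastTwo] (w : V) :
    (ofNat(n) : Module.End ℝ V) w = (ofNat(n) : ℝ) • w := by
  rw [Module.End.ofNat_apply]
  exact (ofNat_smul_eq_nsmul ℝ n w).symm

theorem e_apply_eq_zero (t : EulerTriple e f k z) {v : V} (h1 : e (e v) = 0) (h2 : e (e (f v)) = 0)
    (h3 : z (e v) = 0) : e v = 0 := by
  have a1 := LinearMap.congr_fun t.f_mul_sq v
  have a2 := LinearMap.congr_fun t.sq_mul_f v
  have a3 := LinearMap.congr_fun t.cube (e v)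
  simp only [Module.End.mul_apply, LinearMap.add_apply, LinearMap.sub_apply, h1, h2, h3, map_zero,
    end_ofNat_apply] at a1 a2 a3
  have hk : k (e v) = e v := by
    have : k (k (e v)) = k (e v) := (sub_eq_zero.1 a2.symm)
    rw [this] at a1
    have h4 : (2 : ℝ) • (e v - k (e v)) = 0 := by
      rw [a1]; module
    exact (sub_eq_zero.1 ((smul_eq_zero_iff_right two_ne_zero).1 h4)).symm
  simp only [hk, h3, map_sub, map_neg, map_zero, smul_zero, zero_sub, smul_neg] at a3
  have h5 : (3 : ℝ) • e v = 0 := by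
    linear_combination (norm := module) (1 : ℝ) • a3
  exact (smul_eq_zero_iff_right three_ne_zero).1 h5

/-- The coefficients separating vectors. Up to scalars, `e²f²` projects to the highest weight vectors
of the three-dimensional simple submodules and `z e f` to those of the two-dimensional ones; the
polynomial in the Casimir operator projects to the trivial submodules. -/
theorem eq_zero_of_coefficients (t : EulerTriple e f k z) {v : V}
    (h1 : (z * (e * f)) v = 0) (h2 : (z * (e * f)) (e v) = 0)
    (h3 : (e * e * (f * f)) v = 0) (h4 : (e * e * (f * f)) (e v) = 0)
    (h5 : (e * e * (f * f)) (e (e v)) = 0)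
    (h6 : ((casimir e f k - 3) * (casimir e f k - 8)) v = 0) : v = 0 := by
  have e2 : e (e v) = 0 := by
    have := LinearMap.congr_fun t.sq_sq_sq v
    simp only [Module.End.mul_apply, end_ofNat_apply] at this h5
    rw [h5] at this
    exact (smul_eq_zero_iff_right four_ne_zero).1 this.symm
  have f2 : f (f v) = 0 := by
    have := LinearMap.congr_fun t.symm.sq_sq_sq v
    simp only [Module.End.mul_apply, end_ofNat_apply] at this h3
    rw [h3, map_zero, map_zero] at this
    exact (smul_eq_zero_iff_right four_ne_zero).1 this.symm
  have eef : e (e (f v)) = 0 := by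
    have := LinearMap.congr_fun t.sq_sq_e v
    simp only [Module.End.mul_apply, end_ofNat_apply] at this h4
    rw [h4] at this
    exact (smul_eq_zero_iff_right two_ne_zero).1 this.symm
  have ffe : f (f (e v)) = 0 := by
    have := LinearMap.congr_fun t.symm.sq_sq_e v
    simp only [Module.End.mul_apply, end_ofNat_apply] at this
    rw [eef, map_zero, map_zero] at this
    exact (smul_eq_zero_iff_right two_ne_zero).1 this.symm
  have ze : z (e v) = 0 := by
    have := LinearMap.congr_fun t.z_e_f_e v
    exact this.symm.trans h2
  have zf : (-z) (f v) = 0 := by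
    have h7 := LinearMap.congr_fun t.symm.z_e_f_e v
    have h8 := LinearMap.congr_fun t.fz (e (f v))
    simp only [Module.End.mul_apply, LinearMap.neg_apply] at h1 h7 h8 ⊢
    rw [← h7, ← h8, h1, map_zero, neg_zero]
  have he := t.e_apply_eq_zero e2 eef ze
  have hf := t.symm.e_apply_eq_zero f2 ffe zf
  have hk : k v = 0 := by
    have := LinearMap.congr_fun t.ef v
    simpa [he, hf] using this.symm
  have hc : casimir e f k v = 0 := by
    simp [casimir, he, hk]
  simp only [Module.End.mul_apply, LinearMap.sub_apply, hc, end_ofNat_apply, zero_sub, map_neg,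
    map_smul, smul_neg, neg_neg, smul_smul] at h6
  exact (smul_eq_zero_iff_right (by norm_num)).1 h6

end EulerTriple

/-! ### The group `SL(2,ℝ)` and its exponentials -/

section SLTwo

open LieAlgebra.SpecialLinear

theorem slExp_coe (X : sl (Fin 2) ℝ) :
    (slExp X : Matrix (Fin 2) (Fin 2) ℝ) = NormedSpace.exp (X : Matrix (Fin 2) (Fin 2) ℝ) := rfl

theorem slExp_inv_coe (X : sl (Fin 2) ℝ) :
    ((slExp X)⁻¹ : SL(2, ℝ)).1 = NormedSpace.exp (-(X : Matrix (Fin 2) (Fin 2) ℝ)) := by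
  rw [Matrix.exp_neg]
  exact (Matrix.inv_eq_left_inv (DeSitter.coe_inv_mul (slExp X))).symm

open scoped Matrix.Norms.Operator in
theorem exp_of_mul_self_eq_zero {N : Matrix (Fin 2) (Fin 2) ℝ} (h : N * N = 0) :
    NormedSpace.exp N = 1 + N := by
  have h1 : HasSum (fun n : ℕ => (n.factorial : ℝ)⁻¹ • N ^ n) (NormedSpace.exp N) :=
    NormedSpace.exp_series_hasSum_exp' (𝕂 := ℝ) N
  refine h1.unique ?_
  have h2 := hasSum_sum_of_ne_finset_zero (L := .unconditional ℕ) (f := fun n : ℕ => (n.factorial : ℝ)⁻¹ • N ^ n)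
    (s := Finset.range 2) (fun n hn => by
      obtain ⟨m, rfl⟩ := Nat.exists_eq_add_of_le (not_lt.1 (Finset.mem_range.not.1 hn))
      rw [pow_add, pow_two, h, zero_mul, smul_zero])
  simpa [Finset.sum_range_succ] using h2

/-- `SL(2,ℝ)` is generated by transvections, hence by exponentials of nilpotent matrices. -/
theorem slExp_induction {p : SL(2, ℝ) → Prop} (hexp : ∀ X, p (slExp X))
    (mul : ∀ g k, p g → p k → p (g * k)) (g : SL(2, ℝ)) : p g := by
  refine Matrix.SL2.transvection_induction p ?_ mul g
  intro i j hij c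
  have e : slExp (single i j hij c) = Matrix.SpecialLinearGroup.transvection hij c := by
    apply Subtype.ext
    rw [slExp_coe, val_single]
    exact exp_of_mul_self_eq_zero (Matrix.single_mul_single_of_ne _ _ _ _ hij.symm _)
  rw [← e]
  exact hexp _

end SLTwo

section

attribute [local instance 100] LieRing.ofAssociativeRing LieAlgebra.ofAssociativeAlgebra

variable {m : Type*} [Fintype m] [DecidableEq m]

theorem endExp_matrix_mulLeft (X B : Matrix m m ℝ) :
    endExp (LinearMap.mulLeft ℝ X) B = NormedSpace.exp X * B := by
  ext i j
  have h := endExp_mulVec (A := LinearMap.mulLeft ℝ X) (B := X)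
    { toFun := fun B i => B i j, map_add' := fun _ _ => rfl, map_smul' := fun _ _ => rfl }
    (fun _ => rfl) B
  exact congrFun h i

theorem endExp_matrix_mulRight (X B : Matrix m m ℝ) :
    endExp (LinearMap.mulRight ℝ X) B = B * NormedSpace.exp X := by
  ext i j
  have h := endExp_mulVec (A := LinearMap.mulRight ℝ X) (B := X.transpose)
    { toFun := fun B j => B i j, map_add' := fun _ _ => rfl, map_smul' := fun _ _ => rfl }
    (fun B => (Matrix.mulVec_transpose X (B i)).symm) B
  rw [Matrix.exp_transpose, Matrix.mulVec_transpose] at h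
  exact congrFun h j

/-- The adjoint action of a matrix algebra: `e^{[X, ·]} B = e^X B e^{-X}`. -/
theorem endExp_matrix_commutator (X B : Matrix m m ℝ) :
    endExp (LinearMap.mulLeft ℝ X - LinearMap.mulRight ℝ X) B =
      NormedSpace.exp X * B * NormedSpace.exp (-X) := by
  have hr : -LinearMap.mulRight ℝ X = LinearMap.mulRight ℝ (-X) := by
    ext C : 1
    simp
  have hc : Commute (LinearMap.mulLeft ℝ X) (LinearMap.mulRight ℝ (-X)) := by
    ext C : 1
    simp [mul_assoc]
  rw [sub_eq_add_neg, hr, endExp_add_of_commute hc, Module.End.mul_apply,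
    endExp_matrix_mulRight, endExp_matrix_mulLeft, mul_assoc]

/-- A linear map into matrices intertwining `A` with `[X, ·]` intertwines `e^A` with the conjugation
by `e^X`. -/
theorem endExp_commutator_intertwine {V : Type*} [LieRing V] [LieAlgebra ℝ V]
    [FiniteDimensional ℝ V] {A : Module.End ℝ V} {X : Matrix m m ℝ} (L : V →ₗ[ℝ] Matrix m m ℝ)
    (h : ∀ x, L (A x) = X * L x - L x * X) (x : V) :
    L (endExp A x) = NormedSpace.exp X * L x * NormedSpace.exp (-X) := by
  rw [← endExp_matrix_commutator]
  exact endExp_intertwine (B := LinearMap.mulLeft ℝ X - LinearMap.mulRight ℝ X) L h x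

end

/-! ### Integration of an `sl₂`-subalgebra to a homomorphism of `SL(2,ℝ)` -/

section Integration

open LieAlgebra.SpecialLinear

/-- The neutral element `H = (0 1; 1 0) = 2 σ₁` of an `sl₂`-triple of `sl(2,ℝ)`. -/
def slH : sl (Fin 2) ℝ := ⟨!![0, 1; 1, 0], by
  change Matrix.trace (!![0, 1; 1, 0] : Matrix (Fin 2) (Fin 2) ℝ) = 0
  simp [Matrix.trace_fin_two]⟩

/-- The raising element for `slH`. -/
def slE : sl (Fin 2) ℝ := ⟨!![1 / 2, -1 / 2; 1 / 2, -1 / 2], by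
  change Matrix.trace (!![1 / 2, -1 / 2; 1 / 2, -1 / 2] : Matrix (Fin 2) (Fin 2) ℝ) = 0
  simp [Matrix.trace_fin_two]; norm_num⟩

/-- The lowering element for `slH`. -/
def slF : sl (Fin 2) ℝ := ⟨!![1 / 2, 1 / 2; -1 / 2, -1 / 2], by
  change Matrix.trace (!![1 / 2, 1 / 2; -1 / 2, -1 / 2] : Matrix (Fin 2) (Fin 2) ℝ) = 0
  simp [Matrix.trace_fin_two]; norm_num⟩

theorem lie_slH_slE : ⁅slH, slE⁆ = (2 : ℝ) • slE := by
  apply Subtype.ext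
  rw [sl_bracket]
  change _ = (2 : ℝ) • slE.1
  ext i j
  fin_cases i <;> fin_cases j <;> simp [slH, slE] <;> norm_num

theorem lie_slH_slF : ⁅slH, slF⁆ = (-2 : ℝ) • slF := by
  apply Subtype.ext
  rw [sl_bracket]
  change _ = (-2 : ℝ) • slF.1
  ext i j
  fin_cases i <;> fin_cases j <;> simp [slH, slF] <;> norm_num

theorem lie_slE_slF : ⁅slE, slF⁆ = slH := by
  apply Subtype.ext
  rw [sl_bracket]
  ext i j
  fin_cases i <;> fin_cases j <;> simp [slH, slE, slF] <;> norm_num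

theorem two_smul_sigmaOne : (2 : ℝ) • sigmaOne = slH := by
  apply Subtype.ext
  change (2 : ℝ) • sigmaOne.1 = slH.1
  ext i j
  fin_cases i <;> fin_cases j <;> simp [slH, sigmaOne]

section

variable {V : Type*} [AddCommGroup V] [Module ℝ V]

/-- The coefficient map of `V` to the two-dimensional simple module attached to a functional. -/
def vectorCoeff (e f z : Module.End ℝ V) (φ : Module.Dual ℝ V) : V →ₗ[ℝ] Fin 2 → ℝ :=
  (φ ∘ₗ (z * (e * f))).smulRight ![1, 1] + (φ ∘ₗ (z * (e * f) * e)).smulRight ![1, -1]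

/-- The coefficient map of `V` to the adjoint module `sl(2,ℝ)` attached to a functional. -/
def adjointCoeff (e f : Module.End ℝ V) (φ : Module.Dual ℝ V) :
    V →ₗ[ℝ] Matrix (Fin 2) (Fin 2) ℝ :=
  (φ ∘ₗ (e * e * (f * f))).smulRight slE.1 - (φ ∘ₗ (e * e * (f * f) * e)).smulRight sigmaOne.1 -
    (φ ∘ₗ (e * e * (f * f) * e * e)).smulRight ((1 / 2 : ℝ) • slF.1)

/-- The operator of `X ∈ sl(2,ℝ)` in the representation given by the images of the basis. -/
def slOp (e f k : Module.End ℝ V) (X : sl (Fin 2) ℝ) : Module.End ℝ V :=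
  ((X.1 0 1 + X.1 1 0) / 2) • k + (X.1 0 0 + (X.1 1 0 - X.1 0 1) / 2) • e +
    (X.1 0 0 - (X.1 1 0 - X.1 0 1) / 2) • f

variable {e f k z : Module.End ℝ V}

namespace EulerTriple

theorem vectorCoeff_e (t : EulerTriple e f k z) (φ : Module.Dual ℝ V) (v : V) :
    vectorCoeff e f z φ (e v) = slE.1.mulVec (vectorCoeff e f z φ v) := by
  have h2 := LinearMap.congr_fun t.vector_mul_e_e v
  simp only [Module.End.mul_apply, LinearMap.zero_apply] at h2
  ext i
  fin_cases i <;> simp [vectorCoeff, slE, h2, Matrix.mulVec, dotProduct] <;> ring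

theorem vectorCoeff_f (t : EulerTriple e f k z) (φ : Module.Dual ℝ V) (v : V) :
    vectorCoeff e f z φ (f v) = slF.1.mulVec (vectorCoeff e f z φ v) := by
  have h1 := LinearMap.congr_fun t.vector_mul_f v
  have h2 := LinearMap.congr_fun t.vector_mul_e_f v
  simp only [Module.End.mul_apply, LinearMap.zero_apply] at h1 h2
  ext i
  fin_cases i <;> simp [vectorCoeff, slF, h1, h2, Matrix.mulVec, dotProduct] <;> ring

theorem vectorCoeff_k (t : EulerTriple e f k z) (φ : Module.Dual ℝ V) (v : V) :
    vectorCoeff e f z φ (k v) = slH.1.mulVec (vectorCoeff e f z φ v) := by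
  have h1 := LinearMap.congr_fun t.vector_mul_k v
  have h2 := LinearMap.congr_fun t.vector_mul_e_k v
  simp only [Module.End.mul_apply, LinearMap.neg_apply] at h1 h2
  ext i
  fin_cases i <;> simp [vectorCoeff, slH, h1, h2, Matrix.mulVec, dotProduct]

theorem adjointCoeff_e (t : EulerTriple e f k z) (φ : Module.Dual ℝ V) (v : V) :
    adjointCoeff e f φ (e v) =
      slE.1 * adjointCoeff e f φ v - adjointCoeff e f φ v * slE.1 := by
  have h1 := LinearMap.congr_fun t.adjoint_mul_e_e_e v
  simp only [Module.End.mul_apply, LinearMap.zero_apply] at h1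
  ext i j
  fin_cases i <;> fin_cases j <;>
    simp [adjointCoeff, slE, slF, sigmaOne, h1] <;> ring

theorem adjointCoeff_f (t : EulerTriple e f k z) (φ : Module.Dual ℝ V) (v : V) :
    adjointCoeff e f φ (f v) =
      slF.1 * adjointCoeff e f φ v - adjointCoeff e f φ v * slF.1 := by
  have h1 := LinearMap.congr_fun t.adjoint_mul_f v
  have h2 := LinearMap.congr_fun t.adjoint_mul_e_f v
  have h3 := LinearMap.congr_fun t.adjoint_mul_e_e_f v
  simp only [Module.End.mul_apply, LinearMap.zero_apply, end_ofNat_apply] at h1 h2 h3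
  ext i j
  fin_cases i <;> fin_cases j <;>
    simp [adjointCoeff, slE, slF, sigmaOne, h1, h2, h3] <;> ring

theorem adjointCoeff_k (t : EulerTriple e f k z) (φ : Module.Dual ℝ V) (v : V) :
    adjointCoeff e f φ (k v) =
      slH.1 * adjointCoeff e f φ v - adjointCoeff e f φ v * slH.1 := by
  have h1 := LinearMap.congr_fun t.adjoint_mul_k v
  have h2 := LinearMap.congr_fun t.adjoint_mul_e_k v
  have h3 := LinearMap.congr_fun t.adjoint_mul_e_e_k v
  simp only [Module.End.mul_apply, LinearMap.zero_apply, end_ofNat_apply, neg_mul,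
    LinearMap.neg_apply] at h1 h2 h3
  ext i j
  fin_cases i <;> fin_cases j <;>
    simp [adjointCoeff, slE, slF, slH, sigmaOne, h1, h2, h3] <;> ring

/-- The coordinates with respect to `slH`, `slE` and `slF`. -/
theorem sl_eq (X : sl (Fin 2) ℝ) :
    X.1 = ((X.1 0 1 + X.1 1 0) / 2) • slH.1 + (X.1 0 0 + (X.1 1 0 - X.1 0 1) / 2) • slE.1 +
      (X.1 0 0 - (X.1 1 0 - X.1 0 1) / 2) • slF.1 := by
  have hX : X.1 0 0 + X.1 1 1 = 0 := (Matrix.trace_fin_two X.1).symm.trans X.2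
  ext i j
  fin_cases i <;> fin_cases j <;> simp [slH, slE, slF] <;> linarith

theorem vectorCoeff_slOp (t : EulerTriple e f k z) (φ : Module.Dual ℝ V) (X : sl (Fin 2) ℝ)
    (v : V) : vectorCoeff e f z φ (slOp e f k X v) = X.1.mulVec (vectorCoeff e f z φ v) := by
  conv_rhs => rw [sl_eq X]
  simp only [slOp, LinearMap.add_apply, LinearMap.smul_apply, map_add, map_smul, t.vectorCoeff_e,
    t.vectorCoeff_f, t.vectorCoeff_k, Matrix.add_mulVec, Matrix.smul_mulVec]

theorem adjointCoeff_slOp (t : EulerTriple e f k z) (φ : Module.Dual ℝ V) (X : sl (Fin 2) ℝ)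
    (v : V) : adjointCoeff e f φ (slOp e f k X v) =
      X.1 * adjointCoeff e f φ v - adjointCoeff e f φ v * X.1 := by
  conv_rhs => rw [sl_eq X]
  simp only [slOp, LinearMap.add_apply, LinearMap.smul_apply, map_add, map_smul, t.adjointCoeff_e,
    t.adjointCoeff_f, t.adjointCoeff_k, add_mul, mul_add, smul_mul_assoc, mul_smul_comm, smul_sub]
  abel

theorem casimir_slOp (t : EulerTriple e f k z) (X : sl (Fin 2) ℝ) :
    (casimir e f k - 3) * (casimir e f k - 8) * slOp e f k X = 0 := by
  simp only [slOp, mul_add, mul_smul_comm, t.casimir_mul_e, t.casimir_mul_f, t.casimir_mul_k,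
    smul_zero, add_zero]

/-- The coefficient maps to the simple modules of dimension at most three jointly separate points. -/
theorem eq_zero_of_coeff_eq_zero (t : EulerTriple e f k z) {v : V}
    (h0 : ((casimir e f k - 3) * (casimir e f k - 8)) v = 0)
    (h1 : ∀ φ, vectorCoeff e f z φ v = 0) (h2 : ∀ φ, adjointCoeff e f φ v = 0) : v = 0 := by
  have k1 : ∀ φ : Module.Dual ℝ V, φ ((z * (e * f)) v) = 0 ∧ φ ((z * (e * f)) (e v)) = 0 := by
    intro φ
    have a := congrFun (h1 φ) 0
    have b := congrFun (h1 φ) 1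
    simp [vectorCoeff] at a b
    simp only [Module.End.mul_apply]
    constructor <;> linarith
  have k2 : ∀ φ : Module.Dual ℝ V, φ ((e * e * (f * f)) v) = 0 ∧
      φ ((e * e * (f * f)) (e v)) = 0 ∧ φ ((e * e * (f * f)) (e (e v))) = 0 := by
    intro φ
    have a := congrFun (congrFun (h2 φ) 0) 0
    have b := congrFun (congrFun (h2 φ) 0) 1
    have c := congrFun (congrFun (h2 φ) 1) 0
    simp [adjointCoeff, slE, slF, sigmaOne] at a b c
    simp only [Module.End.mul_apply]
    refine ⟨?_, ?_, ?_⟩ <;> linarith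
  have sep := fun x : V => (Module.forall_dual_apply_eq_zero_iff ℝ x).1
  exact t.eq_zero_of_coefficients (sep _ fun φ => (k1 φ).1) (sep _ fun φ => (k1 φ).2)
    (sep _ fun φ => (k2 φ).1) (sep _ fun φ => (k2 φ).2.1) (sep _ fun φ => (k2 φ).2.2) h0

end EulerTriple

/-- The linear map `a` corresponds to `g ∈ SL(2,ℝ)` under all coefficient maps to the trivial, the
two-dimensional and the adjoint representation. Since these separate points, `g` determines `a`. -/
structure IsCompatible (e f k z : Module.End ℝ V) (g : SL(2, ℝ)) (a : V ≃ₗ[ℝ] V) : Prop where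
  trivial : ∀ v, ((EulerTriple.casimir e f k - 3) * (EulerTriple.casimir e f k - 8)) (a v) =
    ((EulerTriple.casimir e f k - 3) * (EulerTriple.casimir e f k - 8)) v
  vector : ∀ φ v, vectorCoeff e f z φ (a v) = g.1.mulVec (vectorCoeff e f z φ v)
  adjoint : ∀ φ v, adjointCoeff e f φ (a v) = g.1 * adjointCoeff e f φ v * (g⁻¹ : SL(2, ℝ)).1

namespace IsCompatible

theorem mul {g k' : SL(2, ℝ)} {a b : V ≃ₗ[ℝ] V} (ha : IsCompatible e f k z g a)
    (hb : IsCompatible e f k z k' b) : IsCompatible e f k z (g * k') (a * b) where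
  trivial v := (ha.trivial (b v)).trans (hb.trivial v)
  vector φ v := by
    rw [LinearEquiv.mul_apply, ha.vector, hb.vector, Matrix.mulVec_mulVec]
    rfl
  adjoint φ v := by
    rw [LinearEquiv.mul_apply, ha.adjoint, hb.adjoint, mul_inv_rev]
    change _ = g.1 * k'.1 * _ * (k'⁻¹.1 * g⁻¹.1)
    simp only [Matrix.mul_assoc]

theorem unique (t : EulerTriple e f k z) {g : SL(2, ℝ)} {a b : V ≃ₗ[ℝ] V}
    (ha : IsCompatible e f k z g a) (hb : IsCompatible e f k z g b) : a = b := by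
  ext v
  rw [← sub_eq_zero]
  apply t.eq_zero_of_coeff_eq_zero
  · rw [map_sub, ha.trivial, hb.trivial, sub_self]
  · intro φ
    rw [map_sub, ha.vector, hb.vector, sub_self]
  · intro φ
    rw [map_sub, ha.adjoint, hb.adjoint, sub_self]

end IsCompatible

end

end Integration

section IntegrationToInn

open LieAlgebra.SpecialLinear

variable {𝔤 : Type*} [LieRing 𝔤] [LieAlgebra ℝ 𝔤] [FiniteDimensional ℝ 𝔤]

section

attribute [local instance 100] LieRing.ofAssociativeRing LieAlgebra.ofAssociativeAlgebra

omit [FiniteDimensional ℝ 𝔤] in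
theorem ad_mul_ad (x y : 𝔤) : LieAlgebra.ad ℝ 𝔤 x * LieAlgebra.ad ℝ 𝔤 y =
    LieAlgebra.ad ℝ 𝔤 y * LieAlgebra.ad ℝ 𝔤 x + LieAlgebra.ad ℝ 𝔤 ⁅x, y⁆ := by
  rw [LieHom.map_lie, LieRing.of_associative_ring_bracket, add_sub_cancel]

end

omit [FiniteDimensional ℝ 𝔤] in
/-- The relation `(ad h)³ = ad h` for `h = c - Ψ(σ₁)` provides an `EulerTriple`. -/
theorem eulerTriple_ad (Ψ : sl (Fin 2) ℝ →ₗ⁅ℝ⁆ 𝔤) {c : 𝔤} (hc : ∀ X, ⁅c, Ψ X⁆ = 0)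
    (hcube : ∀ y : 𝔤, ⁅c - Ψ sigmaOne, ⁅c - Ψ sigmaOne, ⁅c - Ψ sigmaOne, y⁆⁆⁆ =
      ⁅c - Ψ sigmaOne, y⁆) :
    EulerTriple (LieAlgebra.ad ℝ 𝔤 (Ψ slE)) (LieAlgebra.ad ℝ 𝔤 (Ψ slF))
      (LieAlgebra.ad ℝ 𝔤 (Ψ slH)) (LieAlgebra.ad ℝ 𝔤 c) := by
  have two : ∀ A : Module.End ℝ 𝔤, 2 * A = (2 : ℝ) • A := fun A => by
    rw [two_mul, two_smul]
  have comm : ∀ X, LieAlgebra.ad ℝ 𝔤 (Ψ X) * LieAlgebra.ad ℝ 𝔤 c =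
      LieAlgebra.ad ℝ 𝔤 c * LieAlgebra.ad ℝ 𝔤 (Ψ X) := fun X => by
    rw [ad_mul_ad c, hc, map_zero, add_zero]
  refine ⟨?_, ?_, ?_, comm _, comm _, comm _, ?_⟩
  · rw [ad_mul_ad (Ψ slH), ← LieHom.map_lie, lie_slH_slE, two, map_smul, map_smul]
    abel
  · rw [ad_mul_ad (Ψ slH), ← LieHom.map_lie, lie_slH_slF, two, map_smul, map_smul]
    module
  · rw [ad_mul_ad (Ψ slE), ← LieHom.map_lie, lie_slE_slF]
  · have hd : 2 * LieAlgebra.ad ℝ 𝔤 c - LieAlgebra.ad ℝ 𝔤 (Ψ slH) =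
        (2 : ℝ) • LieAlgebra.ad ℝ 𝔤 (c - Ψ sigmaOne) := by
      rw [two, ← two_smul_sigmaOne, map_smul, map_smul, map_sub, smul_sub]
    rw [hd]
    ext y
    simp only [Module.End.mul_apply, LinearMap.smul_apply, LieAlgebra.ad_apply, lie_smul,
      EulerTriple.end_ofNat_apply, hcube]
    module

theorem isCompatible_slExp {e f k z : Module.End ℝ 𝔤} (t : EulerTriple e f k z)
    (X : sl (Fin 2) ℝ) {a : 𝔤 ≃ₗ[ℝ] 𝔤} (ha : ∀ v, a v = endExp (slOp e f k X) v) :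
    IsCompatible e f k z (slExp X) a where
  trivial v := by
    have h0 := t.casimir_slOp X
    generalize (EulerTriple.casimir e f k - 3) * (EulerTriple.casimir e f k - 8) = q at h0 ⊢
    have h := endExp_intertwine (A := slOp e f k X) (B := (0 : Module.End ℝ 𝔤)) q
        (fun x => LinearMap.congr_fun h0 x) v
    rw [endExp_zero] at h
    rw [ha, h, Module.End.one_apply]
  vector φ v := by
    rw [ha, endExp_mulVec _ (t.vectorCoeff_slOp φ X) v, slExp_coe]
  adjoint φ v := by
    rw [ha, slExp_inv_coe]
    exact endExp_commutator_intertwine _ (t.adjointCoeff_slOp φ X) v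

/-- An `sl₂`-subalgebra that is compatible with an Euler element integrates to a homomorphism of
`SL(2,ℝ)`, although that group is not simply connected: only simple modules of dimension at most
three occur, and they all carry representations of `SL(2,ℝ)`. -/
theorem exists_monoidHom_slExp (Ψ : sl (Fin 2) ℝ →ₗ⁅ℝ⁆ 𝔤) {c : 𝔤} (hc : ∀ X, ⁅c, Ψ X⁆ = 0)
    (hcube : ∀ y : 𝔤, ⁅c - Ψ sigmaOne, ⁅c - Ψ sigmaOne, ⁅c - Ψ sigmaOne, y⁆⁆⁆ =
      ⁅c - Ψ sigmaOne, y⁆) :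
    ∃ ρ : SL(2, ℝ) →* Inn 𝔤, ∀ X, ρ (slExp X) = innExp (Ψ X) := by
  have t := eulerTriple_ad Ψ hc hcube
  set e := LieAlgebra.ad ℝ 𝔤 (Ψ slE)
  set f := LieAlgebra.ad ℝ 𝔤 (Ψ slF)
  set k := LieAlgebra.ad ℝ 𝔤 (Ψ slH)
  set z := LieAlgebra.ad ℝ 𝔤 c
  have hop : ∀ X, LieAlgebra.ad ℝ 𝔤 (Ψ X) = slOp e f k X := by
    intro X
    have hX : X = ((X.1 0 1 + X.1 1 0) / 2) • slH + (X.1 0 0 + (X.1 1 0 - X.1 0 1) / 2) • slE +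
      (X.1 0 0 - (X.1 1 0 - X.1 0 1) / 2) • slF := Subtype.ext (EulerTriple.sl_eq X)
    conv_lhs => rw [hX]
    simp only [map_add, map_smul]
    rfl
  have hexp : ∀ X, IsCompatible e f k z (slExp X) (innExp (Ψ X) : 𝔤 ≃ₗ[ℝ] 𝔤) := by
    intro X
    refine isCompatible_slExp t X fun v => ?_
    rw [coe_innExp, expAd_apply, hop]
  have hex : ∀ g : SL(2, ℝ), ∃ a : Inn 𝔤, IsCompatible e f k z g (a : 𝔤 ≃ₗ[ℝ] 𝔤) :=
    slExp_induction (fun X => ⟨_, hexp X⟩)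
      fun g g' ⟨a, ha⟩ ⟨a', ha'⟩ => ⟨a * a', ha.mul ha'⟩
  -- uniqueness of compatible elements makes this choice multiplicative
  choose r hr using hex
  refine ⟨MonoidHom.mk' r fun g g' => Subtype.ext ?_, fun X => Subtype.ext ?_⟩
  · exact (hr (g * g')).unique t ((hr g).mul (hr g'))
  · exact (hr (slExp X)).unique t (hexp X)

section Adjoint

variable {Ψ : sl (Fin 2) ℝ →ₗ⁅ℝ⁆ 𝔤} {ρ : SL(2, ℝ) →* Inn 𝔤}

theorem monoidHom_apply_of_lie_eq_zero (hρ : ∀ X, ρ (slExp X) = innExp (Ψ X)) {c : 𝔤}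
    (hc : ∀ X, ⁅c, Ψ X⁆ = 0) (g : SL(2, ℝ)) : (ρ g : 𝔤 ≃ₗ[ℝ] 𝔤) c = c := by
  induction g using slExp_induction with
  | hexp X =>
    rw [hρ, coe_innExp]
    exact expAd_eq_self (by rw [← lie_skew, hc, neg_zero])
  | mul g k hg hk =>
    rw [map_mul]
    change (ρ g : 𝔤 ≃ₗ[ℝ] 𝔤) ((ρ k : 𝔤 ≃ₗ[ℝ] 𝔤) c) = c
    rw [hk, hg]

theorem trace_conj_eq_zero (g : SL(2, ℝ)) (X : sl (Fin 2) ℝ) :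
    (g.1 * X.1 * (g⁻¹ : SL(2, ℝ)).1).trace = 0 := by
  rw [Matrix.trace_mul_comm, ← Matrix.mul_assoc]
  change ((g⁻¹ : SL(2, ℝ)).1 * g.1 * X.1).trace = 0
  rw [DeSitter.coe_inv_mul, Matrix.one_mul]
  exact X.2

/-- The adjoint action of `SL(2,ℝ)` on its Lie algebra. -/
def slConj (g : SL(2, ℝ)) (X : sl (Fin 2) ℝ) : sl (Fin 2) ℝ :=
  ⟨g.1 * X.1 * (g⁻¹ : SL(2, ℝ)).1, trace_conj_eq_zero g X⟩

theorem slConj_mul (g k : SL(2, ℝ)) (X : sl (Fin 2) ℝ) :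
    slConj (g * k) X = slConj g (slConj k X) := by
  apply Subtype.ext
  simp only [slConj, mul_inv_rev, Matrix.SpecialLinearGroup.coe_mul, Matrix.mul_assoc]

theorem slConj_slExp (X Y : sl (Fin 2) ℝ) :
    slConj (slExp X) Y = endExp (LieAlgebra.ad ℝ _ X) Y := by
  apply Subtype.ext
  have h := endExp_commutator_intertwine (A := LieAlgebra.ad ℝ (sl (Fin 2) ℝ) X) (X := X.1)
    (sl (Fin 2) ℝ).subtype (fun Y => sl_bracket _ _ X Y) Y
  change (slExp X).1 * Y.1 * ((slExp X)⁻¹ : SL(2, ℝ)).1 = _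
  rw [slExp_inv_coe]
  exact h.symm

/-- The homomorphism intertwines the adjoint actions. -/
theorem monoidHom_apply_map (hρ : ∀ X, ρ (slExp X) = innExp (Ψ X)) (g : SL(2, ℝ))
    (X : sl (Fin 2) ℝ) : (ρ g : 𝔤 ≃ₗ[ℝ] 𝔤) (Ψ X) = Ψ (slConj g X) := by
  induction g using slExp_induction generalizing X with
  | hexp Y =>
    rw [hρ, coe_innExp, expAd_apply, slConj_slExp]
    exact (endExp_intertwine (A := LieAlgebra.ad ℝ _ Y) (B := LieAlgebra.ad ℝ 𝔤 (Ψ Y))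
      (Ψ : sl (Fin 2) ℝ →ₗ[ℝ] 𝔤) (fun Z => LieHom.map_lie Ψ Y Z) X).symm
  | mul g k hg hk =>
    rw [map_mul, slConj_mul]
    change (ρ g : 𝔤 ≃ₗ[ℝ] 𝔤) ((ρ k : 𝔤 ≃ₗ[ℝ] 𝔤) (Ψ X)) = _
    rw [hk, hg]

end Adjoint

end IntegrationToInn

/-! ### Wedges of `dS²` -/

namespace DeSitter

theorem lorentz_eq (g : SL(2, ℝ)) (x : Fin 3 → ℝ) : lorentz g x =
    ![x 0 * (g 0 0 ^ 2 + g 0 1 ^ 2 + g 1 0 ^ 2 + g 1 1 ^ 2) / 2 +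
        x 1 * (g 1 0 * g 1 1 + g 0 0 * g 0 1) +
        x 2 * (g 0 0 ^ 2 - g 0 1 ^ 2 + g 1 0 ^ 2 - g 1 1 ^ 2) / 2,
      x 0 * (g 0 0 * g 1 0 + g 0 1 * g 1 1) + x 1 * (g 0 0 * g 1 1 + g 0 1 * g 1 0) +
        x 2 * (g 0 0 * g 1 0 - g 0 1 * g 1 1),
      x 0 * (g 0 0 ^ 2 + g 0 1 ^ 2 - g 1 0 ^ 2 - g 1 1 ^ 2) / 2 +
        x 1 * (g 0 0 * g 0 1 - g 1 0 * g 1 1) +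
        x 2 * (g 0 0 ^ 2 - g 0 1 ^ 2 - g 1 0 ^ 2 + g 1 1 ^ 2) / 2] := by
  rw [lorentz, Matrix.SpecialLinearGroup.coe_inv]
  ext i
  fin_cases i <;>
    simp [ofMat, toMat, Matrix.adjugate_fin_two, Matrix.mul_apply, Fin.sum_univ_two] <;> ring

/-- The matrix `(0 1; -1 0)`, which acts on `dS²` by the rotation by `π`. -/
def halfTurn : SL(2, ℝ) := ⟨!![0, 1; -1, 0], by simp [Matrix.det_fin_two]⟩

theorem Wedge.compl_smul (g : SL(2, ℝ)) (W : Wedge) : (g • W).compl = g • W.compl :=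
  Subtype.ext (causalCompl_smul g W.1)

theorem halfTurn_smul_rightWedge : halfTurn • rightWedge = rightWedge.compl := by
  apply Subtype.ext
  change halfTurn • rightWedgeRegion = causalCompl rightWedgeRegion
  rw [causalCompl_rightWedgeRegion]
  ext x
  rw [Set.mem_smul_set_iff_inv_smul_mem]
  have e : (halfTurn⁻¹ • x).1 = ![x.1 0, -x.1 1, -x.1 2] := by
    rw [smul_val, lorentz_eq, Matrix.SpecialLinearGroup.coe_inv]
    ext i
    fin_cases i <;> simp [halfTurn, Matrix.adjugate_fin_two] <;> ring
  change |(halfTurn⁻¹ • x).1 0| < (halfTurn⁻¹ • x).1 1 ↔ _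
  rw [e]
  rfl

theorem halfTurn_mul_halfTurn_smul (W : Wedge) : (halfTurn * halfTurn) • W = W := by
  apply Subtype.ext
  change (halfTurn * halfTurn) • W.1 = W.1
  have h : ∀ x : DeSitter, (halfTurn * halfTurn) • x = x := fun x => by
    apply Subtype.ext
    rw [smul_val, lorentz_eq, Matrix.SpecialLinearGroup.coe_mul]
    ext i
    fin_cases i <;> simp [halfTurn] <;> ring
  simp only [← Set.image_smul, h, Set.image_id']

theorem Wedge.exists_eq_smul (W : Wedge) : ∃ g : SL(2, ℝ), W = g • rightWedge := by
  obtain ⟨g, hg⟩ := W.2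
  exact ⟨g, Subtype.ext hg.symm⟩

theorem Wedge.compl_compl (W : Wedge) : W.compl.compl = W := by
  obtain ⟨g, rfl⟩ := W.exists_eq_smul
  rw [compl_smul, compl_smul, ← halfTurn_smul_rightWedge, compl_smul, ← halfTurn_smul_rightWedge,
    smul_smul halfTurn, halfTurn_mul_halfTurn_smul]

theorem nonneg_of_forall_pos {a b : ℝ} (h : ∀ t : ℝ, 0 < t → 0 < 2 * t * a + (1 - t ^ 2) * b) :
    0 ≤ b := by
  have hc : Continuous fun t : ℝ => 2 * t * a + (1 - t ^ 2) * b := by fun_prop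
  have hl := (hc.tendsto 0).mono_left (nhdsWithin_le_nhds (s := Set.Ioi 0))
  have := ge_of_tendsto hl (eventually_nhdsWithin_of_forall fun t ht => (h t ht).le)
  simpa using this

/-- The stabilizer of the right wedge centralizes its boost generator. Such an element maps the
edge points `(0, 0, ±1)` into the closure of the wedge, which yields inequalities of opposite signs
and hence equations for the matrix entries. -/
theorem slConj_sigmaOne_of_smul_rightWedge {g : SL(2, ℝ)} (hg : g • rightWedge = rightWedge) :
    slConj g sigmaOne = sigmaOne := by
  have hset : ∀ x : Fin 3 → ℝ, x 1 ^ 2 + x 2 ^ 2 - x 0 ^ 2 = 1 → |x 0| < x 1 →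
      |lorentz g x 0| < lorentz g x 1 := fun x hx hlt => by
    let y : DeSitter := ⟨x, hx⟩
    have h1 : g • y ∈ g • rightWedgeRegion :=
      Set.smul_mem_smul_set (show y ∈ rightWedgeRegion from hlt)
    have h2 : g • rightWedgeRegion = rightWedgeRegion := congrArg Subtype.val hg
    rw [h2] at h1
    exact h1
  -- points of the wedge that tend to `(0, 0, ε)` on its edge as `t → 0`
  have key : ∀ ε : ℝ, ε ^ 2 = 1 → ∀ t : ℝ, 0 < t →
      |2 * t * (g 1 0 * g 1 1 + g 0 0 * g 0 1) + (1 - t ^ 2) *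
        (ε * (g 0 0 ^ 2 - g 0 1 ^ 2 + g 1 0 ^ 2 - g 1 1 ^ 2) / 2)| <
      2 * t * (g 0 0 * g 1 1 + g 0 1 * g 1 0) + (1 - t ^ 2) *
        (ε * (g 0 0 * g 1 0 - g 0 1 * g 1 1)) := by
    intro ε hε t ht
    have hp : 0 < 1 + t ^ 2 := by positivity
    have h := hset ![0, 2 * t / (1 + t ^ 2), ε * (1 - t ^ 2) / (1 + t ^ 2)] (by
      simp
      field_simp
      rw [hε]
      ring) (by simp; positivity)
    rw [lorentz_eq] at h
    simp at h
    have h' := mul_lt_mul_of_pos_left h hp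
    rw [← abs_of_pos hp, ← abs_mul, abs_of_pos hp] at h'
    refine lt_of_eq_of_lt ?_ (h'.trans_eq ?_)
    · congr 1
      field_simp
    · field_simp
  have p : ∀ ε : ℝ, ε ^ 2 = 1 →
      0 ≤ ε * (g 0 0 * g 1 0 - g 0 1 * g 1 1) -
        ε * (g 0 0 ^ 2 - g 0 1 ^ 2 + g 1 0 ^ 2 - g 1 1 ^ 2) / 2 ∧
      0 ≤ ε * (g 0 0 * g 1 0 - g 0 1 * g 1 1) +
        ε * (g 0 0 ^ 2 - g 0 1 ^ 2 + g 1 0 ^ 2 - g 1 1 ^ 2) / 2 := by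
    intro ε hε
    constructor
    · refine nonneg_of_forall_pos (a := (g 0 0 * g 1 1 + g 0 1 * g 1 0) -
        (g 1 0 * g 1 1 + g 0 0 * g 0 1)) fun t ht => ?_
      have := (abs_lt.1 (key ε hε t ht)).2
      linarith
    · refine nonneg_of_forall_pos (a := (g 0 0 * g 1 1 + g 0 1 * g 1 0) +
        (g 1 0 * g 1 1 + g 0 0 * g 0 1)) fun t ht => ?_
      have := (abs_lt.1 (key ε hε t ht)).1
      linarith
  have hpos : 0 < g 0 0 * g 1 1 + g 0 1 * g 1 0 := by
    have h := (abs_nonneg _).trans_lt (key 1 (by norm_num) 1 one_pos)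
    linarith
  obtain ⟨q1, q2⟩ := p 1 (by norm_num)
  obtain ⟨q3, q4⟩ := p (-1) (by norm_num)
  have hdet := g.det_coe
  rw [Matrix.det_fin_two] at hdet
  have e : slConj g sigmaOne = ⟨!![(g 0 1 * g 1 1 - g 0 0 * g 1 0) / 2,
      (g 0 0 ^ 2 - g 0 1 ^ 2) / 2; (g 1 1 ^ 2 - g 1 0 ^ 2) / 2,
      (g 0 0 * g 1 0 - g 0 1 * g 1 1) / 2], by
        change Matrix.trace !![(g 0 1 * g 1 1 - g 0 0 * g 1 0) / 2,
          (g 0 0 ^ 2 - g 0 1 ^ 2) / 2; (g 1 1 ^ 2 - g 1 0 ^ 2) / 2,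
          (g 0 0 * g 1 0 - g 0 1 * g 1 1) / 2] = 0
        simp [Matrix.trace_fin_two]; ring⟩ := by
    apply Subtype.ext
    change g.1 * sigmaOne.1 * (g⁻¹ : SL(2, ℝ)).1 = _
    rw [Matrix.SpecialLinearGroup.coe_inv]
    ext i j
    fin_cases i <;> fin_cases j <;>
      simp [sigmaOne, Matrix.adjugate_fin_two, Matrix.mul_apply, Fin.sum_univ_two] <;> ring
  rw [e]
  apply Subtype.ext
  generalize g 0 0 = a at *
  generalize g 0 1 = b at *
  generalize g 1 0 = c at *
  generalize g 1 1 = d at *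
  have r1 : a * c = b * d := by linarith
  have r2 : a ^ 2 - b ^ 2 = d ^ 2 - c ^ 2 := by linarith
  have r3 : (a ^ 2 - b ^ 2) ^ 2 = 1 := by
    have h1 : (a ^ 2 - b ^ 2) * (d ^ 2 - c ^ 2) = (a * d - b * c) ^ 2 - (a * c - b * d) ^ 2 := by
      ring
    rw [r1, hdet, ← r2] at h1
    linarith
  have r4 : a ^ 2 - b ^ 2 = 1 := by
    rcases sq_eq_one_iff.1 r3 with h | h
    · exact h
    · exfalso
      have h1 : d = -a := by linear_combination d * h - a * hdet - b * r1
      have h2 : c = -b := by linear_combination c * h - b * hdet - a * r1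
      rw [h1, h2] at hpos
      nlinarith [sq_nonneg a, sq_nonneg b]
  ext i j
  fin_cases i <;> fin_cases j <;> simp [sigmaOne] <;> linarith

/-- Not every conjugate of `σ₁` commutes with the boosts. -/
theorem exists_slConj_ne : ∃ (k : SL(2, ℝ)) (s : ℝ),
    slConj (slExp (s • sigmaOne)) (slConj k sigmaOne) ≠
      slConj (slExp ((-s) • sigmaOne)) (slConj k sigmaOne) := by
  by_contra! h
  -- any `k` whose conjugate of `σ₁` has a non-zero bracket with `σ₁` would do
  let k : SL(2, ℝ) := ⟨!![1, 1; 0, 1], by simp [Matrix.det_fin_two]⟩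
  have hX : (slConj k sigmaOne).1 = !![1 / 2, 0; 1 / 2, -1 / 2] := by
    change k.1 * sigmaOne.1 * (k⁻¹ : SL(2, ℝ)).1 = _
    rw [Matrix.SpecialLinearGroup.coe_inv]
    ext i j
    fin_cases i <;> fin_cases j <;> simp [k, sigmaOne, Matrix.adjugate_fin_two]
    norm_num
  -- differentiate at `s = 0`
  have h1 : ⁅sigmaOne, slConj k sigmaOne⁆ = -⁅sigmaOne, slConj k sigmaOne⁆ := by
    refine eq_of_dual_eq fun φ => ?_
    have h2 := hasDerivAt_endExp_smul (LieAlgebra.ad ℝ _ sigmaOne) φ (slConj k sigmaOne)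
    have h3 := hasDerivAt_endExp_smul (-LieAlgebra.ad ℝ _ sigmaOne) φ (slConj k sigmaOne)
    have he : ∀ s : ℝ, endExp (s • LieAlgebra.ad ℝ _ sigmaOne) (slConj k sigmaOne) =
        endExp (s • -LieAlgebra.ad ℝ _ sigmaOne) (slConj k sigmaOne) := fun s => by
      have := h k s
      rwa [slConj_slExp, slConj_slExp, map_smul, map_smul, neg_smul, ← smul_neg] at this
    simp only [he] at h2
    exact h2.unique h3
  have h2 : (⁅sigmaOne, slConj k sigmaOne⁆).1 = -(⁅sigmaOne, slConj k sigmaOne⁆).1 :=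
    congrArg Subtype.val h1
  rw [LieAlgebra.SpecialLinear.sl_bracket, hX] at h2
  have h3 := congrFun (congrFun h2 0) 0
  simp [sigmaOne] at h3
  norm_num at h3

end DeSitter

section RotationLemmas

open DeSitter

theorem mul_slExp_mul_inv (g : SL(2, ℝ)) (X : LieAlgebra.SpecialLinear.sl (Fin 2) ℝ) :
    g * slExp X * g⁻¹ = slExp (slConj g X) := by
  apply Subtype.ext
  have hinv : (g.1)⁻¹ = (g⁻¹ : SL(2, ℝ)).1 := Matrix.inv_eq_left_inv (coe_inv_mul g)
  have h := Matrix.exp_conj g.1 X.1 (IsUnit.of_mul_eq_one _ (coe_mul_inv g))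
  rw [hinv] at h
  exact h.symm

theorem slConj_halfTurn_smul_sigmaOne (s : ℝ) :
    slConj halfTurn (s • sigmaOne) = (-s) • sigmaOne := by
  apply Subtype.ext
  change halfTurn.1 * (s • sigmaOne.1) * (halfTurn⁻¹ : SL(2, ℝ)).1 = (-s) • sigmaOne.1
  rw [Matrix.SpecialLinearGroup.coe_inv]
  ext i j
  fin_cases i <;> fin_cases j <;> simp [halfTurn, sigmaOne, Matrix.adjugate_fin_two]

end RotationLemmas

/-! ### The modular data of an Euler element -/

section EulerModular

variable {𝔤 : Type*} [LieRing 𝔤] [LieAlgebra ℝ 𝔤] [FiniteDimensional ℝ 𝔤]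
  {H : Type*} [NormedAddCommGroup H] [InnerProductSpace ℂ H] {h : 𝔤} {hE : IsEuler h}

theorem continuous_evenIncl : Continuous (evenIncl h hE) := by
  refine Continuous.subtype_mk (Continuous.subtype_mk ?_ _) _
  exact continuous_subtype_val.prodMk continuous_const

variable (U : AntiunitaryRep (grading h hE) H)

theorem continuous_even_evenIncl (v : H) : Continuous fun a => U.even (evenIncl h hE a) v :=
  (U.continuous v).comp (continuous_subtype_val.comp continuous_evenIncl)

theorem odd_oddInvolution_involutive (v : H) :
    U.odd (oddInvolution h hE) rfl (U.odd (oddInvolution h hE) rfl v) = v := by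
  have e : oddInvolution h hE * oddInvolution h hE = 1 := by
    apply Subtype.ext
    refine Prod.ext ?_ rfl
    ext y
    exact (eulerInvolution h hE).left_inv y
  change (U.toHom (oddInvolution h hE) * U.toHom (oddInvolution h hE)) v = v
  rw [← map_mul, e, map_one]
  rfl

/-- Inner automorphisms fixing the Euler element commute with its involution. -/
theorem odd_oddInvolution_comm {a : Inn 𝔤} (ha : (a : 𝔤 ≃ₗ[ℝ] 𝔤) h = h) (v : H) :
    U.odd (oddInvolution h hE) rfl (U.even (evenIncl h hE a) v) =
      U.even (evenIncl h hE a) (U.odd (oddInvolution h hE) rfl v) := by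
  have hc : ∀ y, (a : 𝔤 ≃ₗ[ℝ] 𝔤) ⁅h, y⁆ = ⁅h, (a : 𝔤 ≃ₗ[ℝ] 𝔤) y⁆ := fun y => by
    rw [inn_lie, ha]
  have e : oddInvolution h hE * (evenIncl h hE a).1 = (evenIncl h hE a).1 * oddInvolution h hE := by
    apply Subtype.ext
    refine Prod.ext ?_ rfl
    ext y
    change (a : 𝔤 ≃ₗ[ℝ] 𝔤) y - (2 : ℝ) • ⁅h, ⁅h, (a : 𝔤 ≃ₗ[ℝ] 𝔤) y⁆⁆ =
      (a : 𝔤 ≃ₗ[ℝ] 𝔤) (y - (2 : ℝ) • ⁅h, ⁅h, y⁆⁆)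
    rw [map_sub, map_smul, hc, hc]
  change (U.toHom (oddInvolution h hE) * U.toHom (evenIncl h hE a).1) v =
    (U.toHom (evenIncl h hE a).1 * U.toHom (oddInvolution h hE)) v
  rw [← map_mul, e, map_mul]

theorem innExp_smul_apply_self (s : ℝ) : (innExp (s • h) : 𝔤 ≃ₗ[ℝ] 𝔤) h = h :=
  expAd_eq_self (by rw [smul_lie, lie_self, smul_zero])

/-- The conjugation `U(σ_h)` and the unitary group `Δ^{it} = U(e^{-2πt ad h})`. -/
theorem isModularData_euler : IsModularData (U.odd (oddInvolution h hE) rfl)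
    fun t => U.even (evenIncl h hE (innExp ((-(2 * Real.pi * t)) • h))) where
  map_add s t := by
    rw [← map_mul, ← map_mul, ← innExp_add_smul]
    congr 4
    ring
  continuous v := (continuous_even_evenIncl U v).comp
    ((continuous_innExp_smul h).comp (by fun_prop : Continuous fun t : ℝ => -(2 * Real.pi * t)))
  involutive := odd_oddInvolution_involutive U
  comm t := odd_oddInvolution_comm U (innExp_smul_apply_self _)

variable [CompleteSpace H]

/-- The centralizer of the Euler element in `Inn(𝔤)` preserves the standard subspace. -/
theorem map_standardSubspace_euler {a : Inn 𝔤} (ha : (a : 𝔤 ≃ₗ[ℝ] 𝔤) h = h) :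
    (isModularData_euler U).standardSubspace.map (U.even (evenIncl h hE a)) =
      (isModularData_euler U).standardSubspace := by
  refine (isModularData_euler U).map_eq_of_comm
    (fun v => (odd_oddInvolution_comm U ha v).symm) fun t => ?_
  have hc : Commute a (innExp ((-(2 * Real.pi * t)) • h)) := by
    have := inn_conj_innExp a ((-(2 * Real.pi * t)) • h)
    rw [map_smul, ha] at this
    exact mul_inv_eq_iff_eq_mul.1 this
  exact (hc.map (evenIncl h hE)).map U.even

omit [CompleteSpace H] in
/-- An inner automorphism fixes the Euler element as soon as it commutes with the modular group,
because a non-trivial representation of the simple group `Inn(𝔤)` distinguishes one-parameter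
groups. -/
theorem apply_euler_eq_self [LieAlgebra.IsSimple ℝ 𝔤]
    (hU : ∃ a : Inn 𝔤, U.even (evenIncl h hE a) ≠ 1) {a : Inn 𝔤}
    (hc : ∀ t : ℝ, Commute (U.even (evenIncl h hE a))
      (U.even (evenIncl h hE (innExp (t • h))))) : (a : 𝔤 ≃ₗ[ℝ] 𝔤) h = h := by
  refine eq_of_map_innExp_eq (π := U.even.comp (evenIncl h hE))
    (continuous_even_evenIncl U) hU fun t => ?_
  rw [← map_smul, ← inn_conj_innExp, map_mul, map_mul, map_inv]
  exact mul_inv_eq_iff_eq_mul.2 (hc t)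

/-- The stabilizer of the standard subspace in `Inn(𝔤)` fixes the Euler element. -/
theorem apply_euler_eq_self_of_map_eq [LieAlgebra.IsSimple ℝ 𝔤]
    (hU : ∃ a : Inn 𝔤, U.even (evenIncl h hE a) ≠ 1) {a : Inn 𝔤}
    (ha : (isModularData_euler U).standardSubspace.map (U.even (evenIncl h hE a)) =
      (isModularData_euler U).standardSubspace) : (a : 𝔤 ≃ₗ[ℝ] 𝔤) h = h := by
  refine apply_euler_eq_self U hU fun t => ?_
  have h1 := (isModularData_euler U).comm_of_map_eq ha (-(t / (2 * Real.pi)))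
  have e : -(2 * Real.pi * -(t / (2 * Real.pi))) = t := by
    field_simp
  rwa [e] at h1

end EulerModular

section BoostComparison

variable {𝔤 : Type*} [LieRing 𝔤] [LieAlgebra ℝ 𝔤] [FiniteDimensional ℝ 𝔤]
  {H : Type*} [NormedAddCommGroup H] [InnerProductSpace ℂ H]

/-- The modular flow `e^{s ad h}` and the boosts `ρ(exp(s σ₁))` move some translate of the standard
subspace `S` to different places, since `h = c - Ψ(σ₁)` while the boosts are generated by
`Ψ(σ₁)`. -/
theorem exists_map_ne {Ψ : LieAlgebra.SpecialLinear.sl (Fin 2) ℝ →ₗ⁅ℝ⁆ 𝔤}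
    (hinj : Function.Injective Ψ) {ρ : SL(2, ℝ) →* Inn 𝔤}
    (hρ : ∀ X, ρ (slExp X) = innExp (Ψ X)) {h c : 𝔤} (hc : ∀ X, ⁅c, Ψ X⁆ = 0)
    (hh : h = c - Ψ sigmaOne) (π : Inn 𝔤 →* (H ≃ₗᵢ[ℂ] H)) (S : StandardSubspace H)
    (hS : ∀ a : Inn 𝔤, S.map (π a) = S → (a : 𝔤 ≃ₗ[ℝ] 𝔤) h = h) :
    ∃ (k : SL(2, ℝ)) (s : ℝ), (S.map (π (ρ k))).map (π (innExp (s • h))) ≠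
      S.map (π (ρ (slExp (s • sigmaOne) * k))) := by
  obtain ⟨k, s, hne⟩ := DeSitter.exists_slConj_ne
  refine ⟨k, s, fun heq => hne ?_⟩
  have hρh : ∀ g, (ρ g : 𝔤 ≃ₗ[ℝ] 𝔤) h = c - Ψ (slConj g sigmaOne) := fun g => by
    rw [hh, map_sub, monoidHom_apply_of_lie_eq_zero hρ hc, monoidHom_apply_map hρ]
  -- equality gives an element of the stabilizer of `S`, which then fixes `h`
  have h1 : S.map (π ((innExp (s • h) * ρ k)⁻¹ * ρ (slExp (s • sigmaOne) * k))) = S := by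
    rw [← StandardSubspace.map_mul, ← map_mul] at heq
    rw [map_mul, StandardSubspace.map_mul, ← heq, ← StandardSubspace.map_mul, ← map_mul,
      inv_mul_cancel, map_one, StandardSubspace.map_one]
  have h2 : (ρ (slExp (s • sigmaOne) * k) : 𝔤 ≃ₗ[ℝ] 𝔤) h =
      (innExp (s • h) : 𝔤 ≃ₗ[ℝ] 𝔤) ((ρ k : 𝔤 ≃ₗ[ℝ] 𝔤) h) := by
    have h3 := congrArg ((innExp (s • h) * ρ k : Inn 𝔤) : 𝔤 ≃ₗ[ℝ] 𝔤) (hS _ h1)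
    rw [← LinearEquiv.mul_apply, ← Subgroup.coe_mul, mul_inv_cancel_left] at h3
    exact h3
  -- `e^{s ad c}` is central for the image of `ρ`, so the flow of `h` acts like the inverse boosts
  have hexp : innExp (s • h) = ρ (slExp ((-s) • sigmaOne)) * innExp (s • c) := by
    have e : s • h = Ψ ((-s) • sigmaOne) + s • c := by
      rw [hh, map_smul]
      module
    rw [e, innExp_add (by rw [← lie_skew, smul_lie, hc, smul_zero, neg_zero]), hρ]
  have hfix : (innExp (s • c) : 𝔤 ≃ₗ[ℝ] 𝔤) ((ρ k : 𝔤 ≃ₗ[ℝ] 𝔤) h) = (ρ k : 𝔤 ≃ₗ[ℝ] 𝔤) h := by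
    refine expAd_eq_self ?_
    rw [hρh, lie_sub, smul_lie, smul_lie, hc, lie_self, smul_zero, sub_zero]
  rw [hexp, Subgroup.coe_mul, LinearEquiv.mul_apply, hfix, ← LinearEquiv.mul_apply,
    ← Subgroup.coe_mul, ← map_mul, hρh, hρh, slConj_mul, slConj_mul] at h2
  exact hinj (sub_right_injective h2)

end BoostComparison

/-! ### Nets of standard subspaces generated by one standard subspace -/

section GeneratedNets

open DeSitter

variable {H : Type*} [NormedAddCommGroup H] [InnerProductSpace ℂ H]

/-- A standard subspace invariant under the stabilizer of the right wedge generates a net. -/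
theorem exists_net (V : SL(2, ℝ) →* (H ≃ₗᵢ[ℂ] H)) (S : StandardSubspace H)
    (hS : ∀ g, g • rightWedge = rightWedge → S.map (V g) = S) :
    ∃ N : Wedge → StandardSubspace H, ∀ g : SL(2, ℝ), N (g • rightWedge) = S.map (V g) := by
  choose γ hγ using fun W : Wedge => W.exists_eq_smul
  refine ⟨fun W => S.map (V (γ W)), fun g => ?_⟩
  have h1 := hS ((γ (g • rightWedge))⁻¹ * g) (by
    rw [mul_smul, inv_smul_eq_iff]
    exact hγ _)
  change S.map (V (γ (g • rightWedge))) = _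
  conv_lhs => rw [← h1]
  rw [← StandardSubspace.map_mul, ← map_mul, mul_inv_cancel_left]

variable {V : SL(2, ℝ) →* (H ≃ₗᵢ[ℂ] H)} {S : StandardSubspace H} {N : Wedge → StandardSubspace H}

theorem isLorentzCovariant_of_forall_smul
    (hN : ∀ g : SL(2, ℝ), N (g • rightWedge) = S.map (V g)) : IsLorentzCovariant N V := by
  intro g W
  obtain ⟨k, rfl⟩ := W.exists_eq_smul
  rw [smul_smul, hN, hN, map_mul, StandardSubspace.map_mul]

theorem IsLorentzCovariant.symplComp_compl [CompleteSpace H] (hN : IsLorentzCovariant N V)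
    {K : Wedge → StandardSubspace H} (hK : ∀ W, K W = (N W.compl).symplComp) :
    IsLorentzCovariant K V := fun g W => by
  rw [hK, hK, Wedge.compl_smul, hN, StandardSubspace.map_symplComp]

theorem IsLorentzCovariant.prod {K : Wedge → StandardSubspace H} (hN : IsLorentzCovariant N V)
    (hK : IsLorentzCovariant K V) :
    IsLorentzCovariant (fun W => (N W).prod (K W)) (doubleRep V) := fun g W => by
  change (N (g • W)).prod (K (g • W)) = _
  rw [hN, hK]
  exact (StandardSubspace.map_prod _ _ _ _).symm

/-- Modular covariance of a direct sum of nets passes to the summands. -/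
theorem IsModularCovariant.map_fst {K : Wedge → StandardSubspace H}
    (hm : IsModularCovariant fun W => (N W).prod (K W)) {g : SL(2, ℝ)}
    {J J' : H ≃ₗᵢ⋆[ℂ] H} {Δ Δ' : ℝ → H ≃ₗᵢ[ℂ] H}
    (hN : IsModularPair (N (g • rightWedge)) J Δ) (hK : IsModularPair (K (g • rightWedge)) J' Δ')
    (W : Wedge) (t : ℝ) : (N W).map (Δ (-t)) =
      N ((g * slExp ((2 * Real.pi * t) • sigmaOne) * g⁻¹) • W) := by
  have h1 := hm g W t _ _ (hN.prod hK)
  rw [StandardSubspace.map_prod] at h1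
  exact StandardSubspace.prod_left_injective h1

end GeneratedNets

end

theorem mainTheorem5
    {𝔤 : Type*} [LieRing 𝔤] [LieAlgebra ℝ 𝔤] [FiniteDimensional ℝ 𝔤] [LieAlgebra.IsSimple ℝ 𝔤]
    {H : Type*} [NormedAddCommGroup H] [InnerProductSpace ℂ H] [CompleteSpace H]
    -- a non-symmetric Euler element
    (h : 𝔤) (hE : IsEuler h) (hns : ¬ IsSymmetricEuler h)
    -- a subalgebra `b ≅ gl₂(ℝ)` containing `h`, and an identification `ψ` of `sl₂(ℝ)` with `[b, b]`
    -- such that `h = h_c - h₁` with `h_c` central in `b` and `h₁ = ψ(σ₁)`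
    (b : LieSubalgebra ℝ 𝔤) (hb : h ∈ b)
    (hgl : IsIsoGL2 b)
    (ψ : LieAlgebra.SpecialLinear.sl (Fin 2) ℝ ≃ₗ⁅ℝ⁆ LieAlgebra.derivedSeries ℝ b 1)
    (hψ : (⟨h, hb⟩ + (ψ sigmaOne : b) : b) ∈ LieAlgebra.center ℝ b)
    -- an (anti-)unitary representation of `G = Inn(𝔤) ⋊ {1, σ_h}`, non-trivial on `Inn(𝔤)`
    (U : AntiunitaryRep (grading h hE) H)
    (hU : ∃ a : Inn 𝔤, U.even (evenIncl h hE a) ≠ 1) :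
    -- the homomorphism `SL(2,ℝ) → Inn(𝔤)` integrating `ψ`, and the subspace `N_U(W_h)`
    ∃ (ρ : SL(2, ℝ) →* Inn 𝔤) (N₀ : StandardSubspace H),
      (∀ X, ρ (slExp X) = innExp ((ψ X : b) : 𝔤)) ∧
      IsModularPair N₀ (U.odd (oddInvolution h hE) rfl)
        (fun t => U.even (evenIncl h hE (innExp ((-(2 * Real.pi * t)) • h)))) ∧
      -- `N_U(W_{-h}) = N_U(W_h)'`
      IsModularPair N₀.symplComp (U.odd (oddInvolution h hE) rfl)
        (fun t => U.even (evenIncl h hE (innExp ((-(2 * Real.pi * t)) • (-h))))) ∧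
      ∃ N K : DeSitter.Wedge → StandardSubspace H,
        -- the nets generated by `N_U(W_h)` at `W_{x₁}` and by `N_U(W_h)'` at `W_{x₁}'`
        (∀ g : SL(2, ℝ), N (g • DeSitter.rightWedge) = N₀.map (U.even (evenIncl h hE (ρ g)))) ∧
        (∀ g : SL(2, ℝ), K (g • DeSitter.rightWedge.compl) =
          N₀.symplComp.map (U.even (evenIncl h hE (ρ g)))) ∧
        IsLorentzCovariant N ((U.even.comp (evenIncl h hE)).comp ρ) ∧
        ¬ IsModularCovariant N ∧
        IsLorentzCovariant K ((U.even.comp (evenIncl h hE)).comp ρ) ∧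
        ¬ IsModularCovariant K ∧
        (∀ W, N W.compl = (K W).symplComp) ∧
        -- the net `N ⊕ K`
        IsLorentzCovariant (fun W => (N W).prod (K W))
          (doubleRep ((U.even.comp (evenIncl h hE)).comp ρ)) ∧
        ¬ IsModularCovariant (fun W => (N W).prod (K W)) ∧
        (∀ g, Commute (swapOp H) (doubleRep ((U.even.comp (evenIncl h hE)).comp ρ) g)) ∧
        ∀ W : DeSitter.Wedge, (N W.compl).prod (K W.compl) =
          ((N W).prod (K W)).symplComp.map (swapOp H) := by
  let Ψ : LieAlgebra.SpecialLinear.sl (Fin 2) ℝ →ₗ⁅ℝ⁆ 𝔤 :=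
    b.incl.comp ((LieAlgebra.derivedSeries ℝ b 1).incl.comp
      (ψ : LieAlgebra.SpecialLinear.sl (Fin 2) ℝ →ₗ⁅ℝ⁆ LieAlgebra.derivedSeries ℝ b 1))
  have hinj : Function.Injective Ψ := fun X Y hXY =>
    ψ.injective (Subtype.ext (Subtype.ext hXY))
  obtain ⟨c, hcdef⟩ : ∃ c, c = h + Ψ sigmaOne := ⟨_, rfl⟩
  have hc : ∀ X, ⁅c, Ψ X⁆ = 0 := fun X => by
    have h1 := (LieModule.mem_maxTrivSubmodule ℝ b b _).1 hψ (ψ X : b)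
    rw [← lie_skew, hcdef]
    exact neg_eq_zero.2 (congrArg Subtype.val h1)
  have hh : h = c - Ψ sigmaOne := by rw [hcdef, add_sub_cancel_right]
  obtain ⟨ρ, hρ⟩ := exists_monoidHom_slExp Ψ hc (by rw [← hh]; exact hE.ad_cube)
  have D := isModularData_euler U
  have hρh : ∀ g : SL(2, ℝ), g • DeSitter.rightWedge = DeSitter.rightWedge →
      (ρ g : 𝔤 ≃ₗ[ℝ] 𝔤) h = h := fun g hg => by
    conv_lhs => rw [hh]
    rw [map_sub, monoidHom_apply_of_lie_eq_zero hρ hc, monoidHom_apply_map hρ,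
      DeSitter.slConj_sigmaOne_of_smul_rightWedge hg, ← hh]
  obtain ⟨N, hN⟩ := exists_net ((U.even.comp (evenIncl h hE)).comp ρ) D.standardSubspace
    fun g hg => map_standardSubspace_euler U (hρh g hg)
  have hNcov := isLorentzCovariant_of_forall_smul hN
  obtain ⟨K, hK⟩ : ∃ K : DeSitter.Wedge → StandardSubspace H,
    ∀ W, K W = (N W.compl).symplComp := ⟨_, fun _ => rfl⟩
  have hKcov := hNcov.symplComp_compl hK
  have hN1 : N DeSitter.rightWedge = D.standardSubspace := by
    have := hN 1
    rwa [one_smul, map_one, StandardSubspace.map_one] at this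
  have hK1 : K DeSitter.rightWedge.compl = D.standardSubspace.symplComp := by
    rw [hK, DeSitter.Wedge.compl_compl, hN1]
  have hinv : (fun t => U.even (evenIncl h hE (innExp ((-(2 * Real.pi * -t)) • h)))) =
      fun t => U.even (evenIncl h hE (innExp ((-(2 * Real.pi * t)) • (-h)))) := by
    funext t
    congr 3
    module
  -- the modular group of `N₀` does not act on the net by the boosts
  have hne : ¬ ∀ (Wb : DeSitter.Wedge) (t : ℝ),
      (N Wb).map (U.even (evenIncl h hE (innExp ((-(2 * Real.pi * -t)) • h)))) =
        N (slExp ((2 * Real.pi * t) • sigmaOne) • Wb) := by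
    intro hcov
    obtain ⟨k, s, hks⟩ := exists_map_ne hinj hρ hc hh (U.even.comp (evenIncl h hE))
      D.standardSubspace fun a ha => apply_euler_eq_self_of_map_eq U hU ha
    have h1 := hcov (k • DeSitter.rightWedge) (s / (2 * Real.pi))
    have e1 : -(2 * Real.pi * -(s / (2 * Real.pi))) = s := by field_simp
    have e2 : 2 * Real.pi * (s / (2 * Real.pi)) = s := by field_simp
    rw [e1, e2, smul_smul, hN, hN] at h1
    exact hks h1
  refine ⟨ρ, D.standardSubspace, hρ, D.isModularPair, ?_, N, K, hN,
    fun g => ?_, hNcov, fun hm => hne fun Wb t => ?_, hKcov, fun hm => ?_, fun W => ?_,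
    hNcov.prod hKcov, fun hm => hne fun Wb t => ?_, fun g => ?_, fun W => ?_⟩
  · rw [D.symplComp_standardSubspace, ← hinv]
    exact D.inverse.isModularPair
  · rw [hKcov, hK1]
    rfl
  · have h1 := hm 1 Wb t _ _ (by rw [one_smul, hN1]; exact D.isModularPair)
    rwa [one_mul, inv_one, mul_one] at h1
  · obtain ⟨k, s, hks⟩ := exists_map_ne hinj hρ hc hh (U.even.comp (evenIncl h hE))
      D.standardSubspace.symplComp fun a ha => by
        rw [← StandardSubspace.map_symplComp] at ha
        exact apply_euler_eq_self_of_map_eq U hU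
          (StandardSubspace.involutive_symplComp.injective ha)
    -- the boosts of `W_{x₁}'` are the inverse boosts of `W_{x₁}`
    have h1 := hm DeSitter.halfTurn (k • DeSitter.rightWedge.compl) (-(s / (2 * Real.pi))) _ _ (by
      rw [DeSitter.halfTurn_smul_rightWedge, hK1, D.symplComp_standardSubspace]
      exact D.inverse.isModularPair)
    have e1 : -(2 * Real.pi * -(- -(s / (2 * Real.pi)))) = s := by field_simp
    have e2 : -(2 * Real.pi * -(s / (2 * Real.pi))) = s := by field_simp
    rw [mul_slExp_mul_inv, slConj_halfTurn_smul_sigmaOne, e1, e2, smul_smul, hKcov, hKcov,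
      hK1] at h1
    exact hks h1
  · rw [hK, StandardSubspace.symplComp_symplComp_eq]
  · obtain ⟨J', V', hpair⟩ : ∃ J' V', IsModularPair (K DeSitter.rightWedge) J' V' := by
      have e : K DeSitter.rightWedge = (D.inverse.conjugate
          (((U.even.comp (evenIncl h hE)).comp ρ) DeSitter.halfTurn⁻¹)).standardSubspace := by
        rw [D.inverse.standardSubspace_conjugate, ← D.symplComp_standardSubspace, ← hK1,
          ← hKcov, ← DeSitter.halfTurn_smul_rightWedge, inv_smul_smul]
      rw [e]
      exact ⟨_, _, IsModularData.isModularPair _⟩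
    have h1 := hm.map_fst (g := 1) (by rw [one_smul, hN1]; exact D.isModularPair)
      (by rw [one_smul]; exact hpair) Wb t
    rwa [one_mul, inv_one, mul_one] at h1
  · ext x
    rfl
  · rw [StandardSubspace.prod_symplComp, StandardSubspace.prod_map_swapOp, hK, hK,
      StandardSubspace.symplComp_symplComp_eq, DeSitter.Wedge.compl_compl]
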